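/- **Setup.** Let $k$ be a field that is either algebraically closed (of any characteristic) or finite. Let $V$ be a $k$-vector space of finite dimension $D\ge 2$ and let $Q:V\to k$ be a quadratic form with associated bilinear form $\langle x,y\rangle=Q(x+y)-Q(x)-Q(y)$. Assume that $Q$ is nondegenerate, that is, the restriction of $Q$ to $\{x:\langle x,V\rangle=0\}$ is injective (nondegeneracy of a quadratic form always has this meaning below). Let $O_Q$ be the group of all $T\in GL(V)$ with $Q\circ T=Q$. Let $\bar k$ be an algebraic closure of $k$ (so $\bar k=k$ if $k$ is algebraically closed) and let $\bar V=\bar k\otimes_k V$ with the quadratic form $\tilde Q$ obtained from $Q$ by extension of scalars. Let $SO_{\tilde Q}$ be the identity component of $O_{\tilde Q}$ in the Zariski topology, and let $SO_Q$ be the set of all $g\in O_Q$ whose extension to $\bar V$ lies in $SO_{\tilde Q}$. **$Q$-filtrations.** A $Q$-filtration of $V$ is a family $X^*=(X^{\ge a})_{a\in\mathbb Z}$ of subspaces of $V$ with $X^{\ge a+1}\subseteq X^{\ge a}$ for all $a$, $X^{\ge a}=0$ for some $a$, $X^{\ge a}=V$ for some $a$, and, for every $a\ge 1$, $Q|_{X^{\ge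 a}}=0$ and $X^{\ge 1-a}=(X^{\ge a})^\perp$. Set $\mathrm{gr}^a X^*=X^{\ge a}/X^{\ge a+1}$ and $\mathrm{gr}X^*=\bigoplus_a\mathrm{gr}^aX^*$, with the quadratic form $\bar Q\big(\sum_a x_a\big)=Q(\dot x_0)+\sum_{a\ge1}\langle\dot x_{-a},\dot x_a\rangle$, where $\dot x_a\in X^{\ge a}$ represents $x_a\in\mathrm{gr}^aX^*$, and with its associated bilinear form, again written $\langle\,,\rangle$. Let $E^2\,\mathrm{gr}X^*$ be the set of all linear maps $T:\mathrm{gr}X^*\to\mathrm{gr}X^*$ with $T(\mathrm{gr}^a X^*)\subseteq\mathrm{gr}^{a+2}X^*$ for all $a$, $\langle Tx,y\rangle+\langle x,Ty\rangle=0$ for all $x,y$, and $\langle x,Tx\rangle=0$ for all $x\in\mathrm{gr}^{-1}X^*$. Let $E^2_*\,\mathrm{gr}X^*$ be the set of all $T\in E^2\,\mathrm{gr}X^*$ such that for every even $a\ge0$ the quadratic form $x\mapsto\bar Q(T^{a/2}x)$ on $\mathrm{gr}^{-a}X^*$ is nondegenerate, and for every odd $a\ge1$ the symplectic form $(x,y)\mapsto\langle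 x,T^ay\rangle$ on $\mathrm{gr}^{-a}X^*$ is nondegenerate. Let $E^{\ge2}X^*$ be the set of all $N\in\mathrm{End}(V)$ such that $1+N$ is a unipotent element of $O_Q$ and $NX^{\ge a}\subseteq X^{\ge a+2}$ for all $a$. Each such $N$ induces a linear map $\bar N:\mathrm{gr}X^*\to\mathrm{gr}X^*$ of degree $2$. Let $E^{\ge2}_*X^*$ be the set of all $N\in E^{\ge2}X^*$ with $\bar N\in E^2_*\,\mathrm{gr}X^*$. **Index set.** Let $\tilde{\mathcal F}^D$ be the set of all families $f=(f_a)_{a\in\mathbb Z}$ of natural numbers with $\sum_af_a=D$, $f_a=f_{-a}$ for all $a$, $f_0\ge f_{-2}\ge f_{-4}\ge\cdots$, $f_{-1}\ge f_{-3}\ge f_{-5}\ge\cdots$, and $f_a$ even for all odd $a$. If $D$ is odd put $\mathcal F^D=\tilde{\mathcal F}^D$. If $D$ is even, let $J$ be the set of $SO_{\tilde Q}$-orbits on the set of $D/2$-dimensional subspaces of $\bar V$ on which $\tilde Q$ is zero, and put $\mathcal F^D=\{f\in\tilde{\mathcal F}^D:f_0>0\}\sqcup\big(J\times\{f\in\tilde{\mathcal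 F}^D:f_0=0\}\big)$. For $\varphi\in\mathcal F^D$ of the form $f$ or $(j,f)$, let $\mathcal Y_\varphi$ be the set of all pairs $(X^*,N)$ where $X^*$ is a $Q$-filtration of $V$ with $\dim\mathrm{gr}^aX^*=f_a$ for all $a$ and, if $\varphi=(j,f)$, with $X^{\ge0}=X^{\ge1}$ and $\bar k\otimes_kX^{\ge0}\in j$, and where $N\in E^{\ge2}_*X^*$. **Theorem 1.7.** 1. For every unipotent element $g\in SO_Q$ there is a unique $Q$-filtration $X^*$ of $V$ such that $g-1\in E^{\ge2}_*X^*$. 2. The assignment $\Psi(X^*,N)=1+N$ defines a bijection $$\Psi:\bigsqcup_{\varphi\in\mathcal F^D}\mathcal Y_\varphi\to\{g\in SO_Q: g\text{ unipotent}\}.$$ 3. The sets $\Xi_\varphi=\Psi(\mathcal Y_\varphi)$, $\varphi\in\mathcal F^D$, are pairwise disjoint and their union is the set of all unipotent elements of $SO_Q$. -/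

import Mathlib

open scoped DirectSum

noncomputable section

namespace OrthUnip

universe u v

/-! ### Quadratic forms and their orthogonal groups -/

section Forms

variable {k : Type*} [Field k] {V : Type*} [AddCommGroup V] [Module k V]

/-- The radical `R` of the bilinear form `⟨x, y⟩ = Q (x + y) - Q x - Q y` attached to `Q`. -/
def formRad (Q : QuadraticForm k V) : Set V :=
  {x | ∀ y, QuadraticMap.polar Q x y = 0}

/-- `Q` is nondegenerate: its restriction to the radical of its bilinear form is injective. -/
def IsNondeg (Q : QuadraticForm k V) : Prop :=
  Set.InjOn Q (formRad Q)

/-- `W^⊥` with respect to the bilinear form of `Q`. -/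
def perp (Q : QuadraticForm k V) (W : Submodule k V) : Submodule k V :=
  LinearMap.BilinForm.orthogonal Q.polarBilin W

/-- The orthogonal group `O_Q`, as a set of endomorphisms. -/
def orthGroup (Q : QuadraticForm k V) : Set (Module.End k V) :=
  {T | IsUnit T ∧ ∀ x, Q (T x) = Q x}

/-- `T` is unipotent: `T - 1` is nilpotent. -/
def IsUnipotent (T : Module.End k V) : Prop :=
  IsNilpotent (T - 1)

/-- The set of all `N` such that `1 + N` is a unipotent element of `O_Q`. -/
def unipShift (Q : QuadraticForm k V) : Set (Module.End k V) :=
  {N | 1 + N ∈ orthGroup Q ∧ IsUnipotent (1 + N)}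

end Forms

/-! ### The Zariski topology and the special orthogonal group -/

section Zariski

/-- The algebra of polynomial functions on a vector space: the functions that are polynomials in
linear functionals. -/
def polyFun (K : Type*) [Field K] (E : Type*) [AddCommGroup E] [Module K E] :
    Subalgebra K (E → K) :=
  Algebra.adjoin K (Set.range fun l : Module.Dual K E => (l : E → K))

/-- The Zariski topology of a vector space, with the basis of open sets `{x | f x ≠ 0}` for `f` a
polynomial function. -/
@[reducible]
def zariski (K : Type*) [Field K] (E : Type*) [AddCommGroup E] [Module K E] :
    TopologicalSpace E :=
  TopologicalSpace.generateFrom {U | ∃ f ∈ polyFun K E, U = {x | f x ≠ 0}}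

variable {K : Type*} [Field K] {W : Type*} [AddCommGroup W] [Module K W]

/-- The identity component of `O_Q` for the Zariski topology. Over an algebraically closed field
this is the special orthogonal group. (The Zariski topology of `GL(W)` is the one induced from
`End(W)`.) -/
def identityComponent (Q : QuadraticForm K W) : Set (Module.End K W) :=
  @connectedComponentIn (Module.End K W) (zariski K (Module.End K W)) (orthGroup Q) 1

/-- The set of subspaces of half the dimension of `W` on which `Q` is zero. -/
def halfIsotropic (Q : QuadraticForm K W) : Set (Submodule K W) :=
  {S | 2 * Module.finrank K S = Module.finrank K W ∧ ∀ x ∈ S, Q x = 0}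

/-- The set `J` of orbits of the identity component of `O_Q` on `halfIsotropic Q`. -/
def isotropicOrbits (Q : QuadraticForm K W) : Set (Set (Submodule K W)) :=
  {j | ∃ S ∈ halfIsotropic Q, j = {S' | ∃ g ∈ identityComponent Q, S' = S.map g}}

variable {k : Type*} [Field k] [Algebra k K] {V : Type*} [AddCommGroup V] [Module k V]
  [Module k W] [IsScalarTower k K W]

/-- `SO_Q` for a form `Q` on a `k`-vector space `V`. Here `ι : V → W` is an extension of scalars
from `k` to an algebraic closure `K`, and `QK` is the quadratic form on `W` which extends `Q`.
The elements of `SO_Q` are the elements of `O_Q` whose extension to `W` lies in the identity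
component of `O_QK`. If `k` is algebraically closed, one can take `K = k`, `W = V`, `ι = id`,
`QK = Q`, and `SO_Q` is the identity component of `O_Q`. -/
def specialOrth (Q : QuadraticForm k V) (ι : V →ₗ[k] W) (QK : QuadraticForm K W) :
    Set (Module.End k V) :=
  {T | T ∈ orthGroup Q ∧ ∃ T' ∈ identityComponent QK, ∀ v, T' (ι v) = ι (T v)}

end Zariski

/-! ### Graded quadratic spaces -/

section Graded

variable {k : Type*} [Field k] {G : ℤ → Type*} [∀ a, AddCommGroup (G a)] [∀ a, Module k (G a)]

/-- The set `E² G` attached to a quadratic form on a graded vector space `⨁ a, G a`. -/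
def E2 (q : QuadraticForm k (⨁ a, G a)) : Set (Module.End k (⨁ a, G a)) :=
  {T | (∀ (a : ℤ) (x : G a), ∃ y : G (a + 2),
          T (DirectSum.lof k ℤ G a x) = DirectSum.lof k ℤ G (a + 2) y) ∧
       (∀ x y, QuadraticMap.polar q (T x) y + QuadraticMap.polar q x (T y) = 0) ∧
       (∀ x : G (-1), QuadraticMap.polar q (DirectSum.lof k ℤ G (-1) x)
          (T (DirectSum.lof k ℤ G (-1) x)) = 0)}

/-- The set `E²_* G` of all `T ∈ E² G` such that
* for even `a = 2 n ≥ 0` the quadratic form `x ↦ q (T ^ (a / 2) x)` on `G (-a)` is nondegenerate;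
* for odd `a = 2 n + 1 ≥ 1` the symplectic form `(x, y) ↦ ⟨x, T ^ a y⟩` on `G (-a)` is
  nondegenerate. -/
def E2Star (q : QuadraticForm k (⨁ a, G a)) : Set (Module.End k (⨁ a, G a)) :=
  {T | T ∈ E2 q ∧
       (∀ n : ℕ, IsNondeg (q.comp ((T ^ n).comp (DirectSum.lof k ℤ G (-(2 * n : ℤ)))))) ∧
       (∀ (n : ℕ) (x : G (-(2 * n + 1 : ℤ))),
          (∀ y : G (-(2 * n + 1 : ℤ)),
            QuadraticMap.polar q (DirectSum.lof k ℤ G _ x)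
              ((T ^ (2 * n + 1)) (DirectSum.lof k ℤ G _ y)) = 0) → x = 0)}

end Graded

/-! ### `Q`-filtrations -/

section Filtrations

variable {k : Type u} [Field k] {V : Type v} [AddCommGroup V] [Module k V]

/-- A `Q`-filtration of `V`: `X a` is the subspace usually denoted by `X^{≥ a}`. -/
@[ext]
structure QFiltration (Q : QuadraticForm k V) where
  X : ℤ → Submodule k V
  succ_le : ∀ a, X (a + 1) ≤ X a
  exists_eq_bot : ∃ a, X a = ⊥
  exists_eq_top : ∃ a, X a = ⊤
  isotropic : ∀ a, 1 ≤ a → ∀ x ∈ X a, Q x = 0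
  eq_perp : ∀ a, 1 ≤ a → X (1 - a) = perp Q (X a)

namespace QFiltration

variable {Q : QuadraticForm k V} (F : QFiltration Q)

/-- The graded piece `gr^a X = X^{≥ a} / X^{≥ a + 1}`. -/
abbrev gr (a : ℤ) : Type v :=
  (F.X a) ⧸ ((F.X (a + 1)).submoduleOf (F.X a))

theorem polar_zero_one {x y : V} (hx : x ∈ F.X 0) (hy : y ∈ F.X 1) :
    QuadraticMap.polar Q y x = 0 := by
  have h := F.eq_perp 1 le_rfl
  rw [sub_self] at h
  rw [h] at hx
  exact hx y hy

theorem polar_eq_zero {a : ℤ} (ha : 1 ≤ a) {x y : V} (hx : x ∈ F.X a) (hy : y ∈ F.X (1 - a)) :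
    QuadraticMap.polar Q x y = 0 := by
  rw [F.eq_perp a ha] at hy
  exact hy x hx

/-- The form induced by `Q` on `gr^0 X`. -/
def zeroForm : QuadraticForm k (F.gr 0) :=
  (Q.comp (F.X 0).subtype).lift ((F.X (0 + 1)).submoduleOf (F.X 0)) (by
    intro y hy
    have hy1 : (y : V) ∈ F.X 1 := by
      have h : (y : V) ∈ F.X (0 + 1) := hy
      rwa [zero_add] at h
    refine ⟨F.isotropic 1 le_rfl _ hy1, ?_⟩
    refine LinearMap.mem_ker.mpr (LinearMap.ext fun x => ?_)
    have h := F.polar_zero_one x.2 hy1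
    simpa [QuadraticMap.polar] using h)

/-- The bilinear form of `Q` on `X^{≥ a} × X^{≥ b}`. -/
def restrictedPairing (a b : ℤ) : F.X a →ₗ[k] F.X b →ₗ[k] k :=
  Q.polarBilin.compl₁₂ (F.X a).subtype (F.X b).subtype

theorem restrictedPairing_left (a : ℤ) (ha : 1 ≤ a) :
    (F.X (a + 1)).submoduleOf (F.X a) ≤ LinearMap.ker (F.restrictedPairing a (-a)) := by
  intro x hx
  refine LinearMap.mem_ker.mpr (LinearMap.ext fun y => ?_)
  have hx' : (x : V) ∈ F.X (a + 1) := hx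
  have hy' : (y : V) ∈ F.X (1 - (a + 1)) := by
    have h := y.2
    rwa [show 1 - (a + 1) = -a by ring]
  exact F.polar_eq_zero (by omega) hx' hy'

theorem restrictedPairing_right (a : ℤ) (ha : 1 ≤ a) :
    (F.X (-a + 1)).submoduleOf (F.X (-a)) ≤ LinearMap.ker (F.restrictedPairing a (-a)).flip := by
  intro y hy
  refine LinearMap.mem_ker.mpr (LinearMap.ext fun x => ?_)
  have hy' : (y : V) ∈ F.X (1 - a) := by
    have h : (y : V) ∈ F.X (-a + 1) := hy
    rwa [show 1 - a = -a + 1 by ring]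
  exact F.polar_eq_zero ha x.2 hy'

/-- The pairing `gr^a X × gr^{-a} X → k` induced by the bilinear form of `Q`, for `a ≥ 1`. -/
def pairing (a : ℤ) (ha : 1 ≤ a) : F.gr a →ₗ[k] F.gr (-a) →ₗ[k] k :=
  LinearMap.liftQ₂ _ _ (F.restrictedPairing a (-a))
    (F.restrictedPairing_left a ha) (F.restrictedPairing_right a ha)

/-- The bilinear form `(x, y) ↦ ∑_{a ≥ 1} ⟨x_a, y_{-a}⟩` on `gr X`. -/
def halfForm : (⨁ a, F.gr a) →ₗ[k] (⨁ a, F.gr a) →ₗ[k] k :=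
  DirectSum.toModule k ℤ _ fun a =>
    if ha : 1 ≤ a then
      (LinearMap.lcomp k k (DirectSum.component k ℤ F.gr (-a))).comp (F.pairing a ha)
    else 0

/-- The quadratic form `x ↦ Q (x_0) + ∑_{a ≥ 1} ⟨x_{-a}, x_a⟩` on `gr X`, where `Q` and the bilinear
form are evaluated at representatives. -/
def gradedForm : QuadraticForm k (⨁ a, F.gr a) :=
  F.zeroForm.comp (DirectSum.component k ℤ F.gr 0) + LinearMap.BilinMap.toQuadraticMap F.halfForm

/-- The set `E^{≥ 2} X` of all `N` with `1 + N` unipotent in `O_Q` and `N X^{≥ a} ⊆ X^{≥ a + 2}` for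
all `a`. -/
def E2ge : Set (Module.End k V) :=
  {N | N ∈ unipShift Q ∧ ∀ a, ∀ x ∈ F.X a, N x ∈ F.X (a + 2)}

/-- The endomorphism of `gr X` induced by an endomorphism `N` such that
`N X^{≥ a} ⊆ X^{≥ a + 2}` for all `a`. -/
def gradedMap (N : Module.End k V) (hN : ∀ a, ∀ x ∈ F.X a, N x ∈ F.X (a + 2)) :
    Module.End k (⨁ a, F.gr a) :=
  DirectSum.toModule k ℤ _ fun a =>
    (DirectSum.lof k ℤ F.gr (a + 2)).comp
      (Submodule.mapQ _ _ (N.restrict (hN a)) (by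
        intro x hx
        have h : N (x : V) ∈ F.X (a + 1 + 2) := hN (a + 1) x hx
        rw [add_right_comm] at h
        exact h))

/-- The set `E^{≥ 2}_* X` of all `N ∈ E^{≥ 2} X` whose induced map on `gr X` lies in `E²_* (gr X)`. -/
def E2geStar : Set (Module.End k V) :=
  {N | ∃ h : N ∈ F.E2ge, F.gradedMap N h.2 ∈ E2Star F.gradedForm}

end QFiltration

end Filtrations

/-! ### The index set and the pieces -/

section Pieces

/-- The admissible dimension vectors of total dimension `D`. -/
def dimVectors (D : ℕ) : Set (ℤ →₀ ℕ) :=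
  {f | (f.sum fun _ n => n) = D ∧
       (∀ a, f a = f (-a)) ∧
       (∀ n : ℕ, f (-(2 * n + 2 : ℤ)) ≤ f (-(2 * n : ℤ))) ∧
       (∀ n : ℕ, f (-(2 * n + 3 : ℤ)) ≤ f (-(2 * n + 1 : ℤ))) ∧
       (∀ a : ℤ, Odd a → Even (f a))}

variable {k : Type*} [Field k] {K : Type*} [Field K] [Algebra k K]
  {V : Type*} [AddCommGroup V] [Module k V]
  {W : Type*} [AddCommGroup W] [Module K W] [Module k W] [IsScalarTower k K W]

/-- The index set of the pieces: for `D` odd it consists of the admissible dimension vectors `f`;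
for `D` even, of those with `f 0 > 0` together with the pairs `(j, f)`, where `j ∈ J` and `f` is an
admissible dimension vector with `f 0 = 0`. -/
abbrev PieceIndex (D : ℕ) (QK : QuadraticForm K W) : Type _ :=
  {f : ℤ →₀ ℕ // f ∈ dimVectors D ∧ (Even D → 0 < f 0)} ⊕
    ({j : Set (Submodule K W) // j ∈ isotropicOrbits QK} ×
      {f : ℤ →₀ ℕ // f ∈ dimVectors D ∧ Even D ∧ f 0 = 0})

/-- The `Q`-filtrations of type `φ`. For `φ = (j, f)` the condition is that `X^{≥ 0} = X^{≥ 1}` and that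
the extension of scalars of this subspace belongs to the orbit `j`. -/
def filtrationsOfType (Q : QuadraticForm k V) (ι : V →ₗ[k] W) (QK : QuadraticForm K W) {D : ℕ} :
    PieceIndex D QK → Set (QFiltration Q)
  | Sum.inl f => {F | ∀ a, Module.finrank k (F.gr a) = f.1 a}
  | Sum.inr (j, f) => {F | (∀ a, Module.finrank k (F.gr a) = f.1 a) ∧ F.X 0 = F.X 1 ∧
      Submodule.span K (ι '' (F.X 0 : Set V)) ∈ j.1}

/-- The set `𝒴_φ` of pairs `(X, N)` with `X` of type `φ` and `N ∈ E^{≥ 2}_* X`. -/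
def pieceY (Q : QuadraticForm k V) (ι : V →ₗ[k] W) (QK : QuadraticForm K W) {D : ℕ}
    (φ : PieceIndex D QK) : Set (QFiltration Q × Module.End k V) :=
  {p | p.1 ∈ filtrationsOfType Q ι QK φ ∧ p.2 ∈ p.1.E2geStar}

/-- The map `Ψ : ⨆ φ, 𝒴_φ → End V`, `(X, N) ↦ 1 + N`. -/
def Psi (Q : QuadraticForm k V) (ι : V →ₗ[k] W) (QK : QuadraticForm K W) (D : ℕ) :
    (Σ φ : PieceIndex D QK, pieceY Q ι QK φ) → Module.End k V :=
  fun z => 1 + z.2.1.2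

/-- The set `Ξ_φ = Ψ (𝒴_φ)`. -/
def pieceXi (Q : QuadraticForm k V) (ι : V →ₗ[k] W) (QK : QuadraticForm K W) {D : ℕ}
    (φ : PieceIndex D QK) : Set (Module.End k V) :=
  {g | ∃ p : pieceY Q ι QK φ, g = Psi Q ι QK D ⟨φ, p⟩}

/-- The set of unipotent elements of `SO_Q`. -/
def unipotentSO (Q : QuadraticForm k V) (ι : V →ₗ[k] W) (QK : QuadraticForm K W) :
    Set (Module.End k V) :=
  {g | g ∈ specialOrth Q ι QK ∧ IsUnipotent g}

end Pieces

end OrthUnip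

end

/-!
The proof rests on one description of the pairs `(X, N)`: `N` lies in `E^{≥2}_* X` iff `1 + N` is a
unipotent isometry and `N` is *adapted* to `X`, meaning that `N` raises the filtration by two and
the forms `Q (N ^ (a / 2) x)`, for even `a ≥ 0`, and `⟨x, N ^ a y⟩`, for odd `a ≥ 1`, on `X^{≥ -a}`
detect every element outside `X^{≥ 1-a}`; see `IsAdapted` and `QFiltration.mem_E2geStar_iff`.

**Uniqueness** (`IsAdapted.unique`). For `a ≥ 1` the term `X^{≥ -a}` is the orthogonal complement of
`X^{≥ a+1}`, nondegeneracy determines `X^{≥ 1-a}` inside `X^{≥ -a}` from `N` alone, and the isotropic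
subspace `X^{≥ a}` is determined by its orthogonal complement `X^{≥ 1-a}`. So the terms are determined
one after the other, in descending order of `a`.

**Existence** (`exists_isAdapted`). Let `m` be a bound for the degrees that can occur. The top
piece `U = X^{≥ m}` is the image of `N ^ m`, in characteristic two possibly enlarged by a vector `w`
that represents the square root of the form `x ↦ Q (N ^ (m / 2) x)` on the kernel of `N ^ m`
(`exists_top_piece`). Induction on `m` applies to the isometry induced on `U^⊥ / U`, and a filtration
there pulls back to `V` with `U` placed on top and `U^⊥` as the last step before `V`
(`isAdapted_pullback`). The step fails only if `U` is not isotropic because `Q w ≠ 0`. Then the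
characteristic is two, `m = 2`, the bilinear form is nondegenerate, `Q w = 1`, and `1 + N` multiplied
by the reflection in `w` acts trivially on the graded space of some `Q`-filtration (`IsOddShift`).

**The identity component.** An isometry acting trivially on `gr X` is contracted to `1` by the
one-parameter group that scales an adapted basis by the weights of `X`, which is an isometric
action; the resulting curve, a polynomial image of the affine line, is connected, so the isometry
belongs to the identity component (`endHom_mem_identityComponent`). This puts `1 + N` into `SO_Q`
for every adapted `N`, and it shows that in the exceptional case, if `1 + N` were in `SO_Q`, the
reflection itself would belong to the identity component. The Dickson invariant, which is a
polynomial function on the orthogonal group with values in `{0, 1}` and takes the value `1` on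
reflections, excludes that (`reflection_notMem_identityComponent`). So every unipotent element of
`SO_Q` has an adapted filtration.

**The pieces.** The form pairs `gr^{-a}` with `gr^a`, the map `N` embeds `gr^{-a}` into `gr^{-a+2}`
for `a ≥ 2`, and `gr^{-a}` carries a symplectic form for odd `a ≥ 1`; hence the dimensions form an
admissible vector (`IsAdapted.exists_dimVector`). Together with the disjointness of the orbits of
maximal isotropic subspaces this gives each filtration exactly one type (`bijOn_Psi`).
-/

open scoped DirectSum

noncomputable section

namespace OrthUnip

universe u v

/-! ### The graded conditions in terms of the filtration -/

namespace QFiltration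

variable {k : Type u} [Field k] {V : Type v} [AddCommGroup V] [Module k V]
variable {Q : QuadraticForm k V} (F : QFiltration Q)

theorem antitone : Antitone F.X :=
  antitone_int_of_succ_le F.succ_le

/-- The homogeneous element of degree `a` of `gr X` represented by `x ∈ X^{≥ a}`. -/
def homog (a : ℤ) (x : V) (hx : x ∈ F.X a) : ⨁ a, F.gr a :=
  DirectSum.lof k ℤ F.gr a (Submodule.Quotient.mk ⟨x, hx⟩)

theorem homog_congr {a b : ℤ} (h : a = b) {x : V} (hx : x ∈ F.X a) :
    F.homog a x hx = F.homog b x (h ▸ hx) := by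
  subst h; rfl

theorem mk_eq_zero_iff {a : ℤ} {x : V} (hx : x ∈ F.X a) :
    (Submodule.Quotient.mk ⟨x, hx⟩ : F.gr a) = 0 ↔ x ∈ F.X (a + 1) := by
  rw [Submodule.Quotient.mk_eq_zero]; rfl

theorem halfForm_homog (a b : ℤ) (x y : V) (hx : x ∈ F.X a) (hy : y ∈ F.X b) :
    F.halfForm (F.homog a x hx) (F.homog b y hy) =
      if 1 ≤ a ∧ a + b = 0 then QuadraticMap.polar Q x y else 0 := by
  rw [halfForm, homog, DirectSum.toModule_lof]
  by_cases ha : 1 ≤ a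
  · rw [dif_pos ha]
    by_cases hab : a + b = 0
    · obtain rfl : b = -a := by omega
      rw [if_pos ⟨ha, hab⟩]
      simp only [homog, LinearMap.comp_apply, LinearMap.lcomp_apply, DirectSum.component.lof_self]
      rfl
    · rw [if_neg (by tauto)]
      simp only [homog, LinearMap.comp_apply, LinearMap.lcomp_apply]
      rw [DirectSum.component.of, dif_neg (by omega), map_zero]
  · rw [dif_neg ha, if_neg (by tauto)]; rfl

theorem component_zero_homog {a : ℤ} (ha : a ≠ 0) (x : V) (hx : x ∈ F.X a) :
    DirectSum.component k ℤ F.gr 0 (F.homog a x hx) = 0 := by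
  rw [homog, DirectSum.component.of, dif_neg ha]

theorem gradedForm_homog_zero (x : V) (hx : x ∈ F.X 0) :
    F.gradedForm (F.homog 0 x hx) = Q x := by
  rw [gradedForm, _root_.add_apply, LinearMap.BilinMap.toQuadraticMap_apply,
    F.halfForm_homog, if_neg (by omega), add_zero, QuadraticMap.comp_apply, homog,
    DirectSum.component.lof_self]
  rfl

theorem polar_gradedForm_homog (a b : ℤ) (x y : V) (hx : x ∈ F.X a) (hy : y ∈ F.X b) :
    QuadraticMap.polar F.gradedForm (F.homog a x hx) (F.homog b y hy) =
      if a + b = 0 then QuadraticMap.polar Q x y else 0 := by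
  have key : QuadraticMap.polar F.gradedForm (F.homog a x hx) (F.homog b y hy) =
      QuadraticMap.polar F.zeroForm (DirectSum.component k ℤ F.gr 0 (F.homog a x hx))
        (DirectSum.component k ℤ F.gr 0 (F.homog b y hy)) +
      (F.halfForm (F.homog a x hx) (F.homog b y hy) +
        F.halfForm (F.homog b y hy) (F.homog a x hx)) := by
    simp only [QuadraticMap.polar, gradedForm, _root_.add_apply, QuadraticMap.comp_apply,
      LinearMap.BilinMap.toQuadraticMap_apply, map_add, LinearMap.add_apply]
    ring
  rw [key, F.halfForm_homog, F.halfForm_homog]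
  by_cases ha : a = 0
  · subst ha
    by_cases hb : b = 0
    · subst hb
      simp only [homog, DirectSum.component.lof_self]
      rw [if_neg (by omega), if_neg (by omega), if_pos (by omega), add_zero, add_zero]
      rfl
    · rw [F.component_zero_homog hb, QuadraticMap.polar_zero_right, if_neg (by omega),
        if_neg (by omega), if_neg (by omega)]
      simp
  · rw [F.component_zero_homog ha, QuadraticMap.polar_zero_left]
    by_cases hab : a + b = 0
    · rcases lt_or_gt_of_ne ha with h | h
      · rw [if_neg (by omega), if_pos (by omega), if_pos hab, QuadraticMap.polar_comm]; simp
      · rw [if_pos (by omega), if_neg (by omega), if_pos hab]; simp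
    · rw [if_neg (by omega), if_neg (by omega), if_neg hab]; simp

variable {F} {N : Module.End k V}

theorem gradedMap_homog (hN : ∀ a, ∀ x ∈ F.X a, N x ∈ F.X (a + 2)) (a : ℤ) (x : V)
    (hx : x ∈ F.X a) :
    F.gradedMap N hN (F.homog a x hx) = F.homog (a + 2) (N x) (hN a x hx) := by
  rw [gradedMap, homog, DirectSum.toModule_lof]
  rfl

theorem pow_mem (hN : ∀ a, ∀ x ∈ F.X a, N x ∈ F.X (a + 2)) (n : ℕ) {a : ℤ} {x : V}
    (hx : x ∈ F.X a) : (N ^ n) x ∈ F.X (a + 2 * n) := by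
  induction n with
  | zero => simpa using hx
  | succ n ih =>
    rw [pow_succ', Module.End.mul_apply]
    have := hN _ _ ih
    convert this using 2
    push_cast; ring

theorem gradedMap_pow_homog (hN : ∀ a, ∀ x ∈ F.X a, N x ∈ F.X (a + 2)) (n : ℕ) (a : ℤ) (x : V)
    (hx : x ∈ F.X a) :
    (F.gradedMap N hN ^ n) (F.homog a x hx) = F.homog (a + 2 * n) ((N ^ n) x)
      (pow_mem hN n hx) := by
  induction n with
  | zero => exact F.homog_congr (show a = a + 2 * (0 : ℕ) by simp) hx
  | succ n ih =>
    rw [pow_succ', Module.End.mul_apply, ih, gradedMap_homog hN]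
    have h : (N ^ (n + 1)) x = N ((N ^ n) x) := by rw [pow_succ', Module.End.mul_apply]
    simp only [h]
    exact F.homog_congr (by push_cast; ring) _

variable (F N) in
/-- `N` raises degrees by two and is as nondegenerate as possible on the graded pieces: the
elementary form of the conditions that define `E^{≥ 2}_* X`. -/
structure IsAdapted : Prop where
  map_mem : ∀ a, ∀ x ∈ F.X a, N x ∈ F.X (a + 2)
  even : ∀ n : ℕ, ∀ x ∈ F.X (-(2 * n : ℤ)),
    (∀ y ∈ F.X (-(2 * n : ℤ)), QuadraticMap.polar Q ((N ^ n) x) ((N ^ n) y) = 0) →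
      Q ((N ^ n) x) = 0 → x ∈ F.X (-(2 * n : ℤ) + 1)
  odd : ∀ n : ℕ, ∀ x ∈ F.X (-(2 * n + 1 : ℤ)),
    (∀ y ∈ F.X (-(2 * n + 1 : ℤ)), QuadraticMap.polar Q x ((N ^ (2 * n + 1)) y) = 0) →
      x ∈ F.X (-(2 * n + 1 : ℤ) + 1)

theorem isNondeg_iff {W : Type*} [AddCommGroup W] [Module k W] (q : QuadraticForm k W) :
    IsNondeg q ↔ ∀ x, (∀ y, QuadraticMap.polar q x y = 0) → q x = 0 → x = 0 := by
  constructor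
  · intro h x hx h0
    exact h (show x ∈ formRad q from hx) (show (0 : W) ∈ formRad q from fun y => by simp)
      (by simp [h0])
  · intro h x hx y hy hxy
    have h1 : ∀ z, QuadraticMap.polar q (x - y) z = 0 := fun z => by
      rw [QuadraticMap.polar_sub_left, hx z, hy z, sub_zero]
    have h2 : q (x - y) = 0 := by
      have e1 := hx (-y)
      have e2 := hy y
      rw [QuadraticMap.polar, QuadraticMap.map_neg, ← sub_eq_add_neg] at e1
      rw [QuadraticMap.polar_self] at e2
      rw [hxy] at e1
      linear_combination e1 + e2
    exact sub_eq_zero.mp (h _ h1 h2)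

theorem isNondeg_comp_iff (hN : ∀ a, ∀ x ∈ F.X a, N x ∈ F.X (a + 2)) (n : ℕ) :
    IsNondeg (F.gradedForm.comp ((F.gradedMap N hN ^ n).comp
      (DirectSum.lof k ℤ F.gr (-(2 * n : ℤ))))) ↔
    ∀ x ∈ F.X (-(2 * n : ℤ)),
    (∀ y ∈ F.X (-(2 * n : ℤ)), QuadraticMap.polar Q ((N ^ n) x) ((N ^ n) y) = 0) →
      Q ((N ^ n) x) = 0 → x ∈ F.X (-(2 * n : ℤ) + 1) := by
  have hval : ∀ x : F.X (-(2 * n : ℤ)), (F.gradedForm.comp ((F.gradedMap N hN ^ n).comp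
      (DirectSum.lof k ℤ F.gr (-(2 * n : ℤ))))) (Submodule.Quotient.mk x) =
      Q ((N ^ n) x) := by
    intro x
    rw [QuadraticMap.comp_apply, LinearMap.comp_apply]
    have h := gradedMap_pow_homog hN n _ x.1 x.2
    rw [F.homog_congr (show -(2 * n : ℤ) + 2 * n = 0 by ring)] at h
    exact (congrArg F.gradedForm h).trans (F.gradedForm_homog_zero _ _)
  have hpol : ∀ x y : F.X (-(2 * n : ℤ)), QuadraticMap.polar
      (F.gradedForm.comp ((F.gradedMap N hN ^ n).comp
      (DirectSum.lof k ℤ F.gr (-(2 * n : ℤ))))) (Submodule.Quotient.mk x)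
      (Submodule.Quotient.mk y) = QuadraticMap.polar Q ((N ^ n) x) ((N ^ n) y) := by
    intro x y
    rw [QuadraticMap.polar, ← Submodule.Quotient.mk_add, hval, hval, hval, QuadraticMap.polar,
      Submodule.coe_add, map_add]
  rw [isNondeg_iff]
  constructor
  · intro h x hx h1 h2
    rw [← F.mk_eq_zero_iff hx]
    refine h _ (fun y => ?_) ((hval ⟨x, hx⟩).trans h2)
    obtain ⟨y, rfl⟩ := Submodule.Quotient.mk_surjective _ y
    exact (hpol ⟨x, hx⟩ y).trans (h1 y.1 y.2)
  · intro h x h1 h2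
    obtain ⟨x, rfl⟩ := Submodule.Quotient.mk_surjective _ x
    refine (F.mk_eq_zero_iff x.2).mpr (h x.1 x.2 (fun y hy => ?_) ?_)
    · rw [← hpol x ⟨y, hy⟩]; exact h1 _
    · rw [← hval x]; exact h2

theorem odd_pairing_iff (hN : ∀ a, ∀ x ∈ F.X a, N x ∈ F.X (a + 2)) (n : ℕ) :
    (∀ (x : F.gr (-(2 * n + 1 : ℤ))),
          (∀ y : F.gr (-(2 * n + 1 : ℤ)),
            QuadraticMap.polar F.gradedForm (DirectSum.lof k ℤ F.gr _ x)
              ((F.gradedMap N hN ^ (2 * n + 1)) (DirectSum.lof k ℤ F.gr _ y)) = 0) → x = 0) ↔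
    ∀ x ∈ F.X (-(2 * n + 1 : ℤ)),
    (∀ y ∈ F.X (-(2 * n + 1 : ℤ)), QuadraticMap.polar Q x ((N ^ (2 * n + 1)) y) = 0) →
      x ∈ F.X (-(2 * n + 1 : ℤ) + 1) := by
  have hpol : ∀ x y : F.X (-(2 * n + 1 : ℤ)), QuadraticMap.polar F.gradedForm
      (DirectSum.lof k ℤ F.gr _ (Submodule.Quotient.mk x))
      ((F.gradedMap N hN ^ (2 * n + 1)) (DirectSum.lof k ℤ F.gr _ (Submodule.Quotient.mk y))) =
      QuadraticMap.polar Q x ((N ^ (2 * n + 1)) y) := by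
    intro x y
    have h := gradedMap_pow_homog hN (2 * n + 1) _ y.1 y.2
    refine (congrArg _ h).trans ((F.polar_gradedForm_homog _ _ x.1 _ x.2 _).trans ?_)
    rw [if_pos (by push_cast; ring)]
  constructor
  · intro h x hx h1
    rw [← F.mk_eq_zero_iff hx]
    refine h _ (fun y => ?_)
    obtain ⟨y, rfl⟩ := Submodule.Quotient.mk_surjective _ y
    exact (hpol ⟨x, hx⟩ y).trans (h1 y.1 y.2)
  · intro h x h1
    obtain ⟨x, rfl⟩ := Submodule.Quotient.mk_surjective _ x
    refine (F.mk_eq_zero_iff x.2).mpr (h x.1 x.2 (fun y hy => ?_))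
    rw [← hpol x ⟨y, hy⟩]; exact h1 _

end QFiltration

section Isometry

variable {k : Type u} [Field k] {V : Type v} [AddCommGroup V] [Module k V]
variable {Q : QuadraticForm k V} {N : Module.End k V}

theorem polar_isometry {g : Module.End k V} (hg : ∀ x, Q (g x) = Q x) (x y : V) :
    QuadraticMap.polar Q (g x) (g y) = QuadraticMap.polar Q x y := by
  rw [QuadraticMap.polar, ← map_add, hg, hg, hg, QuadraticMap.polar]

theorem map_shift (hN : ∀ x, Q ((1 + N) x) = Q x) (x : V) :
    Q (N x) = -QuadraticMap.polar Q x (N x) := by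
  have h := hN x
  rw [LinearMap.add_apply, Module.End.one_apply, QuadraticMap.map_add Q] at h
  linear_combination h

theorem polar_shift_left (hN : ∀ x, Q ((1 + N) x) = Q x) (x y : V) :
    QuadraticMap.polar Q (N x) y =
      -QuadraticMap.polar Q x (N y) - QuadraticMap.polar Q (N x) (N y) := by
  have h := polar_isometry hN x y
  simp only [LinearMap.add_apply, Module.End.one_apply, QuadraticMap.polar_add_left,
    QuadraticMap.polar_add_right] at h
  linear_combination h

end Isometry

namespace QFiltration

variable {k : Type u} [Field k] {V : Type v} [AddCommGroup V] [Module k V]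
variable {Q : QuadraticForm k V} {F : QFiltration Q} {N : Module.End k V}

theorem polar_eq_zero_of_one_le {a b : ℤ} (hab : 1 ≤ a + b) {x y : V} (hx : x ∈ F.X a)
    (hy : y ∈ F.X b) : QuadraticMap.polar Q x y = 0 := by
  rcases le_or_gt 1 a with ha | ha
  · exact F.polar_eq_zero ha hx (F.antitone (by omega) hy)
  · rw [QuadraticMap.polar_comm]
    exact F.polar_eq_zero (by omega) hy (F.antitone (by omega) hx)

theorem gradedMap_mem_E2 (hQ : ∀ x, Q ((1 + N) x) = Q x)
    (hN : ∀ a, ∀ x ∈ F.X a, N x ∈ F.X (a + 2)) : F.gradedMap N hN ∈ E2 F.gradedForm := by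
  refine ⟨fun a x => ?_, fun x y => ?_, fun x => ?_⟩
  · obtain ⟨x, rfl⟩ := Submodule.Quotient.mk_surjective _ x
    exact ⟨_, gradedMap_homog hN a x.1 x.2⟩
  · induction x using DirectSum.induction_on with
    | zero => simp
    | add x₁ x₂ h₁ h₂ =>
      simp only [map_add, QuadraticMap.polar_add_left]
      linear_combination h₁ + h₂
    | of a x =>
      induction y using DirectSum.induction_on with
      | zero => simp
      | add x₁ x₂ h₁ h₂ =>
        simp only [map_add, QuadraticMap.polar_add_right]
        linear_combination h₁ + h₂
      | of b y =>
        obtain ⟨⟨x, hx⟩, rfl⟩ := Submodule.Quotient.mk_surjective _ x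
        obtain ⟨⟨y, hy⟩, rfl⟩ := Submodule.Quotient.mk_surjective _ y
        change QuadraticMap.polar F.gradedForm (F.gradedMap N hN (F.homog a x hx))
          (F.homog b y hy) + QuadraticMap.polar F.gradedForm (F.homog a x hx)
          (F.gradedMap N hN (F.homog b y hy)) = 0
        rw [gradedMap_homog, gradedMap_homog, polar_gradedForm_homog, polar_gradedForm_homog]
        by_cases hab : a + b + 2 = 0
        · rw [if_pos (by omega), if_pos (by omega), polar_shift_left hQ,
            polar_eq_zero_of_one_le (a := a + 2) (b := b + 2) (by omega) (hN _ _ hx) (hN _ _ hy)]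
          ring
        · rw [if_neg (by omega), if_neg (by omega), add_zero]
  · obtain ⟨⟨x, hx⟩, rfl⟩ := Submodule.Quotient.mk_surjective _ x
    change QuadraticMap.polar F.gradedForm (F.homog (-1) x hx)
      (F.gradedMap N hN (F.homog (-1) x hx)) = 0
    rw [gradedMap_homog, polar_gradedForm_homog, if_pos (by omega)]
    have h := map_shift hQ x
    rw [F.isotropic (-1 + 2) (by omega) _ (hN _ _ hx)] at h
    linear_combination h

/-- The definition of `E^{≥ 2}_* X` without graded spaces. -/
theorem mem_E2geStar_iff : N ∈ F.E2geStar ↔ N ∈ unipShift Q ∧ IsAdapted F N := by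
  constructor
  · rintro ⟨h, hS⟩
    exact ⟨h.1, ⟨h.2, fun n => (isNondeg_comp_iff h.2 n).mp (hS.2.1 n),
      fun n => (odd_pairing_iff h.2 n).mp (hS.2.2 n)⟩⟩
  · rintro ⟨h, hA⟩
    exact ⟨⟨h, hA.map_mem⟩, gradedMap_mem_E2 h.1.2 hA.map_mem,
      fun n => (isNondeg_comp_iff hA.map_mem n).mpr (hA.even n),
      fun n => (odd_pairing_iff hA.map_mem n).mpr (hA.odd n)⟩

end QFiltration

/-! ### Orthogonal complements of isotropic subspaces -/

section Perp

variable {k : Type u} [Field k] {V : Type v} [AddCommGroup V] [Module k V]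
variable {Q : QuadraticForm k V}

theorem perp_anti {U U' : Submodule k V} (h : U ≤ U') : perp Q U' ≤ perp Q U :=
  fun _ hx u hu => hx u (h hu)

theorem polar_eq_zero_of_isotropic {U : Submodule k V} (hU : ∀ x ∈ U, Q x = 0) {x y : V}
    (hx : x ∈ U) (hy : y ∈ U) : QuadraticMap.polar Q x y = 0 := by
  rw [QuadraticMap.polar, hU _ (U.add_mem hx hy), hU _ hx, hU _ hy]; simp

theorem le_perp_of_isotropic {U : Submodule k V} (hU : ∀ x ∈ U, Q x = 0) : U ≤ perp Q U :=
  fun _ hx _ hu => polar_eq_zero_of_isotropic hU hu hx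

theorem eq_zero_of_mem_radical (hQ : IsNondeg Q) {x : V}
    (hx : ∀ y, QuadraticMap.polar Q x y = 0) (h : Q x = 0) : x = 0 :=
  (QFiltration.isNondeg_iff Q).mp hQ x hx h

theorem polarBilin_isRefl : (QuadraticMap.polarBilin Q).IsRefl := fun x y h => by
  rw [QuadraticMap.polarBilin_apply_apply] at h ⊢
  rwa [QuadraticMap.polar_comm]

theorem finrank_add_finrank_perp [FiniteDimensional k V] (hQ : IsNondeg Q) {U : Submodule k V}
    (hU : ∀ x ∈ U, Q x = 0) :
    Module.finrank k U + Module.finrank k (perp Q U) = Module.finrank k V := by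
  have h := LinearMap.BilinForm.finrank_add_finrank_orthogonal
    (B := Q.polarBilin) (W := U) polarBilin_isRefl
  have h0 : U ⊓ LinearMap.BilinForm.orthogonal Q.polarBilin ⊤ = ⊥ := by
    rw [Submodule.eq_bot_iff]
    rintro x ⟨hx, hx'⟩
    refine eq_zero_of_mem_radical hQ (fun y => ?_) (hU x hx)
    rw [QuadraticMap.polar_comm]
    exact hx' y trivial
  rw [h0, finrank_bot, add_zero] at h
  exact h

/-- An isotropic subspace is determined by its orthogonal complement. This holds even when the
bilinear form is degenerate, where `U^⊥⊥` may be larger than `U`. -/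
theorem eq_of_perp_eq [FiniteDimensional k V] (hQ : IsNondeg Q) {U U' : Submodule k V}
    (hU : ∀ x ∈ U, Q x = 0) (hU' : ∀ x ∈ U', Q x = 0) (h : perp Q U = perp Q U') : U = U' := by
  have aux : ∀ {U U' : Submodule k V}, (∀ x ∈ U, Q x = 0) → (∀ x ∈ U', Q x = 0) →
      perp Q U = perp Q U' → U' ≤ U := by
    intro U U' hU hU' h
    have hiso : ∀ x ∈ U ⊔ U', Q x = 0 := by
      intro x hx
      obtain ⟨y, hy, z, hz, rfl⟩ := Submodule.mem_sup.mp hx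
      have : QuadraticMap.polar Q y z = 0 := by
        have hz' := le_perp_of_isotropic hU' hz
        rw [← h] at hz'
        exact hz' y hy
      rw [QuadraticMap.map_add Q, hU y hy, hU' z hz, this]; simp
    have hp : perp Q (U ⊔ U') = perp Q U := by
      refine le_antisymm (perp_anti le_sup_left) fun x hx u hu => ?_
      obtain ⟨y, hy, z, hz, rfl⟩ := Submodule.mem_sup.mp hu
      have hx' := hx
      rw [h] at hx'
      have h1 := hx y hy
      have h2 := hx' z hz
      change QuadraticMap.polar Q (y + z) x = 0
      rw [QuadraticMap.polar_add_left, show QuadraticMap.polar Q y x = 0 from h1,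
        show QuadraticMap.polar Q z x = 0 from h2, add_zero]
    have h1 := finrank_add_finrank_perp hQ hiso
    have h2 := finrank_add_finrank_perp hQ hU
    rw [hp] at h1
    have h3 : U = U ⊔ U' := Submodule.eq_of_le_of_finrank_eq le_sup_left (by omega)
    rw [h3]; exact le_sup_right
  exact le_antisymm (aux hU' hU h.symm) (aux hU hU' h)

end Perp

/-- A space with a nondegenerate alternating form has even dimension: a maximal totally isotropic
subspace is its own orthogonal complement. This argument is valid in characteristic two. -/
theorem even_finrank_of_isAlt {k : Type*} [Field k] {V : Type*} [AddCommGroup V] [Module k V]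
    [FiniteDimensional k V] (B : LinearMap.BilinForm k V) (hB : B.IsAlt)
    (hnd : ∀ x, (∀ y, B x y = 0) → x = 0) : Even (Module.finrank k V) := by
  obtain ⟨L, hL, hmax⟩ := wellFounded_gt.has_min
    {L : Submodule k V | ∀ x ∈ L, ∀ y ∈ L, B x y = 0} ⟨⊥, by simp⟩
  have hperp : B.orthogonal L = L := by
    refine le_antisymm (fun x hx => ?_) fun x hx y hy => hL y hy x hx
    by_contra hxL
    have hx' : ∀ y ∈ L, B y x = 0 := hx
    have hx'' : ∀ y ∈ L, B x y = 0 := fun y hy => hB.isRefl y x (hx' y hy)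
    refine hmax (L ⊔ Submodule.span k {x}) ?_ ?_
    · intro y hy z hz
      obtain ⟨y, hy', s, hs, rfl⟩ := Submodule.mem_sup.mp hy
      obtain ⟨z, hz', t, ht, rfl⟩ := Submodule.mem_sup.mp hz
      obtain ⟨c, rfl⟩ := Submodule.mem_span_singleton.mp hs
      obtain ⟨d, rfl⟩ := Submodule.mem_span_singleton.mp ht
      simp [hL y hy' z hz', hx' y hy', hx'' z hz', hB.self_eq_zero x]
    · refine lt_of_le_of_ne le_sup_left fun h => hxL ?_
      rw [h]
      exact Submodule.mem_sup_right (Submodule.mem_span_singleton_self x)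
  have h := LinearMap.BilinForm.finrank_add_finrank_orthogonal (B := B) (W := L) hB.isRefl
  have h0 : L ⊓ B.orthogonal ⊤ = ⊥ := by
    rw [Submodule.eq_bot_iff]
    rintro x ⟨-, hx⟩
    exact hnd x fun y => hB.isRefl y x (hx y trivial)
  rw [h0, finrank_bot, add_zero, hperp] at h
  exact ⟨_, h.symm⟩

/-! ### Uniqueness of the adapted filtration -/

namespace QFiltration

variable {k : Type u} [Field k] {V : Type v} [AddCommGroup V] [Module k V]
variable {Q : QuadraticForm k V} {F F' : QFiltration Q} {N : Module.End k V}

theorem X_eq_perp {a : ℤ} (ha : a ≤ 0) : F.X a = perp Q (F.X (1 - a)) := by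
  rw [← F.eq_perp (1 - a) (by omega)]; congr 1; ring

/-- For `a ≥ 1` the subspace `X^{≥ 1 - a}` is determined by `X^{≥ -a}` and `N`. -/
theorem IsAdapted.X_le (h : IsAdapted F N) (h' : IsAdapted F' N) {a : ℤ} (ha : 1 ≤ a)
    (hX : F.X (-a) = F'.X (-a)) : F.X (-a + 1) ≤ F'.X (-a + 1) := by
  intro x hx
  have hx0 : x ∈ F'.X (-a) := hX ▸ F.succ_le _ hx
  rcases Int.even_or_odd' a with ⟨n, rfl | rfl⟩
  · lift n to ℕ using by omega
    have h1 : (N ^ n) x ∈ F.X 1 := by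
      have := pow_mem h.map_mem n hx
      convert this using 2; ring
    refine h'.even n x hx0 (fun y hy => ?_) (F.isotropic 1 le_rfl _ h1)
    rw [← hX] at hy
    exact polar_eq_zero_of_one_le (by omega) h1 (pow_mem h.map_mem n hy)
  · lift n to ℕ using by omega
    refine h'.odd n x hx0 (fun y hy => ?_)
    rw [← hX] at hy
    exact polar_eq_zero_of_one_le (by push_cast; omega) hx (pow_mem h.map_mem (2 * n + 1) hy)

theorem exists_forall_ge_eq_bot (F : QFiltration Q) : ∃ A : ℤ, 1 ≤ A ∧ ∀ a, A ≤ a → F.X a = ⊥ := by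
  obtain ⟨A, hA⟩ := F.exists_eq_bot
  exact ⟨max A 1, le_max_right _ _, fun a ha =>
    le_bot_iff.mp ((F.antitone ((le_max_left _ _).trans ha)).trans hA.le)⟩

/-- Descending induction on the degree `a ≥ 1`: if the terms of degree `> a` agree, then so do those of
degree `≤ -a`, which are their orthogonal complements; `N` then determines the term of degree
`1 - a`, and that is the orthogonal complement of the term of degree `a`. -/
theorem IsAdapted.unique [FiniteDimensional k V] (hQ : IsNondeg Q) (h : IsAdapted F N)
    (h' : IsAdapted F' N) : F = F' := by
  obtain ⟨A, hA1, hA⟩ := F.exists_forall_ge_eq_bot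
  obtain ⟨B, hB1, hB⟩ := F'.exists_forall_ge_eq_bot
  have key : ∀ a ≤ max A B, 1 ≤ a → ∀ b, a ≤ b → F.X b = F'.X b := by
    refine Int.leInductionDown ?_ ?_
    · intro _ b hb
      rw [hA b ((le_max_left _ _).trans hb), hB b ((le_max_right _ _).trans hb)]
    · intro a _ ih ha b hb
      rcases hb.eq_or_lt with rfl | hb
      · -- here `a - 1` is the current degree: the terms of degree `≥ a` agree by induction
        have h1 : F.X (-(a - 1)) = F'.X (-(a - 1)) := by
          rw [X_eq_perp (F := F) (by omega), X_eq_perp (F := F') (by omega), ih (by omega) _ (by omega)]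
        have h2 := le_antisymm (h.X_le h' (by omega) h1) (h'.X_le h (by omega) h1.symm)
        refine eq_of_perp_eq hQ (F.isotropic _ ha) (F'.isotropic _ ha) ?_
        rw [← F.eq_perp _ ha, ← F'.eq_perp _ ha]
        convert h2 using 2 <;> ring
      · exact ih (by omega) b (by omega)
  have key1 : ∀ b, 1 ≤ b → F.X b = F'.X b :=
    key 1 (hA1.trans (le_max_left _ _)) le_rfl
  refine QFiltration.ext (funext fun a => ?_)
  rcases le_or_gt 1 a with ha | ha
  · exact key1 a ha
  · rw [X_eq_perp (F := F) (by omega), X_eq_perp (F := F') (by omega), key1 _ (by omega)]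

/-! ### The dimension vector of an adapted filtration -/

theorem finrank_gr [FiniteDimensional k V] (F : QFiltration Q) (a : ℤ) :
    Module.finrank k (F.gr a) + Module.finrank k (F.X (a + 1)) = Module.finrank k (F.X a) := by
  rw [← Submodule.finrank_quotient_add_finrank ((F.X (a + 1)).submoduleOf (F.X a))]
  congr 1
  exact (LinearEquiv.finrank_eq (Submodule.submoduleOfEquivOfLe (F.succ_le a))).symm

theorem finrank_gr_neg [FiniteDimensional k V] (hQ : IsNondeg Q) (F : QFiltration Q) (a : ℤ) :
    Module.finrank k (F.gr a) = Module.finrank k (F.gr (-a)) := by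
  have aux : ∀ a : ℤ, 1 ≤ a → Module.finrank k (F.gr a) = Module.finrank k (F.gr (-a)) := by
    intro a ha
    have h1 := F.finrank_gr a
    have h2 := F.finrank_gr (-a)
    have h3 := finrank_add_finrank_perp hQ (F.isotropic a ha)
    have h4 := finrank_add_finrank_perp hQ (F.isotropic (a + 1) (by omega))
    rw [← F.eq_perp _ ha] at h3
    rw [← F.eq_perp _ (by omega)] at h4
    have e1 : Module.finrank k (F.X (-a + 1)) = Module.finrank k (F.X (1 - a)) :=
      congrArg (fun i => Module.finrank k (F.X i)) (by ring)
    have e2 : Module.finrank k (F.X (1 - (a + 1))) = Module.finrank k (F.X (-a)) :=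
      congrArg (fun i => Module.finrank k (F.X i)) (by ring)
    omega
  rcases lt_trichotomy a 0 with h | rfl | h
  · have := aux (-a) (by omega)
    rw [neg_neg] at this
    exact this.symm
  · simp
  · exact aux a h

/-- For `a ≥ 2` the map `gr^{-a} X → gr^{-a + 2} X` induced by `N` is injective. -/
theorem IsAdapted.finrank_gr_le [FiniteDimensional k V] (h : IsAdapted F N)
    (hQ : ∀ x, Q ((1 + N) x) = Q x) {a : ℤ} (ha : 2 ≤ a) :
    Module.finrank k (F.gr (-a)) ≤ Module.finrank k (F.gr (-a + 2)) := by
  let f : F.gr (-a) →ₗ[k] F.gr (-a + 2) :=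
    Submodule.mapQ _ _ (N.restrict (h.map_mem (-a))) (by
        intro x hx
        have h : N (x : V) ∈ F.X (-a + 1 + 2) := h.map_mem (-a + 1) x hx
        rw [add_right_comm] at h
        exact h)
  refine LinearMap.finrank_le_finrank_of_injective (f := f)
    ((injective_iff_map_eq_zero f).mpr fun x hx => ?_)
  obtain ⟨⟨x, hxX⟩, rfl⟩ := Submodule.Quotient.mk_surjective _ x
  have hx' : N x ∈ F.X (-a + 2 + 1) := (F.mk_eq_zero_iff (h.map_mem _ _ hxX)).mp hx
  refine (F.mk_eq_zero_iff hxX).mpr ?_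
  rcases Int.even_or_odd' a with ⟨n, rfl | rfl⟩
  · obtain ⟨n, rfl⟩ : ∃ m : ℕ, n = (m : ℤ) + 1 := ⟨(n - 1).toNat, by omega⟩
    have h1 : (N ^ (n + 1)) x ∈ F.X 1 := by
      have := pow_mem h.map_mem n hx'
      rw [pow_succ, Module.End.mul_apply]
      convert this using 2; ring
    have := h.even (n + 1) x (by push_cast; exact hxX) (fun y hy =>
      polar_eq_zero_of_one_le (by push_cast; omega) h1 (pow_mem h.map_mem (n + 1) hy))
      (F.isotropic 1 le_rfl _ h1)
    push_cast at this
    exact this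
  · lift n to ℕ using by omega
    refine h.odd n x hxX (fun y hy => ?_)
    have e : (N ^ (2 * n + 1)) y = N ((N ^ (2 * n)) y) := by rw [pow_succ', Module.End.mul_apply]
    have h2 := pow_mem h.map_mem (2 * n) hy
    have h3 := polar_shift_left hQ x ((N ^ (2 * n)) y)
    rw [polar_eq_zero_of_one_le (by push_cast; omega) hx' h2,
      polar_eq_zero_of_one_le (by push_cast; omega) hx' (h.map_mem _ _ h2), ← e] at h3
    linear_combination h3

/-- On `X^{≥ p} × X^{≥ q}` the map `-N` is the adjoint of `N` in leading order. -/
theorem polar_pow_left (hN : ∀ a, ∀ x ∈ F.X a, N x ∈ F.X (a + 2))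
    (hQ : ∀ x, Q ((1 + N) x) = Q x) (i j : ℕ) {p q : ℤ} (hpq : 0 ≤ p + q + 2 * (i + j)) {x y : V}
    (hx : x ∈ F.X p) (hy : y ∈ F.X q) :
    QuadraticMap.polar Q ((N ^ i) x) ((N ^ j) y) =
      (-1) ^ i * QuadraticMap.polar Q x ((N ^ (i + j)) y) := by
  induction i generalizing j with
  | zero => simp
  | succ i ih =>
    have h1 := pow_mem hN i hx
    have h2 := pow_mem hN j hy
    rw [pow_succ', Module.End.mul_apply, polar_shift_left hQ,
      polar_eq_zero_of_one_le (by push_cast at hpq ⊢; omega) (hN _ _ h1) (hN _ _ h2), sub_zero,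
      ← Module.End.mul_apply N, ← pow_succ', ih (j + 1) (by push_cast at hpq ⊢; omega),
      show i + (j + 1) = i + 1 + j by ring]
    ring

/-- The bilinear form on `gr^{-a} X` defined by `N ^ a`, `a = 2 * n + 1`, is alternating. In characteristic
two this uses that `1 + N` preserves `Q` and not only the bilinear form. -/
theorem polar_self_odd_pow (hN : ∀ a, ∀ x ∈ F.X a, N x ∈ F.X (a + 2))
    (hQ : ∀ x, Q ((1 + N) x) = Q x) (n : ℕ) {x : V} (hx : x ∈ F.X (-(2 * n + 1 : ℤ))) :
    QuadraticMap.polar Q x ((N ^ (2 * n + 1)) x) = 0 := by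
  have h1 := polar_pow_left hN hQ n (n + 1) (by push_cast; omega) hx hx
  have h2 := map_shift hQ ((N ^ n) x)
  rw [← Module.End.mul_apply N, ← pow_succ'] at h2
  rw [F.isotropic 1 le_rfl _ (F.antitone (by push_cast; omega) (pow_mem hN (n + 1) hx)), h1,
    show n + (n + 1) = 2 * n + 1 by ring] at h2
  have h3 : ((-1 : k) ^ n) * (-1) ^ n = 1 := by rw [← mul_pow]; simp
  linear_combination (-QuadraticMap.polar Q x ((N ^ (2 * n + 1)) x)) * h3 + (-1) ^ n * h2

theorem IsAdapted.even_finrank_gr [FiniteDimensional k V] (h : IsAdapted F N)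
    (hQ : ∀ x, Q ((1 + N) x) = Q x) (n : ℕ) :
    Even (Module.finrank k (F.gr (-(2 * n + 1 : ℤ)))) := by
  let B₀ : F.X (-(2 * n + 1 : ℤ)) →ₗ[k] F.X (-(2 * n + 1 : ℤ)) →ₗ[k] k :=
    Q.polarBilin.compl₁₂ (Submodule.subtype _) ((N ^ (2 * n + 1)).comp (Submodule.subtype _))
  have hB₀ : ∀ x y, B₀ x y = QuadraticMap.polar Q x ((N ^ (2 * n + 1)) y) := fun _ _ => rfl
  have hself : ∀ x, B₀ x x = 0 := fun x => polar_self_odd_pow h.map_mem hQ n x.2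
  have hanti : ∀ x y, B₀ x y = -B₀ y x := by
    intro x y
    have := hself (x + y)
    simp only [map_add, LinearMap.add_apply, hself, zero_add, add_zero] at this
    linear_combination this
  have hker : ((F.X (-(2 * n + 1 : ℤ) + 1)).submoduleOf (F.X (-(2 * n + 1 : ℤ)))) ≤
      LinearMap.ker B₀ := by
    intro x hx
    refine LinearMap.mem_ker.mpr (LinearMap.ext fun y => ?_)
    exact polar_eq_zero_of_one_le (by push_cast; omega)
      (show (x : V) ∈ F.X (-(2 * n + 1 : ℤ) + 1) from hx) (pow_mem h.map_mem (2 * n + 1) y.2)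
  have hker' : ((F.X (-(2 * n + 1 : ℤ) + 1)).submoduleOf (F.X (-(2 * n + 1 : ℤ)))) ≤
      LinearMap.ker B₀.flip := by
    intro x hx
    refine LinearMap.mem_ker.mpr (LinearMap.ext fun y => ?_)
    rw [LinearMap.flip_apply, hanti, LinearMap.mem_ker.mp (hker hx)]; simp
  let B : LinearMap.BilinForm k (F.gr (-(2 * n + 1 : ℤ))) := LinearMap.liftQ₂ _ _ B₀ hker hker'
  refine even_finrank_of_isAlt B (fun x => ?_) (fun x hx => ?_)
  · obtain ⟨x, rfl⟩ := Submodule.Quotient.mk_surjective _ x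
    exact hself x
  · obtain ⟨x, rfl⟩ := Submodule.Quotient.mk_surjective _ x
    exact (F.mk_eq_zero_iff x.2).mpr (h.odd n x x.2 fun y hy =>
      hx (Submodule.Quotient.mk ⟨y, hy⟩))

theorem sum_finrank_gr [FiniteDimensional k V] (F : QFiltration Q) {A : ℤ} (n : ℕ)
    (hA : F.X A = ⊥) :
    ∑ i ∈ Finset.range n, Module.finrank k (F.gr (A - 1 - i)) =
      Module.finrank k (F.X (A - n)) := by
  induction n with
  | zero =>
    have e : F.X (A - (0 : ℕ)) = ⊥ := by rw [← hA]; congr 1; simp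
    rw [e, finrank_bot, Finset.sum_range_zero]
  | succ n ih =>
    have h := F.finrank_gr (A - 1 - n)
    have e : Module.finrank k (F.X (A - 1 - n + 1)) = Module.finrank k (F.X (A - n)) :=
      congrArg (fun i => Module.finrank k (F.X i)) (by ring)
    have e' : Module.finrank k (F.X (A - 1 - n)) = Module.finrank k (F.X (A - (n + 1 : ℕ))) :=
      congrArg (fun i => Module.finrank k (F.X i)) (by push_cast; ring)
    rw [Finset.sum_range_succ]
    omega

/-- The dimension vector of the graded space of an adapted filtration is admissible. -/
theorem IsAdapted.exists_dimVector [FiniteDimensional k V] (hQn : IsNondeg Q)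
    (h : IsAdapted F N) (hQ : ∀ x, Q ((1 + N) x) = Q x) :
    ∃ f ∈ dimVectors (Module.finrank k V), ∀ a, Module.finrank k (F.gr a) = f a := by
  obtain ⟨A, hA1, hA⟩ := F.exists_forall_ge_eq_bot
  have hzero : ∀ a, A ≤ a → Module.finrank k (F.gr a) = 0 := by
    intro a ha
    have := F.finrank_gr a
    have e : Module.finrank k (F.X a) = 0 := by rw [hA a ha, finrank_bot]
    omega
  have hzero' : ∀ a, a ≤ -A → Module.finrank k (F.gr a) = 0 := fun a ha => by
    rw [finrank_gr_neg hQn]; exact hzero _ (by omega)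
  have hsupp : ∀ a, Module.finrank k (F.gr a) ≠ 0 → a ∈ Finset.Ioo (-A) A := by
    intro a ha
    rw [Finset.mem_Ioo]
    constructor <;> by_contra hc
    · exact ha (hzero' a (by omega))
    · exact ha (hzero a (by omega))
  refine ⟨Finsupp.onFinset (Finset.Ioo (-A) A) (fun a => Module.finrank k (F.gr a)) hsupp,
    ⟨?_, fun a => finrank_gr_neg hQn F a, fun n => ?_, fun n => ?_, ?_⟩, fun a => rfl⟩
  · rw [Finsupp.onFinset_sum _ (fun _ => rfl)]
    have h1 := F.sum_finrank_gr (A := A) (2 * A - 1).toNat (hA A le_rfl)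
    have h2 : F.X (A - ((2 * A - 1).toNat : ℕ)) = ⊤ := by
      rw [X_eq_perp (by omega), hA _ (by omega), eq_top_iff]
      intro x _ u hu
      rw [(Submodule.mem_bot k).mp hu]; simp
    rw [h2, finrank_top] at h1
    rw [← h1]
    symm
    refine Finset.sum_bij (fun i _ => A - 1 - (i : ℤ)) ?_ ?_ ?_ ?_
    · intro i hi
      rw [Finset.mem_range] at hi
      rw [Finset.mem_Ioo]; omega
    · intro i _ j _ hij
      omega
    · intro a ha
      rw [Finset.mem_Ioo] at ha
      exact ⟨(A - 1 - a).toNat, by rw [Finset.mem_range]; omega, by omega⟩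
    · intro i _
      rfl
  · have := h.finrank_gr_le hQ (a := 2 * n + 2) (by omega)
    rwa [show -(2 * n + 2 : ℤ) + 2 = -(2 * n : ℤ) by ring] at this
  · have := h.finrank_gr_le hQ (a := 2 * n + 3) (by omega)
    rwa [show -(2 * n + 3 : ℤ) + 2 = -(2 * n + 1 : ℤ) by ring] at this
  · intro a ha
    change Even (Module.finrank k (F.gr a))
    obtain ⟨n, rfl⟩ := ha
    rcases le_or_gt 0 n with hn | hn
    · lift n to ℕ using hn
      rw [finrank_gr_neg hQn]
      exact h.even_finrank_gr hQ n
    · obtain ⟨m, rfl⟩ : ∃ m : ℕ, n = -(m : ℤ) - 1 := ⟨(-n - 1).toNat, by omega⟩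
      rw [show 2 * (-(m : ℤ) - 1) + 1 = -(2 * m + 1 : ℤ) by ring]
      exact h.even_finrank_gr hQ m

end QFiltration

/-! ### Adjoints of powers of a nilpotent shift -/

section Adjoint

variable {k : Type u} [Field k] {V : Type v} [AddCommGroup V] [Module k V]
variable {Q : QuadraticForm k V} {N : Module.End k V}

theorem polar_pow_shift_left (hN : ∀ x, Q ((1 + N) x) = Q x) (i : ℕ) (x y : V) :
    QuadraticMap.polar Q ((N ^ i) x) y =
      (-1) ^ i * QuadraticMap.polar Q (((1 + N) ^ i) x) ((N ^ i) y) := by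
  induction i generalizing x y with
  | zero => simp
  | succ i ih =>
    have h1 : (N ^ (i + 1)) x = N ((N ^ i) x) := by rw [pow_succ', Module.End.mul_apply]
    have h2 : (N ^ i) (N y) = (N ^ (i + 1)) y := by rw [pow_succ, Module.End.mul_apply]
    have hc : (1 + N) ((N ^ i) x) = (N ^ i) ((1 + N) x) := by
      rw [← Module.End.mul_apply, ← Module.End.mul_apply]
      congr 1
      exact ((Commute.one_left _).add_left (Commute.refl N)).pow_right i
    have h3 : QuadraticMap.polar Q (N ((N ^ i) x)) y =
        -QuadraticMap.polar Q ((1 + N) ((N ^ i) x)) (N y) := by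
      rw [polar_shift_left hN, LinearMap.add_apply, Module.End.one_apply,
        QuadraticMap.polar_add_left]
      ring
    rw [h1, h3, hc, ih, h2, ← Module.End.mul_apply, ← pow_succ]
    ring

theorem pow_apply_eq_zero_of_le {m i : ℕ} (hm : N ^ m = 0) (h : m ≤ i) (x : V) :
    (N ^ i) x = 0 := by
  rw [pow_eq_zero_of_le h hm, LinearMap.zero_apply]

theorem pow_pow_apply (i j : ℕ) (x : V) : (N ^ i) ((N ^ j) x) = (N ^ (i + j)) x := by
  rw [← Module.End.mul_apply, ← pow_add]

theorem polar_pow_pow_eq_zero (hN : ∀ x, Q ((1 + N) x) = Q x) {m i j : ℕ} (hm : N ^ m = 0)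
    (h : m ≤ i + j) (x y : V) : QuadraticMap.polar Q ((N ^ i) x) ((N ^ j) y) = 0 := by
  rw [polar_pow_shift_left hN, pow_pow_apply, pow_apply_eq_zero_of_le hm h]; simp

/-- The operator `-N` is the adjoint of `N` in top degree. -/
theorem polar_pow_pow_top (hN : ∀ x, Q ((1 + N) x) = Q x) {m i j : ℕ} (hm : N ^ (m + 1) = 0)
    (h : m ≤ i + j) (x y : V) : QuadraticMap.polar Q ((N ^ i) x) ((N ^ j) y) =
      (-1) ^ i * QuadraticMap.polar Q x ((N ^ (i + j)) y) := by
  rw [polar_pow_shift_left hN, pow_pow_apply]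
  congr 1
  have hz : ∀ l : ℕ, ∀ x, QuadraticMap.polar Q (((1 + N) ^ l) x) ((N ^ (i + j)) y) =
      QuadraticMap.polar Q x ((N ^ (i + j)) y) := by
    intro l
    induction l with
    | zero => simp
    | succ l ih =>
      intro x
      rw [pow_succ, Module.End.mul_apply, ih, LinearMap.add_apply, Module.End.one_apply,
        QuadraticMap.polar_add_left]
      have := polar_pow_pow_eq_zero hN (i := 1) (j := i + j) hm (by omega) x y
      rw [pow_one] at this
      rw [this, add_zero]
  exact hz i x

theorem surjective_one_add {m : ℕ} (hm : N ^ m = 0) :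
    Function.Surjective ((1 + N : Module.End k V) : V → V) := by
  have h : IsUnit (1 + N) := IsNilpotent.isUnit_one_add ⟨m, hm⟩
  exact ((Module.End.isUnit_iff _).mp h).2

/-- If `x` is orthogonal to the image of `N`, then `N x = 0`. -/
theorem shift_eq_zero_of_orthogonal_range (hQ : IsNondeg Q) (hN : ∀ x, Q ((1 + N) x) = Q x) {m : ℕ}
    (hm : N ^ m = 0) {x : V} (hx : ∀ y, QuadraticMap.polar Q x (N y) = 0) : N x = 0 := by
  refine eq_zero_of_mem_radical hQ (fun y => ?_) (by rw [map_shift hN, hx, neg_zero])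
  obtain ⟨y, rfl⟩ := surjective_one_add hm y
  have h := polar_shift_left hN x y
  rw [hx] at h
  rw [LinearMap.add_apply, Module.End.one_apply, QuadraticMap.polar_add_right]
  linear_combination h

theorem pow_mem_radical_of_mem_perp_range (hN : ∀ x, Q ((1 + N) x) = Q x) {m : ℕ}
    (hm : N ^ m = 0) {i : ℕ} {x : V} (hx : x ∈ perp Q (LinearMap.range (N ^ i))) (y : V) :
    QuadraticMap.polar Q ((N ^ i) x) y = 0 := by
  have hs : Function.Surjective (((1 + N) ^ i : Module.End k V) : V → V) := by
    rw [Module.End.coe_pow]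
    exact (surjective_one_add hm).iterate i
  obtain ⟨y, rfl⟩ := hs y
  have h1 : QuadraticMap.polar Q ((N ^ i) y) x = 0 := hx _ ⟨y, rfl⟩
  rw [polar_pow_shift_left hN] at h1
  rw [QuadraticMap.polar_comm]
  exact (mul_eq_zero.mp h1).resolve_left (pow_ne_zero _ (by simp))

theorem mem_perp_range_pow_top (hQ : IsNondeg Q) (hN : ∀ x, Q ((1 + N) x) = Q x) {m : ℕ}
    (hm : N ^ (m + 1) = 0) (hiso : ∀ x, Q ((N ^ m) x) = 0) {x : V} :
    x ∈ perp Q (LinearMap.range (N ^ m)) ↔ (N ^ m) x = 0 := by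
  constructor
  · intro hx
    exact eq_zero_of_mem_radical hQ (pow_mem_radical_of_mem_perp_range hN hm hx) (hiso x)
  · rintro hx _ ⟨y, rfl⟩
    change QuadraticMap.polar Q ((N ^ m) y) x = 0
    rw [polar_pow_shift_left hN, hx]; simp

/-- A linear functional that vanishes on the radical is represented by a vector. -/
theorem exists_polar_eq [FiniteDimensional k V] (φ : V →ₗ[k] k)
    (hφ : ∀ r, (∀ y, QuadraticMap.polar Q r y = 0) → φ r = 0) :
    ∃ w, ∀ x, QuadraticMap.polar Q w x = φ x := by
  have h : φ ∈ LinearMap.range (LinearMap.dualMap Q.polarBilin) := by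
    rw [LinearMap.range_dualMap_eq_dualAnnihilator_ker, Submodule.mem_dualAnnihilator]
    exact fun r hr => hφ r fun y => LinearMap.congr_fun (LinearMap.mem_ker.mp hr) y
  obtain ⟨ψ, rfl⟩ := h
  obtain ⟨w, rfl⟩ := (Module.evalEquiv k V).surjective ψ
  refine ⟨w, fun x => ?_⟩
  rw [QuadraticMap.polar_comm]
  rfl

theorem perp_perp_of_radical_eq_zero [FiniteDimensional k V]
    (hR : ∀ r, (∀ y, QuadraticMap.polar Q r y = 0) → r = 0) (S : Submodule k V) :
    perp Q (perp Q S) = S := by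
  refine LinearMap.BilinForm.orthogonal_orthogonal ?_ polarBilin_isRefl S
  refine ⟨fun x hx => hR x hx, fun x hx => hR x fun y => ?_⟩
  rw [QuadraticMap.polar_comm]
  exact hx y

/-- The vectors of `U^⊥⊥ ∩ U^⊥` on which `Q` vanishes lie in `U`. This makes the form on `U^⊥ / U`
nondegenerate. -/
theorem mem_of_mem_perp_perp [FiniteDimensional k V] (hQ : IsNondeg Q) {U : Submodule k V}
    (hU : ∀ x ∈ U, Q x = 0) {x : V} (hx : x ∈ perp Q U) (hx' : x ∈ perp Q (perp Q U))
    (h0 : Q x = 0) : x ∈ U := by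
  have hiso : ∀ y ∈ U ⊔ Submodule.span k {x}, Q y = 0 := by
    intro y hy
    obtain ⟨y, hy', s, hs, rfl⟩ := Submodule.mem_sup.mp hy
    obtain ⟨c, rfl⟩ := Submodule.mem_span_singleton.mp hs
    have h1 : QuadraticMap.polar Q y x = 0 := hx y hy'
    rw [QuadraticMap.map_add Q, QuadraticMap.map_smul, hU y hy', h0,
      QuadraticMap.polar_smul_right, h1]
    simp
  have hp : perp Q U = perp Q (U ⊔ Submodule.span k {x}) := by
    refine le_antisymm (fun z hz y hy => ?_) (perp_anti le_sup_left)
    obtain ⟨y, hy', s, hs, rfl⟩ := Submodule.mem_sup.mp hy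
    obtain ⟨c, rfl⟩ := Submodule.mem_span_singleton.mp hs
    have h1 : QuadraticMap.polar Q y z = 0 := hz y hy'
    have h2 : QuadraticMap.polar Q z x = 0 := hx' z hz
    change QuadraticMap.polar Q (y + c • x) z = 0
    rw [QuadraticMap.polar_add_left, QuadraticMap.polar_smul_left, h1,
      QuadraticMap.polar_comm, h2]
    simp
  rw [eq_of_perp_eq hQ hU hiso hp]
  exact Submodule.mem_sup_right (Submodule.mem_span_singleton_self x)

end Adjoint

/-! ### Filtrations from isotropic flags, and their pullback from `U^⊥ / U` -/

section Construct

variable {k : Type u} [Field k] {V : Type v} [AddCommGroup V] [Module k V]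
variable {Q : QuadraticForm k V}

/-- The `Q`-filtration whose terms of degree `≥ 1` form the given flag `Y` of isotropic subspaces. -/
def QFiltration.ofIsotropic (Y : ℤ → Submodule k V) (hY : ∀ a, 1 ≤ a → Y (a + 1) ≤ Y a)
    (hbot : ∃ A, 1 ≤ A ∧ Y A = ⊥) (hiso : ∀ x ∈ Y 1, Q x = 0) : QFiltration Q where
  X a := if 1 ≤ a then Y a else perp Q (Y (1 - a))
  succ_le a := by
    rcases lt_trichotomy a 0 with h | rfl | h
    · rw [if_neg (by omega), if_neg (by omega)]
      refine perp_anti ?_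
      have := hY (1 - (a + 1)) (by omega)
      rwa [sub_add_eq_sub_sub, sub_add_cancel, ← sub_add_eq_sub_sub] at this
    · rw [if_pos (by omega), if_neg (by omega)]
      exact le_perp_of_isotropic hiso
    · rw [if_pos (by omega), if_pos (by omega)]
      exact hY a (by omega)
  exists_eq_bot := by
    obtain ⟨A, h1, h2⟩ := hbot
    exact ⟨A, by rw [if_pos h1, h2]⟩
  exists_eq_top := by
    obtain ⟨A, h1, h2⟩ := hbot
    refine ⟨1 - A, ?_⟩
    rw [if_neg (by omega), sub_sub_cancel, h2, eq_top_iff]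
    intro x _ u hu
    rw [(Submodule.mem_bot k).mp hu]; simp
  isotropic a ha x hx := by
    rw [if_pos ha] at hx
    have h : ∀ a, 1 ≤ a → Y a ≤ Y 1 :=
      Int.leInduction le_rfl fun n hn ih => (hY n hn).trans ih
    exact hiso x (h a ha hx)
  eq_perp a ha := by
    rw [if_neg (by omega), if_pos ha, sub_sub_cancel]

variable (Q) in
/-- The space `U^⊥ / U`. -/
abbrev Subquot (U : Submodule k V) : Type v :=
  perp Q U ⧸ U.submoduleOf (perp Q U)

/-- The form induced by `Q` on `U^⊥ / U`, where `U` is isotropic. -/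
def subForm (U : Submodule k V) (hU : ∀ x ∈ U, Q x = 0) : QuadraticForm k (Subquot Q U) :=
  (Q.comp (perp Q U).subtype).lift (U.submoduleOf (perp Q U)) (by
    intro y hy
    have hy1 : (y : V) ∈ U := hy
    refine ⟨hU _ hy1, LinearMap.mem_ker.mpr (LinearMap.ext fun x => ?_)⟩
    have h : QuadraticMap.polar Q y x = 0 := x.2 y hy1
    simpa [QuadraticMap.polar] using h)

variable {U : Submodule k V} {hU : ∀ x ∈ U, Q x = 0}

/-- The class in `U^⊥ / U` of a vector of `U^⊥`. -/
def subMk (x : V) (hx : x ∈ perp Q U) : Subquot Q U :=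
  Submodule.Quotient.mk ⟨x, hx⟩

theorem subMk_surjective (y : Subquot Q U) : ∃ x, ∃ hx : x ∈ perp Q U, subMk x hx = y := by
  obtain ⟨x, rfl⟩ := Submodule.Quotient.mk_surjective _ y
  exact ⟨x.1, x.2, rfl⟩

theorem subMk_eq_zero {x : V} (hx : x ∈ perp Q U) : subMk x hx = 0 ↔ x ∈ U := by
  rw [subMk, Submodule.Quotient.mk_eq_zero]; rfl

theorem subForm_subMk {x : V} (hx : x ∈ perp Q U) : subForm U hU (subMk x hx) = Q x := rfl

theorem polar_subForm_subMk {x y : V} (hx : x ∈ perp Q U) (hy : y ∈ perp Q U) :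
    QuadraticMap.polar (subForm U hU) (subMk x hx) (subMk y hy) = QuadraticMap.polar Q x y := rfl

theorem subForm_isNondeg [FiniteDimensional k V] (hQ : IsNondeg Q) : IsNondeg (subForm U hU) := by
  rw [QFiltration.isNondeg_iff]
  intro x hx h0
  obtain ⟨x, hxU, rfl⟩ := subMk_surjective x
  rw [subMk_eq_zero]
  refine mem_of_mem_perp_perp hQ hU hxU (fun y hy => ?_) h0
  change QuadraticMap.polar Q y x = 0
  rw [QuadraticMap.polar_comm]
  exact hx (subMk y hy)

/-- The preimage in `U^⊥` of a subspace of `U^⊥ / U`, as a subspace of `V`. -/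
def subComap (U : Submodule k V) (S : Submodule k (Subquot Q U)) : Submodule k V :=
  (S.comap (Submodule.mkQ _)).map (perp Q U).subtype

theorem mem_subComap {S : Submodule k (Subquot Q U)} {x : V} :
    x ∈ subComap U S ↔ ∃ hx : x ∈ perp Q U, subMk x hx ∈ S := by
  constructor
  · rintro ⟨y, hy, rfl⟩
    exact ⟨y.2, hy⟩
  · rintro ⟨hx, h⟩
    exact ⟨⟨x, hx⟩, h, rfl⟩

theorem subComap_mono {S T : Submodule k (Subquot Q U)} (h : S ≤ T) :
    subComap U S ≤ subComap U T := fun x hx => by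
  obtain ⟨h1, h2⟩ := mem_subComap.mp hx
  exact mem_subComap.mpr ⟨h1, h h2⟩

theorem le_subComap (hU : ∀ x ∈ U, Q x = 0) (S : Submodule k (Subquot Q U)) :
    U ≤ subComap U S := fun x hx =>
  mem_subComap.mpr ⟨le_perp_of_isotropic hU hx, by
    rw [(subMk_eq_zero (le_perp_of_isotropic hU hx)).mpr hx]; exact S.zero_mem⟩

/-- The pullback to `V` of a filtration of `U^⊥ / U` which is concentrated in degrees between
`1 - M` and `M - 1`; the subspace `U` gets the degree `M`. -/
def QFiltration.pullback (F : QFiltration (subForm U hU)) (M : ℤ) (hM : 1 ≤ M) :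
    QFiltration Q :=
  QFiltration.ofIsotropic (fun a => if a ≤ M then subComap U (F.X a) else ⊥)
    (by
      intro a _
      split_ifs with h1 h2
      · exact subComap_mono (F.succ_le a)
      · omega
      · exact bot_le
      · exact le_rfl)
    ⟨M + 1, by omega, by simp⟩
    (by
      intro x hx
      rw [if_pos hM] at hx
      obtain ⟨h1, h2⟩ := mem_subComap.mp hx
      exact F.isotropic 1 le_rfl _ h2)

namespace QFiltration

variable {F : QFiltration (subForm U hU)} {M : ℤ} {hM : 1 ≤ M}

theorem mem_pullback {a : ℤ} (h1 : 1 - M ≤ a) (h2 : a ≤ M) {x : V} :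
    x ∈ (F.pullback M hM).X a ↔ ∃ hx : x ∈ perp Q U, subMk x hx ∈ F.X a := by
  rw [← mem_subComap]
  simp only [pullback, ofIsotropic]
  by_cases ha : 1 ≤ a
  · rw [if_pos ha, if_pos h2]
  · rw [if_neg ha, if_pos (by omega)]
    constructor
    · intro hx
      have hxU : x ∈ perp Q U := perp_anti (le_subComap hU _) hx
      refine mem_subComap.mpr ⟨hxU, ?_⟩
      rw [F.X_eq_perp (by omega)]
      intro y hy
      obtain ⟨y, hyU, rfl⟩ := subMk_surjective y
      exact hx y (mem_subComap.mpr ⟨hyU, hy⟩)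
    · intro hx y hy
      obtain ⟨hx1, hx2⟩ := mem_subComap.mp hx
      obtain ⟨hy1, hy2⟩ := mem_subComap.mp hy
      rw [F.X_eq_perp (by omega)] at hx2
      exact hx2 _ hy2

theorem X_eq_top_of_eq_bot {Q : QuadraticForm k V} {F : QFiltration Q} {a : ℤ} (ha : 1 ≤ a)
    (h : F.X a = ⊥) : F.X (1 - a) = ⊤ := by
  rw [F.eq_perp a ha, h, eq_top_iff]
  intro x _ u hu
  rw [(Submodule.mem_bot k).mp hu]; simp

theorem pullback_eq_bot {a : ℤ} (h : M < a) : (F.pullback M hM).X a = ⊥ := by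
  simp only [pullback, ofIsotropic]
  rw [if_pos (by omega), if_neg (by omega)]

theorem pullback_eq_top {a : ℤ} (h : a ≤ -M) : (F.pullback M hM).X a = ⊤ := by
  have := X_eq_top_of_eq_bot (F := F.pullback M hM) (a := 1 - a) (by omega)
    (pullback_eq_bot (by omega))
  rwa [sub_sub_cancel] at this

end QFiltration

end Construct

/-! ### Passing from `U^⊥ / U` to `V` -/

section Step

variable {k : Type u} [Field k] {V : Type v} [AddCommGroup V] [Module k V]
variable {Q : QuadraticForm k V} {N : Module.End k V} {U : Submodule k V}

/-- The endomorphism of `U^⊥ / U` induced by an endomorphism which preserves `U^⊥` and kills `U`. -/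
def subEnd (N : Module.End k V) (hL : ∀ x, N x ∈ perp Q U) (h0 : ∀ x ∈ U, N x = 0) :
    Module.End k (Subquot Q U) :=
  Submodule.mapQ _ _ (N.restrict fun x _ => hL x) (by
    intro x hx
    have : N (x : V) = 0 := h0 x hx
    change N (x : V) ∈ U
    rw [this]; exact U.zero_mem)

variable {hL : ∀ x, N x ∈ perp Q U} {h0 : ∀ x ∈ U, N x = 0}

theorem subEnd_subMk {x : V} (hx : x ∈ perp Q U) :
    subEnd N hL h0 (subMk x hx) = subMk (N x) (hL x) := rfl

theorem pow_mem_perp (hL : ∀ x, N x ∈ perp Q U) (i : ℕ) {x : V} (hx : x ∈ perp Q U) :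
    (N ^ i) x ∈ perp Q U := by
  cases i with
  | zero => simpa using hx
  | succ i => rw [pow_succ', Module.End.mul_apply]; exact hL _

theorem subEnd_pow_subMk (i : ℕ) {x : V} (hx : x ∈ perp Q U) :
    (subEnd N hL h0 ^ i) (subMk x hx) = subMk ((N ^ i) x) (pow_mem_perp hL i hx) := by
  induction i with
  | zero => rfl
  | succ i ih =>
    rw [pow_succ', Module.End.mul_apply, ih, subEnd_subMk]
    simp only [pow_succ', Module.End.mul_apply]

variable {hU : ∀ x ∈ U, Q x = 0}

theorem subForm_one_add_subEnd (hN : ∀ x, Q ((1 + N) x) = Q x) (x : Subquot Q U) :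
    subForm U hU ((1 + subEnd N hL h0) x) = subForm U hU x := by
  obtain ⟨x, hx, rfl⟩ := subMk_surjective x
  exact hN x

open QFiltration in
/-- Let `U` be the isotropic subspace for which `U^⊥` consists of the `x` with `N ^ m x = 0` and
`Q (N ^ j x) = 0` for `2 j ≥ m`. The pullback of a filtration adapted to the endomorphism induced by
`N` on `U^⊥ / U` is adapted to `N`. -/
theorem isAdapted_pullback (hQ : IsNondeg Q) (hN : ∀ x, Q ((1 + N) x) = Q x)
    {m : ℕ} (hm1 : 1 ≤ m) (hm : N ^ (m + 1) = 0) (hf : ∀ j, m < 2 * j → ∀ x, Q ((N ^ j) x) = 0)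
    (hperp : ∀ x, x ∈ perp Q U ↔ (N ^ m) x = 0 ∧ ∀ j, m ≤ 2 * j → Q ((N ^ j) x) = 0)
    (F : QFiltration (subForm U hU)) (hF : F.X m = ⊥) (hA : F.IsAdapted (subEnd N hL h0)) :
    (F.pullback m (by exact_mod_cast hm1)).IsAdapted N := by
  have hm1' : (1 : ℤ) ≤ m := by exact_mod_cast hm1
  set G := F.pullback m hm1' with hG
  have hFtop : F.X (1 - m) = ⊤ := X_eq_top_of_eq_bot hm1' hF
  have hrad : ∀ x, (∀ y, QuadraticMap.polar Q ((N ^ m) x) y = 0) → (N ^ m) x = 0 := fun x hx =>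
    eq_zero_of_mem_radical hQ hx (hf m (by omega) x)
  -- `N V ⊆ X^{≥ 2 - m}` is the nondegeneracy of the induced filtration in degree `1 - m`
  have hbottom : ∀ x, N x ∈ G.X (2 - m) := by
    intro x
    rw [hG, mem_pullback (by omega) (by omega)]
    refine ⟨hL x, ?_⟩
    rcases Nat.even_or_odd' (m - 1) with ⟨n, hn | hn⟩
    · have hmn : m = 2 * n + 1 := by omega
      have e : (-(2 * n : ℤ)) = 1 - m := by rw [hmn]; push_cast; ring
      have e' : (-(2 * n : ℤ) + 1) = 2 - m := by rw [hmn]; push_cast; ring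
      have := hA.even n (subMk (N x) (hL x)) (by rw [e, hFtop]; trivial) ?_ ?_
      · rwa [e'] at this
      · intro y _
        obtain ⟨y, hy, rfl⟩ := subMk_surjective y
        rw [subEnd_pow_subMk, subEnd_pow_subMk, polar_subForm_subMk,
          ← Module.End.mul_apply, ← pow_succ, polar_pow_pow_top hN hm (by omega),
          show n + 1 + n = m by omega, ((hperp y).mp hy).1]
        simp
      · rw [subEnd_pow_subMk, subForm_subMk, ← Module.End.mul_apply, ← pow_succ]
        exact hf _ (by omega) x
    · have hmn : m = 2 * n + 1 + 1 := by omega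
      have e : (-(2 * n + 1 : ℤ)) = 1 - m := by rw [hmn]; push_cast; ring
      have e' : (-(2 * n + 1 : ℤ) + 1) = 2 - m := by rw [hmn]; push_cast; ring
      have := hA.odd n (subMk (N x) (hL x)) (by rw [e, hFtop]; trivial) ?_
      · rwa [e'] at this
      · intro y _
        obtain ⟨y, hy, rfl⟩ := subMk_surjective y
        have h1 := polar_pow_pow_top hN (i := 1) (j := 2 * n + 1) hm (by omega) x y
        rw [pow_one, show 1 + (2 * n + 1) = m by omega, ((hperp y).mp hy).1] at h1
        rw [subEnd_pow_subMk, polar_subForm_subMk, h1]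
        simp
  have htop : ∀ a : ℤ, (m : ℤ) - 1 ≤ a → ∀ x ∈ G.X a, N x = 0 := by
    intro a ha x hx
    refine shift_eq_zero_of_orthogonal_range hQ hN hm fun y => ?_
    exact polar_eq_zero_of_one_le (a := m - 1) (b := 2 - m) (by omega) (G.antitone ha hx)
      (hbottom y)
  refine ⟨fun a x hx => ?_, fun n x hx h1 h2 => ?_, fun n x hx h1 => ?_⟩
  · rcases le_or_gt a (-m) with h | h
    · exact G.antitone (by omega) (hbottom x)
    · rcases le_or_gt (m - 1 : ℤ) a with h' | h'
      · rw [htop a h' x hx]; exact Submodule.zero_mem _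
      · rw [hG, mem_pullback (by omega) (by omega)] at hx ⊢
        obtain ⟨hx1, hx2⟩ := hx
        exact ⟨hL x, hA.map_mem a _ hx2⟩
  · rcases lt_trichotomy (2 * n) m with h | h | h
    · have h' : (2 * n : ℤ) < m := by exact_mod_cast h
      rw [hG, mem_pullback (by omega) (by omega)] at hx ⊢
      obtain ⟨hx1, hx2⟩ := hx
      refine ⟨hx1, hA.even n _ hx2 (fun y hy => ?_) ?_⟩
      · obtain ⟨y, hy', rfl⟩ := subMk_surjective y
        rw [subEnd_pow_subMk, subEnd_pow_subMk, polar_subForm_subMk]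
        refine h1 y ?_
        rw [hG, mem_pullback (by omega) (by omega)]
        exact ⟨hy', hy⟩
      · rw [subEnd_pow_subMk, subForm_subMk, h2]
    · have h' : (2 * n : ℤ) = m := by exact_mod_cast h
      have e : (-(2 * n : ℤ) + 1) = 1 - m := by rw [h']; ring
      rw [e, hG, mem_pullback (by omega) (by omega)]
      have hxL : x ∈ perp Q U := by
        refine (hperp x).mpr ⟨hrad x fun y => ?_, fun j hj => ?_⟩
        · have h3 := h1 y (by
            rw [h', hG, pullback_eq_top le_rfl]; trivial)
          rw [QuadraticMap.polar_comm, polar_pow_pow_top hN hm (by omega),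
            show n + n = m by omega] at h3
          rw [QuadraticMap.polar_comm]
          exact (mul_eq_zero.mp h3).resolve_left (pow_ne_zero _ (by simp))
        · rcases hj.eq_or_lt with hj | hj
          · obtain rfl : j = n := by omega
            exact h2
          · exact hf j hj x
      exact ⟨hxL, by rw [hFtop]; trivial⟩
    · rw [hG, pullback_eq_top (by omega)]; trivial
  · rcases lt_trichotomy (2 * n + 1) m with h | h | h
    · have h' : (2 * n + 1 : ℤ) < m := by exact_mod_cast h
      rw [hG, mem_pullback (by omega) (by omega)] at hx ⊢
      obtain ⟨hx1, hx2⟩ := hx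
      refine ⟨hx1, hA.odd n _ hx2 (fun y hy => ?_)⟩
      obtain ⟨y, hy', rfl⟩ := subMk_surjective y
      rw [subEnd_pow_subMk, polar_subForm_subMk]
      refine h1 y ?_
      rw [hG, mem_pullback (by omega) (by omega)]
      exact ⟨hy', hy⟩
    · have h' : (2 * n + 1 : ℤ) = m := by exact_mod_cast h
      have e : (-(2 * n + 1 : ℤ) + 1) = 1 - m := by rw [h']; ring
      rw [e, hG, mem_pullback (by omega) (by omega)]
      have hxL : x ∈ perp Q U := by
        refine (hperp x).mpr ⟨hrad x fun y => ?_, fun j hj => hf j (by omega) x⟩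
        have h3 := h1 y (by rw [h', hG, pullback_eq_top le_rfl]; trivial)
        have h4 := polar_pow_pow_top hN (i := m) (j := 0) hm (by omega) x y
        rw [h] at h3
        rw [add_zero, h3, mul_zero] at h4
        simpa using h4
      exact ⟨hxL, by rw [hFtop]; trivial⟩
    · have h' : (m : ℤ) < 2 * n + 1 := by exact_mod_cast h
      rw [hG, pullback_eq_top (by omega)]; trivial

/-- The obstruction to the existence of an adapted filtration for `g = 1 + N`: in characteristic two,
for a nondegenerate bilinear form, the product of `g` with the reflection in a vector `w` with
`Q w = 1` acts trivially on the graded space of a `Q`-filtration. Then `g` is not in the identity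
component, since the reflection is not. -/
def IsOddShift (Q : QuadraticForm k V) (N : Module.End k V) : Prop :=
  (2 : k) = 0 ∧ (∀ r, (∀ y, QuadraticMap.polar Q r y = 0) → r = 0) ∧ ∃ w, Q w = 1 ∧
    ∃ F : QFiltration Q, ∀ a, ∀ x ∈ F.X a,
      (1 + N) (x + QuadraticMap.polar Q w x • w) - x ∈ F.X (a + 1)

open QFiltration in
theorem IsOddShift.of_subquot [FiniteDimensional k V] (h : IsOddShift (subForm U hU) (subEnd N hL h0))
    (hQ : IsNondeg Q) : IsOddShift Q N := by
  obtain ⟨h2, hR, w, hw, F, hF⟩ := h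
  obtain ⟨w, hwL, rfl⟩ := subMk_surjective w
  obtain ⟨M, hM1, hM⟩ := F.exists_forall_ge_eq_bot
  have hdiff : ∀ x, (1 + N) (x + QuadraticMap.polar Q w x • w) - x =
      N x + QuadraticMap.polar Q w x • (w + N w) := by
    intro x
    simp only [LinearMap.add_apply, Module.End.one_apply, map_add, map_smul, smul_add]
    abel
  refine ⟨h2, fun r hr => ?_, w, hw, F.pullback M hM1, fun a x hx => ?_⟩
  · have hrL : r ∈ perp Q U := fun u _ => by
      change QuadraticMap.polar Q u r = 0
      rw [QuadraticMap.polar_comm]; exact hr u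
    have h1 := hR (subMk r hrL) (fun y => by
      obtain ⟨y, hy, rfl⟩ := subMk_surjective y
      exact hr y)
    rw [subMk_eq_zero] at h1
    exact eq_zero_of_mem_radical hQ hr (hU r h1)
  · have hmemL : (1 + N) (x + QuadraticMap.polar Q w x • w) - x ∈ perp Q U := by
      rw [hdiff]
      exact Submodule.add_mem _ (hL x) (Submodule.smul_mem _ _ (Submodule.add_mem _ hwL (hL w)))
    rcases le_or_gt a (-M - 1) with h | h
    · rw [pullback_eq_top (by omega)]; trivial
    rcases lt_or_ge (-M) a with h' | h'
    · rcases lt_trichotomy a M with h'' | rfl | h''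
      · rw [mem_pullback (by omega) (by omega)] at hx ⊢
        obtain ⟨hx1, hx2⟩ := hx
        exact ⟨hmemL, hF a _ hx2⟩
      · rw [mem_pullback (by omega) (by omega)] at hx
        obtain ⟨hx1, hx2⟩ := hx
        rw [hM _ le_rfl, Submodule.mem_bot, subMk_eq_zero] at hx2
        have h3 : QuadraticMap.polar Q w x = 0 := by
          rw [QuadraticMap.polar_comm]; exact hwL x hx2
        rw [hdiff, h3, h0 x hx2]; simp
      · rw [pullback_eq_bot h'', Submodule.mem_bot] at hx
        rw [hx]; simp
    · obtain rfl : a = -M := by omega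
      rw [mem_pullback (by omega) (by omega)]
      refine ⟨hmemL, ?_⟩
      rw [show -M + 1 = 1 - M by ring, X_eq_top_of_eq_bot hM1 (hM M le_rfl)]
      trivial

end Step

/-! ### Existence of the adapted filtration -/

section Existence

variable {k : Type u} [Field k] {V : Type v} [AddCommGroup V] [Module k V]
variable {Q : QuadraticForm k V} {N : Module.End k V}

theorem sq_eq_sq_of_two_eq_zero (h2 : (2 : k) = 0) {a b : k} (h : a ^ 2 = b ^ 2) : a = b := by
  have : (a - b) ^ 2 = 0 := by linear_combination h + (b ^ 2 - a * b) * h2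
  exact sub_eq_zero.mp (pow_eq_zero_iff (two_ne_zero)|>.mp this)

/-- In characteristic two the form `x ↦ Q (N ^ n x)` is the square of a linear functional on the
kernel of `N ^ (2 * n)`, which is represented by a vector. -/
theorem exists_polar_sq_eq [FiniteDimensional k V] (hN : ∀ x, Q ((1 + N) x) = Q x)
    (h2 : (2 : k) = 0) (hsq : ∀ c : k, ∃ d, d ^ 2 = c) (hQ : IsNondeg Q) {n : ℕ} (hn : 1 ≤ n)
    (hm : N ^ (2 * n + 1) = 0) :
    ∃ w, ∀ x, (N ^ (2 * n)) x = 0 → QuadraticMap.polar Q w x ^ 2 = Q ((N ^ n) x) := by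
  choose s hs using hsq
  have hpol : ∀ x y, (N ^ (2 * n)) y = 0 → QuadraticMap.polar Q ((N ^ n) x) ((N ^ n) y) = 0 := by
    intro x y hy
    rw [polar_pow_pow_top hN hm (by omega), ← two_mul, hy]; simp
  let φ : LinearMap.ker (N ^ (2 * n)) →ₗ[k] k :=
    { toFun := fun x => s (Q ((N ^ n) x))
      map_add' := by
        intro x y
        refine sq_eq_sq_of_two_eq_zero h2 ?_
        rw [hs, Submodule.coe_add, map_add, QuadraticMap.map_add Q, hpol x y y.2]
        linear_combination -(hs (Q ((N ^ n) x))) - hs (Q ((N ^ n) y)) -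
          s (Q ((N ^ n) x)) * s (Q ((N ^ n) y)) * h2
      map_smul' := by
        intro c x
        refine sq_eq_sq_of_two_eq_zero h2 ?_
        rw [hs, Submodule.coe_smul, map_smul, QuadraticMap.map_smul, RingHom.id_apply, smul_eq_mul,
          smul_eq_mul, mul_pow, hs]
        ring }
  obtain ⟨ψ, hψ⟩ := LinearMap.exists_extend φ
  have hψ' : ∀ x (hx : (N ^ (2 * n)) x = 0), ψ x ^ 2 = Q ((N ^ n) x) := by
    intro x hx
    have : ψ x = φ ⟨x, hx⟩ := LinearMap.congr_fun hψ ⟨x, hx⟩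
    rw [this]
    exact hs _
  obtain ⟨w, hw⟩ := exists_polar_eq (Q := Q) ψ (fun r hr => by
    have h1 : N r = 0 := shift_eq_zero_of_orthogonal_range hQ hN hm fun y => hr _
    have hpow : ∀ i, 1 ≤ i → (N ^ i) r = 0 := by
      intro i hi
      obtain ⟨j, rfl⟩ := Nat.exists_eq_add_of_le' hi
      rw [pow_succ, Module.End.mul_apply, h1, map_zero]
    have h3 := hψ' r (hpow _ (by omega))
    rw [hpow n hn, QuadraticMap.map_zero] at h3
    exact pow_eq_zero_iff two_ne_zero |>.mp h3)
  exact ⟨w, fun x hx => by rw [hw, hψ' x hx]⟩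

/-- If `w` represents the functional whose square is `Q (N ^ n x)` and `Q w = 0`, then
`U = im N ^ (2 * n) + k w` is a possible top piece, of degree `2 * n`. -/
theorem exists_isotropic_of_polar_sq (hQ : IsNondeg Q) (hN : ∀ x, Q ((1 + N) x) = Q x)
    {n : ℕ} (hn : 1 ≤ n) (hm : N ^ (2 * n + 1) = 0)
    (hf : ∀ j, 2 * n < 2 * j → ∀ x, Q ((N ^ j) x) = 0) {w : V}
    (hw : ∀ x, (N ^ (2 * n)) x = 0 → QuadraticMap.polar Q w x ^ 2 = Q ((N ^ n) x))
    (hw0 : Q w = 0) :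
    ∃ U : Submodule k V, (∀ x ∈ U, Q x = 0) ∧ ∀ x, x ∈ perp Q U ↔
      (N ^ (2 * n)) x = 0 ∧ ∀ j, 2 * n ≤ 2 * j → Q ((N ^ j) x) = 0 := by
  refine ⟨LinearMap.range (N ^ (2 * n)) ⊔ Submodule.span k {w}, ?_, fun x => ?_⟩
  · intro x hx
    obtain ⟨_, ⟨y, rfl⟩, s, hs, rfl⟩ := Submodule.mem_sup.mp hx
    obtain ⟨c, rfl⟩ := Submodule.mem_span_singleton.mp hs
    have h1 : QuadraticMap.polar Q w ((N ^ (2 * n)) y) = 0 := by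
      have := hw ((N ^ (2 * n)) y) (by
        rw [pow_pow_apply]; exact pow_apply_eq_zero_of_le hm (by omega) _)
      rw [pow_pow_apply, hf _ (by omega)] at this
      exact pow_eq_zero_iff two_ne_zero |>.mp this
    rw [QuadraticMap.map_add Q, QuadraticMap.map_smul, QuadraticMap.polar_smul_right,
      QuadraticMap.polar_comm, h1, hw0, hf _ (by omega)]
    simp
  · have hiso : ∀ x, Q ((N ^ (2 * n)) x) = 0 := hf _ (by omega)
    constructor
    · intro hx
      have h1 : (N ^ (2 * n)) x = 0 :=
        (mem_perp_range_pow_top hQ hN hm hiso).mp (perp_anti le_sup_left hx)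
      refine ⟨h1, fun j hj => ?_⟩
      rcases hj.eq_or_lt with hj | hj
      · obtain rfl : n = j := by omega
        have h3 : QuadraticMap.polar Q w x = 0 :=
          hx w (Submodule.mem_sup_right (Submodule.mem_span_singleton_self w))
        rw [← hw x h1, h3]; simp
      · exact hf j hj x
    · rintro ⟨h1, h3⟩ y hy
      obtain ⟨y, hy', s, hs, rfl⟩ := Submodule.mem_sup.mp hy
      obtain ⟨c, rfl⟩ := Submodule.mem_span_singleton.mp hs
      have h4 : QuadraticMap.polar Q y x = 0 :=
        (mem_perp_range_pow_top hQ hN hm hiso).mpr h1 y hy'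
      have h5 : QuadraticMap.polar Q w x = 0 := by
        have := hw x h1
        rw [h3 n le_rfl] at this
        exact pow_eq_zero_iff two_ne_zero |>.mp this
      change QuadraticMap.polar Q (y + c • w) x = 0
      rw [QuadraticMap.polar_add_left, QuadraticMap.polar_smul_left, h4, h5]; simp

/-- For `n ≥ 2` the vector `w` lies in the image of `N ^ (2 * n - 1)`, where `Q` vanishes. -/
theorem eq_zero_of_polar_sq_of_two_le [FiniteDimensional k V] (hN : ∀ x, Q ((1 + N) x) = Q x)
    (hR : ∀ r, (∀ y, QuadraticMap.polar Q r y = 0) → r = 0)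
    {n : ℕ} (hn : 2 ≤ n) (hm : N ^ (2 * n + 1) = 0)
    (hf : ∀ j, 2 * n < 2 * j → ∀ x, Q ((N ^ j) x) = 0) {w : V}
    (hw : ∀ x, (N ^ (2 * n)) x = 0 → QuadraticMap.polar Q w x ^ 2 = Q ((N ^ n) x)) : Q w = 0 := by
  have hmem : w ∈ LinearMap.range (N ^ (2 * n - 1)) := by
    rw [← perp_perp_of_radical_eq_zero hR (LinearMap.range (N ^ (2 * n - 1)))]
    intro x hx
    have h1 : (N ^ (2 * n - 1)) x = 0 := hR _ (pow_mem_radical_of_mem_perp_range hN hm hx)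
    have h3 := hw x (by
      rw [show 2 * n = 1 + (2 * n - 1) by omega, ← pow_pow_apply, h1, map_zero])
    have h4 : Q ((N ^ n) x) = 0 := by
      have h5 := map_shift hN ((N ^ (n - 1)) x)
      rw [← Module.End.mul_apply, ← pow_succ', polar_pow_shift_left hN, pow_pow_apply,
        show n - 1 + (n - 1 + 1) = 2 * n - 1 by omega, h1, show n - 1 + 1 = n by omega] at h5
      simpa using h5
    rw [h4] at h3
    change QuadraticMap.polar Q x w = 0
    rw [QuadraticMap.polar_comm]
    exact pow_eq_zero_iff two_ne_zero |>.mp h3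
  obtain ⟨u, rfl⟩ := hmem
  exact hf _ (by omega) u

open QFiltration in
/-- The exceptional case `N ^ 3 = 0`: here `w = N u + N ^ 2 v` with `N ^ 2 u = 0`, and the
product of `1 + N` with the reflection in `w` acts trivially on the graded space of the filtration
with `X^{≥ 2} = im N ^ 2` and `X^{≥ 1} = M (ker N ^ 2) + im N ^ 2`, where `M x = N x + ⟨w, x⟩ w`. -/
theorem isOddShift_of_polar_sq [FiniteDimensional k V] (hN : ∀ x, Q ((1 + N) x) = Q x)
    (h2 : (2 : k) = 0) (hR : ∀ r, (∀ y, QuadraticMap.polar Q r y = 0) → r = 0)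
    (hm : N ^ 3 = 0) (hf : ∀ j, 2 < 2 * j → ∀ x, Q ((N ^ j) x) = 0) {w : V}
    (hw : ∀ x, (N ^ 2) x = 0 → QuadraticMap.polar Q w x ^ 2 = Q (N x)) (hw0 : Q w ≠ 0) :
    IsOddShift Q N := by
  have hN2 : ∀ x, N (N x) = (N ^ 2) x := fun x => by rw [pow_two, Module.End.mul_apply]
  have hN3 : ∀ x, N ((N ^ 2) x) = 0 := fun x => by
    rw [← Module.End.mul_apply, ← pow_succ', hm, LinearMap.zero_apply]
  have hN3' : ∀ x, (N ^ 2) (N x) = 0 := fun x => by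
    rw [← Module.End.mul_apply, ← pow_succ, hm, LinearMap.zero_apply]
  have hQ2 : ∀ x, Q ((N ^ 2) x) = 0 := hf 2 (by omega)
  have hself : ∀ x, QuadraticMap.polar Q x x = 0 := fun x => by
    rw [QuadraticMap.polar_self, nsmul_eq_mul]
    push_cast
    rw [h2, zero_mul]
  have hK : ∀ x, x ∈ perp Q (LinearMap.range (N ^ 2)) ↔ (N ^ 2) x = 0 := by
    intro x
    constructor
    · intro hx
      exact hR _ (pow_mem_radical_of_mem_perp_range hN hm hx)
    · rintro hx _ ⟨y, rfl⟩
      change QuadraticMap.polar Q ((N ^ 2) y) x = 0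
      rw [polar_pow_shift_left hN, hx]; simp
  have hmem : w ∈ (LinearMap.ker (N ^ 2)).map N ⊔ LinearMap.range (N ^ 2) := by
    rw [← perp_perp_of_radical_eq_zero hR (_ ⊔ _)]
    intro x hx
    have h1 : (N ^ 2) x = 0 := (hK x).mp (perp_anti le_sup_right hx)
    have h3 : ∀ z, (N ^ 2) z = 0 → QuadraticMap.polar Q (N z) x = 0 := fun z hz =>
      hx _ (Submodule.mem_sup_left ⟨z, hz, rfl⟩)
    have h4 : N x ∈ LinearMap.range (N ^ 2) := by
      rw [← perp_perp_of_radical_eq_zero hR (LinearMap.range (N ^ 2))]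
      intro z hz
      rw [hK] at hz
      have h5 := polar_pow_shift_left hN 1 x (N z)
      rw [pow_one, hN2, hz] at h5
      have h6 := polar_shift_left hN x z
      rw [h5, QuadraticMap.polar_comm Q x (N z), h3 z hz] at h6
      change QuadraticMap.polar Q z (N x) = 0
      rw [QuadraticMap.polar_comm, h6]; simp
    obtain ⟨y, hy⟩ := h4
    have h5 := hw x h1
    rw [← hy, hQ2] at h5
    change QuadraticMap.polar Q x w = 0
    rw [QuadraticMap.polar_comm]
    exact pow_eq_zero_iff two_ne_zero |>.mp h5
  obtain ⟨_, ⟨u, hu, rfl⟩, _, ⟨v, rfl⟩, hwuv⟩ := Submodule.mem_sup.mp hmem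
  replace hu : (N ^ 2) u = 0 := hu
  have hNw : N w = 0 := by rw [← hwuv, map_add, hN2, hu, hN3, add_zero]
  have hw1 : Q w = 1 := by
    have h1 : QuadraticMap.polar Q (N u) ((N ^ 2) v) = 0 := by
      have := polar_pow_shift_left hN 1 u ((N ^ 2) v)
      rw [pow_one, hN3] at this
      simpa using this
    have h3 : Q w = Q (N u) := by
      rw [← hwuv, QuadraticMap.map_add Q, h1, hQ2]; simp
    have h4 : QuadraticMap.polar Q w u = Q w := by
      have h5 : QuadraticMap.polar Q ((N ^ 2) v) u = 0 := by
        rw [polar_pow_shift_left hN, hu]; simp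
      have h6 := map_shift hN u
      rw [h3]
      rw [← hwuv, QuadraticMap.polar_add_left, h5, QuadraticMap.polar_comm, add_zero]
      linear_combination -h6 + QuadraticMap.polar Q u (N u) * h2
    have h5 := hw u hu
    rw [h4, ← h3] at h5
    have h6 : Q w * (Q w - 1) = 0 := by linear_combination h5
    exact sub_eq_zero.mp ((mul_eq_zero.mp h6).resolve_left hw0)
  let M : Module.End k V := N + (QuadraticMap.polarBilin Q w).smulRight w
  have hM : ∀ x, M x = N x + QuadraticMap.polar Q w x • w := fun x => rfl
  have hwN : ∀ x, (N ^ 2) x = 0 → QuadraticMap.polar Q w (N x) = 0 := by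
    intro x hx
    have := hw (N x) (hN3' x)
    rw [hN2, hx, QuadraticMap.map_zero] at this
    exact pow_eq_zero_iff two_ne_zero |>.mp this
  have hwN2 : ∀ x, QuadraticMap.polar Q w ((N ^ 2) x) = 0 := by
    intro x
    rw [← hN2]
    exact hwN _ (hN3' x)
  have hM2 : ∀ x, (N ^ 2) (M x) = 0 := by
    intro x
    rw [hM, map_add, map_smul, hN3', ← hN2, hNw]; simp
  have hMM : ∀ x, (N ^ 2) x = 0 → M (M x) = 0 := by
    intro x hx
    rw [hM (M x), hM x, map_add, map_smul, hNw, hN2, hx, QuadraticMap.polar_add_right,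
      QuadraticMap.polar_smul_right, hwN x hx, hself]
    simp
  have hMN : ∀ x, M ((N ^ 2) x) = 0 := by
    intro x
    rw [hM, hN3, hwN2]; simp
  have hiso : ∀ x ∈ (LinearMap.ker (N ^ 2)).map M ⊔ LinearMap.range (N ^ 2), Q x = 0 := by
    intro z hz
    obtain ⟨_, ⟨x, hx, rfl⟩, _, ⟨y, rfl⟩, rfl⟩ := Submodule.mem_sup.mp hz
    replace hx : (N ^ 2) x = 0 := hx
    have h1 : QuadraticMap.polar Q ((N ^ 2) y) (M x) = 0 := (hK _).mpr (hM2 x) _ ⟨y, rfl⟩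
    rw [QuadraticMap.map_add Q, QuadraticMap.polar_comm, h1, hQ2, hM, QuadraticMap.map_add Q,
      QuadraticMap.map_smul, QuadraticMap.polar_smul_right, QuadraticMap.polar_comm Q (N x), hwN x hx,
      hw1, ← hw x hx]
    simp only [smul_eq_mul]
    linear_combination QuadraticMap.polar Q w x ^ 2 * h2
  let Y : ℤ → Submodule k V := fun a =>
    if a = 1 then (LinearMap.ker (N ^ 2)).map M ⊔ LinearMap.range (N ^ 2)
    else if a = 2 then LinearMap.range (N ^ 2) else ⊥
  have hY1 : Y 1 = (LinearMap.ker (N ^ 2)).map M ⊔ LinearMap.range (N ^ 2) := if_pos rfl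
  have hY2 : Y 2 = LinearMap.range (N ^ 2) := rfl
  have hY3 : ∀ a, 3 ≤ a → Y a = ⊥ := fun a ha => by
    simp only [Y]; rw [if_neg (by omega), if_neg (by omega)]
  have hYanti : ∀ a, 1 ≤ a → Y (a + 1) ≤ Y a := by
    intro a ha
    rcases (show a = 1 ∨ 2 ≤ a by omega) with rfl | h
    · rw [one_add_one_eq_two, hY1, hY2]; exact le_sup_right
    · rw [hY3 _ (by omega)]; exact bot_le
  let F : QFiltration Q := ofIsotropic Y hYanti ⟨3, by omega, hY3 3 le_rfl⟩ (by rwa [hY1])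
  have hFpos : ∀ a, 1 ≤ a → F.X a = Y a := fun a ha => if_pos ha
  have hFneg : ∀ a, a ≤ 0 → F.X a = perp Q (Y (1 - a)) := fun a ha => if_neg (by omega)
  refine ⟨h2, hR, w, hw1, F, fun a x hx => ?_⟩
  have hdiff : (1 + N) (x + QuadraticMap.polar Q w x • w) - x = M x := by
    rw [hM]
    simp only [LinearMap.add_apply, Module.End.one_apply, map_add, map_smul, hNw]
    simp only [add_zero]
    abel
  rw [hdiff]
  have hker : (N ^ 2) x = 0 → M x ∈ Y 1 := fun h => by
    rw [hY1]; exact Submodule.mem_sup_left ⟨x, h, rfl⟩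
  rcases le_or_gt a (-3) with h | h
  · rw [hFneg _ (by omega), hY3 _ (by omega)]
    intro y hy
    rw [(Submodule.mem_bot k).mp hy]; simp
  rcases le_or_gt 3 a with h' | h'
  · rw [hFpos _ (by omega), hY3 _ h', Submodule.mem_bot] at hx
    rw [hx, map_zero]; exact Submodule.zero_mem _
  rcases (show a = -2 ∨ a = -1 ∨ a = 0 ∨ a = 1 ∨ a = 2 by omega) with rfl | rfl | rfl | rfl | rfl
  · rw [hFneg _ (by omega), show 1 - (-2 + 1 : ℤ) = 2 by norm_num, hY2, hK]
    exact hM2 x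
  · rw [hFneg _ (by omega), show 1 - (-1 : ℤ) = 2 by norm_num, hY2, hK] at hx
    refine F.antitone (show (-1 + 1 : ℤ) ≤ 1 by norm_num) ?_
    rw [hFpos _ le_rfl]
    exact hker hx
  · rw [hFneg _ le_rfl, sub_zero] at hx
    rw [zero_add, hFpos _ le_rfl]
    refine hker ((hK x).mp (perp_anti ?_ hx))
    rw [hY1]; exact le_sup_right
  · rw [hFpos _ le_rfl, hY1] at hx
    obtain ⟨_, ⟨x, hx', rfl⟩, _, ⟨y, rfl⟩, rfl⟩ := Submodule.mem_sup.mp hx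
    rw [map_add, hMM x hx', hMN, add_zero]
    exact Submodule.zero_mem _
  · rw [hFpos _ (by omega), hY2] at hx
    obtain ⟨y, rfl⟩ := hx
    rw [hMN]
    exact Submodule.zero_mem _

/-- One step of the construction: the top piece `U = X^{≥ m}` of the adapted filtration. Its
orthogonal complement must be the set of all `x` that `N ^ m` and, in even degree `m = 2 * n`, the form
`Q (N ^ n x)` do not detect. The image of `N ^ m` has this property unless that form is nonzero on
the kernel of `N ^ m`, which is possible only in characteristic two. -/
theorem exists_top_piece [FiniteDimensional k V] (hsq : (2 : k) = 0 → ∀ c : k, ∃ d, d ^ 2 = c)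
    (hQ : IsNondeg Q) (hN : ∀ x, Q ((1 + N) x) = Q x)
    {m : ℕ} (hm1 : 1 ≤ m) (hm : N ^ (m + 1) = 0) (hf : ∀ j, m < 2 * j → ∀ x, Q ((N ^ j) x) = 0) :
    (∃ U : Submodule k V, (∀ x ∈ U, Q x = 0) ∧ ∀ x, x ∈ perp Q U ↔
      (N ^ m) x = 0 ∧ ∀ j, m ≤ 2 * j → Q ((N ^ j) x) = 0) ∨ IsOddShift Q N := by
  by_cases hA : ∀ x, (N ^ m) x = 0 → ∀ j, m ≤ 2 * j → Q ((N ^ j) x) = 0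
  · have hiso : ∀ x, Q ((N ^ m) x) = 0 := hf _ (by omega)
    refine Or.inl ⟨LinearMap.range (N ^ m), ?_, fun x => ?_⟩
    · rintro _ ⟨y, rfl⟩
      exact hiso y
    · rw [mem_perp_range_pow_top hQ hN hm hiso]
      exact ⟨fun h => ⟨h, hA x h⟩, fun h => h.1⟩
  push Not at hA
  obtain ⟨x₀, hx₀, n, hn, hne⟩ := hA
  obtain rfl : m = 2 * n := by
    rcases hn.eq_or_lt with h | h
    · exact h
    · exact absurd (hf n h x₀) hne
  have hn1 : 1 ≤ n := by omega
  have h2 : (2 : k) = 0 := by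
    have h1 := polar_pow_pow_top hN (i := n) (j := n) hm (by omega) x₀ x₀
    rw [QuadraticMap.polar_self, ← two_mul, hx₀, QuadraticMap.polar_zero_right, mul_zero,
      nsmul_eq_mul] at h1
    exact_mod_cast (mul_eq_zero.mp h1).resolve_right hne
  obtain ⟨w, hw⟩ := exists_polar_sq_eq hN h2 (hsq h2) hQ hn1 hm
  by_cases hw0 : Q w = 0
  · exact Or.inl (exists_isotropic_of_polar_sq hQ hN hn1 hm hf hw hw0)
  by_cases hR : ∀ r, (∀ y, QuadraticMap.polar Q r y = 0) → r = 0
  · right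
    have hn' : n = 1 := by
      by_contra h
      exact hw0 (eq_zero_of_polar_sq_of_two_le hN hR (by omega) hm hf hw)
    subst hn'
    exact isOddShift_of_polar_sq hN h2 hR hm (by simpa using hf) (by simpa using hw) hw0
  · left
    -- `w` matters only up to the radical, where `Q` takes all values
    push Not at hR
    obtain ⟨r, hr, hr0⟩ := hR
    have hQr : Q r ≠ 0 := fun h => hr0 (eq_zero_of_mem_radical hQ hr h)
    obtain ⟨c, hc⟩ := hsq h2 (Q w / Q r)
    refine exists_isotropic_of_polar_sq hQ hN hn1 hm hf (w := w + c • r) (fun x hx => ?_) ?_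
    · rw [QuadraticMap.polar_add_left, QuadraticMap.polar_smul_left, hr, smul_zero, add_zero,
        hw x hx]
    · have h1 : c * c * Q r = Q w := by rw [← pow_two, hc, div_mul_cancel₀ _ hQr]
      rw [QuadraticMap.map_add Q, QuadraticMap.map_smul, QuadraticMap.polar_comm,
        QuadraticMap.polar_smul_left, hr, smul_eq_mul, h1]
      simp only [smul_zero, add_zero]
      linear_combination Q w * h2

/-- Over a perfect field, every unipotent isometry has an adapted filtration, or differs by a
reflection from an isometry which acts trivially on the graded space of a `Q`-filtration. The
induction is on a bound `m` for the degrees, which is expressed through `N`. -/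
theorem exists_isAdapted_aux (hsq : (2 : k) = 0 → ∀ c : k, ∃ d, d ^ 2 = c) (m : ℕ)
    (V : Type v) [AddCommGroup V] [Module k V] [FiniteDimensional k V]
    (Q : QuadraticForm k V) (N : Module.End k V) (hQ : IsNondeg Q)
    (hN : ∀ x, Q ((1 + N) x) = Q x) (hm : N ^ (m + 1) = 0)
    (hf : ∀ j, m < 2 * j → ∀ x, Q ((N ^ j) x) = 0) :
    (∃ F : QFiltration Q, F.IsAdapted N ∧ F.X (m + 1) = ⊥) ∨ IsOddShift Q N := by
  induction m generalizing V with
  | zero =>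
    left
    obtain rfl : N = 0 := by simpa using hm
    let F : QFiltration Q := QFiltration.ofIsotropic (fun _ => ⊥) (fun _ _ => le_rfl)
      ⟨1, le_rfl, rfl⟩ (by simp)
    have hpos : ∀ a, 1 ≤ a → F.X a = ⊥ := fun a ha => if_pos ha
    have hneg : ∀ a, a ≤ 0 → F.X a = ⊤ := fun a ha => by
      have h := QFiltration.X_eq_top_of_eq_bot (F := F) (a := 1) le_rfl (hpos 1 le_rfl)
      exact top_le_iff.mp (h ▸ F.antitone (show a ≤ 1 - 1 by omega))
    refine ⟨F, ⟨fun a x _ => by simp, fun n x _ h1 h2 => ?_, fun n x _ _ => ?_⟩,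
      hpos _ (by simp)⟩
    · cases n with
      | zero =>
        have : x = 0 := by
          refine eq_zero_of_mem_radical hQ (fun y => ?_) (by simpa using h2)
          simpa using h1 y (by rw [hneg _ (by simp)]; trivial)
        rw [this]; exact Submodule.zero_mem _
      | succ n => rw [hneg _ (by push_cast; omega)]; trivial
    · rw [hneg _ (by omega)]; trivial
  | succ m ih =>
    rcases exists_top_piece hsq hQ hN (m := m + 1) (by omega) hm hf with ⟨U, hU, hperp⟩ | h
    · have hL : ∀ x, N x ∈ perp Q U := fun x => by
        rw [hperp]
        refine ⟨by rw [← Module.End.mul_apply, ← pow_succ, hm, LinearMap.zero_apply],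
          fun j hj => ?_⟩
        rw [← Module.End.mul_apply, ← pow_succ]
        exact hf _ (by omega) x
      have h0 : ∀ x ∈ U, N x = 0 := fun x hx =>
        shift_eq_zero_of_orthogonal_range hQ hN hm fun y => hL y x hx
      have hm' : subEnd N hL h0 ^ (m + 1) = 0 := by
        refine LinearMap.ext fun x => ?_
        obtain ⟨x, hx, rfl⟩ := subMk_surjective x
        rw [subEnd_pow_subMk, LinearMap.zero_apply, subMk_eq_zero, ((hperp x).mp hx).1]
        exact U.zero_mem
      have hf' : ∀ j, m < 2 * j → ∀ x, subForm U hU ((subEnd N hL h0 ^ j) x) = 0 := by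
        intro j hj x
        obtain ⟨x, hx, rfl⟩ := subMk_surjective x
        rw [subEnd_pow_subMk, subForm_subMk]
        exact ((hperp x).mp hx).2 j (by omega)
      rcases ih (Subquot Q U) (subForm U hU) (subEnd N hL h0) (subForm_isNondeg hQ)
        (subForm_one_add_subEnd hN) hm' hf' with ⟨F, hF, hFb⟩ | h
      · left
        have hF' : F.X ((m + 1 : ℕ) : ℤ) = ⊥ := by push_cast; exact hFb
        exact ⟨_, isAdapted_pullback hQ hN (by omega) hm hf hperp F hF' hF,
          QFiltration.pullback_eq_bot (by omega)⟩
      · exact Or.inr (h.of_subquot hQ)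
    · exact Or.inr h

theorem exists_isAdapted [FiniteDimensional k V] (hsq : (2 : k) = 0 → ∀ c : k, ∃ d, d ^ 2 = c)
    (hQ : IsNondeg Q) (hN : ∀ x, Q ((1 + N) x) = Q x) (hnil : IsNilpotent N) :
    (∃ F : QFiltration Q, F.IsAdapted N) ∨ IsOddShift Q N := by
  obtain ⟨r, hr⟩ := hnil
  rcases exists_isAdapted_aux hsq (2 * r) V Q N hQ hN (pow_eq_zero_of_le (by omega) hr)
    (fun j hj x => by
      rw [pow_apply_eq_zero_of_le hr (by omega), QuadraticMap.map_zero]) with ⟨F, hF, -⟩ | h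
  · exact Or.inl ⟨F, hF⟩
  · exact Or.inr h

end Existence

/-! ### The Zariski topology and the identity component -/

section Zariski

variable {K : Type*} [Field K] {E : Type*} [AddCommGroup E] [Module K E]

theorem exists_polyFun_of_isOpen {u : Set E} (hu : @IsOpen E (zariski K E) u) {x : E}
    (hx : x ∈ u) : ∃ f ∈ polyFun K E, f x ≠ 0 ∧ ∀ y, f y ≠ 0 → y ∈ u := by
  induction hu with
  | basic s hs =>
    obtain ⟨f, hf, rfl⟩ := hs
    exact ⟨f, hf, hx, fun _ h => h⟩
  | univ => exact ⟨1, Subalgebra.one_mem _, by simp, fun _ _ => trivial⟩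
  | inter s t _ _ hs ht =>
    obtain ⟨f, hf, hfx, hfs⟩ := hs hx.1
    obtain ⟨g, hg, hgx, hgt⟩ := ht hx.2
    refine ⟨f * g, Subalgebra.mul_mem _ hf hg, mul_ne_zero hfx hgx, fun y hy => ?_⟩
    exact ⟨hfs y (left_ne_zero_of_mul hy), hgt y (right_ne_zero_of_mul hy)⟩
  | sUnion S _ ih =>
    obtain ⟨s, hs, hxs⟩ := hx
    obtain ⟨f, hf, hfx, hfs⟩ := ih s hs hxs
    exact ⟨f, hf, hfx, fun y hy => ⟨s, hs, hfs y hy⟩⟩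

theorem isOpen_polyFun_ne_zero {f : E → K} (hf : f ∈ polyFun K E) :
    @IsOpen E (zariski K E) {x | f x ≠ 0} :=
  TopologicalSpace.isOpen_generateFrom_of_mem ⟨f, hf, rfl⟩

theorem linear_mem_polyFun (l : Module.Dual K E) : (l : E → K) ∈ polyFun K E :=
  Algebra.subset_adjoin ⟨l, rfl⟩

theorem comp_linear_mem_polyFun {E' : Type*} [AddCommGroup E'] [Module K E'] (L : E →ₗ[K] E')
    {f : E' → K} (hf : f ∈ polyFun K E') : f ∘ L ∈ polyFun K E := by
  induction hf using Algebra.adjoin_induction with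
  | mem f hf =>
    obtain ⟨l, rfl⟩ := hf
    exact linear_mem_polyFun (l ∘ₗ L)
  | algebraMap r => exact Subalgebra.algebraMap_mem _ r
  | add f g _ _ hf hg => exact Subalgebra.add_mem _ hf hg
  | mul f g _ _ hf hg => exact Subalgebra.mul_mem _ hf hg

theorem continuous_linear_zariski {E' : Type*} [AddCommGroup E'] [Module K E']
    (L : E →ₗ[K] E') : @Continuous E E' (zariski K E) (zariski K E') L := by
  let _ := zariski K E
  let _ := zariski K E'
  refine continuous_generateFrom_iff.mpr ?_
  rintro _ ⟨f, hf, rfl⟩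
  exact isOpen_polyFun_ne_zero (comp_linear_mem_polyFun L hf)

/-- The image of the affine line under a polynomial map is connected, being irreducible. -/
theorem isPreconnected_range_curve [Infinite K] (c : K → E)
    (hc : ∀ l : Module.Dual K E, ∃ p : Polynomial K, ∀ t, l (c t) = p.eval t) :
    @IsPreconnected E (zariski K E) (Set.range c) := by
  let _ := zariski K E
  have hpoly : ∀ f ∈ polyFun K E, ∃ p : Polynomial K, ∀ t, f (c t) = p.eval t := by
    intro f hf
    induction hf using Algebra.adjoin_induction with
    | mem f hf =>
      obtain ⟨l, rfl⟩ := hf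
      exact hc l
    | algebraMap r => exact ⟨Polynomial.C r, fun t => by simp⟩
    | add f g _ _ hf hg =>
      obtain ⟨p, hp⟩ := hf
      obtain ⟨q, hq⟩ := hg
      exact ⟨p + q, fun t => by simp [hp, hq]⟩
    | mul f g _ _ hf hg =>
      obtain ⟨p, hp⟩ := hf
      obtain ⟨q, hq⟩ := hg
      exact ⟨p * q, fun t => by simp [hp, hq]⟩
  rintro u v hu hv - ⟨_, ⟨a, rfl⟩, ha⟩ ⟨_, ⟨b, rfl⟩, hb⟩
  obtain ⟨f, hf, hfa, hfu⟩ := exists_polyFun_of_isOpen hu ha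
  obtain ⟨g, hg, hgb, hgv⟩ := exists_polyFun_of_isOpen hv hb
  obtain ⟨p, hp⟩ := hpoly f hf
  obtain ⟨q, hq⟩ := hpoly g hg
  have hp0 : p ≠ 0 := by rintro rfl; simp [hp] at hfa
  have hq0 : q ≠ 0 := by rintro rfl; simp [hq] at hgb
  obtain ⟨t, ht⟩ : ∃ t, (p * q).eval t ≠ 0 := by
    by_contra h
    push Not at h
    exact mul_ne_zero hp0 hq0 (Polynomial.funext fun t => by rw [h t, Polynomial.eval_zero])
  rw [Polynomial.eval_mul] at ht
  exact ⟨c t, ⟨t, rfl⟩, hfu _ (by rw [hp]; exact left_ne_zero_of_mul ht),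
    hgv _ (by rw [hq]; exact right_ne_zero_of_mul ht)⟩

end Zariski

section IdentityComponent

variable {K : Type*} [Field K] {W : Type*} [AddCommGroup W] [Module K W] {Q : QuadraticForm K W}

theorem one_mem_orthGroup : (1 : Module.End K W) ∈ orthGroup Q := ⟨isUnit_one, fun _ => rfl⟩

theorem mul_mem_orthGroup {g h : Module.End K W} (hg : g ∈ orthGroup Q) (hh : h ∈ orthGroup Q) :
    g * h ∈ orthGroup Q :=
  ⟨hg.1.mul hh.1, fun x => by rw [Module.End.mul_apply, hg.2, hh.2]⟩

theorem exists_inv_orthGroup {g : Module.End K W} (hg : g ∈ orthGroup Q) :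
    ∃ h ∈ orthGroup Q, h * g = 1 ∧ g * h = 1 := by
  obtain ⟨⟨u, u', h1, h2⟩, rfl⟩ := hg.1
  refine ⟨u', ⟨⟨⟨u', u, h2, h1⟩, rfl⟩, fun x => ?_⟩, h2, h1⟩
  have h3 := hg.2 (u' x)
  have h4 : u (u' x) = x := by rw [← Module.End.mul_apply, h1, Module.End.one_apply]
  rw [← h3]
  exact congrArg Q h4

theorem one_mem_identityComponent : (1 : Module.End K W) ∈ identityComponent Q := by
  let _ := zariski K (Module.End K W)
  exact mem_connectedComponentIn one_mem_orthGroup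

theorem identityComponent_subset : identityComponent Q ⊆ orthGroup Q := by
  let _ := zariski K (Module.End K W)
  exact connectedComponentIn_subset _ _

theorem isPreconnected_mul_identityComponent (g : Module.End K W) :
    @IsPreconnected _ (zariski K (Module.End K W)) ((fun h => g * h) '' identityComponent Q) := by
  let _ := zariski K (Module.End K W)
  exact isPreconnected_connectedComponentIn.image _
    (continuous_linear_zariski (LinearMap.mulLeft K g)).continuousOn

theorem mul_mem_identityComponent {g h : Module.End K W} (hg : g ∈ identityComponent Q)
    (hh : h ∈ identityComponent Q) : g * h ∈ identityComponent Q := by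
  let _ := zariski K (Module.End K W)
  have h1 : (fun h => g * h) '' identityComponent Q ⊆ connectedComponentIn (orthGroup Q) g := by
    refine (isPreconnected_mul_identityComponent g).subset_connectedComponentIn
      ⟨1, one_mem_identityComponent, mul_one g⟩ ?_
    rintro _ ⟨h, hh, rfl⟩
    exact mul_mem_orthGroup (identityComponent_subset hg) (identityComponent_subset hh)
  have h2 : connectedComponentIn (orthGroup Q) 1 = connectedComponentIn (orthGroup Q) g :=
    connectedComponentIn_eq hg
  rw [identityComponent, h2]
  exact h1 ⟨h, hh, rfl⟩

theorem exists_inv_identityComponent {g : Module.End K W} (hg : g ∈ identityComponent Q) :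
    ∃ h ∈ identityComponent Q, h * g = 1 ∧ g * h = 1 := by
  let _ := zariski K (Module.End K W)
  obtain ⟨h, hh, h1, h2⟩ := exists_inv_orthGroup (identityComponent_subset hg)
  refine ⟨h, ?_, h1, h2⟩
  have h3 : (fun x => h * x) '' identityComponent Q ⊆ identityComponent Q := by
    refine (isPreconnected_mul_identityComponent h).subset_connectedComponentIn ⟨g, hg, h1⟩ ?_
    rintro _ ⟨x, hx, rfl⟩
    exact mul_mem_orthGroup hh (identityComponent_subset hx)
  exact h3 ⟨1, one_mem_identityComponent, mul_one h⟩

/-- Orbits of the identity component with a common element are equal. -/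
theorem isotropicOrbits_eq {j j' : Set (Submodule K W)} (hj : j ∈ isotropicOrbits Q)
    (hj' : j' ∈ isotropicOrbits Q) {S : Submodule K W} (h : S ∈ j) (h' : S ∈ j') : j = j' := by
  have aux : ∀ {j j' : Set (Submodule K W)}, j ∈ isotropicOrbits Q → j' ∈ isotropicOrbits Q →
      S ∈ j → S ∈ j' → j ⊆ j' := by
    rintro _ _ ⟨S₁, -, rfl⟩ ⟨S₂, -, rfl⟩ ⟨g, hg, hS⟩ ⟨g', hg', hS'⟩ _ ⟨h, hh, rfl⟩
    obtain ⟨i, hi, h1, -⟩ := exists_inv_identityComponent hg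
    refine ⟨h * (i * g'), mul_mem_identityComponent hh (mul_mem_identityComponent hi hg'), ?_⟩
    have h2 : S₁ = S₂.map (i * g') := by
      rw [Module.End.mul_eq_comp, Submodule.map_comp, ← hS', hS, ← Submodule.map_comp,
        ← Module.End.mul_eq_comp, h1, Module.End.one_eq_id, Submodule.map_id]
    rw [Module.End.mul_eq_comp h, Submodule.map_comp, ← h2]
  exact (aux hj hj' h h').antisymm (aux hj' hj h' h)

/-- A polynomial function which takes only the values `0` and `1` on `O_Q` is constant on the identity
component. -/
theorem eq_zero_of_mem_identityComponent {d : Module.End K W → K}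
    (hd : d ∈ polyFun K (Module.End K W)) (h01 : ∀ g ∈ orthGroup Q, d g = 0 ∨ d g = 1)
    (h1 : d 1 = 0) {g : Module.End K W} (hg : g ∈ identityComponent Q) : d g = 0 := by
  let _ := zariski K (Module.End K W)
  by_contra hne
  have hpre : IsPreconnected (identityComponent Q) := isPreconnected_connectedComponentIn
  have hd' : 1 - d ∈ polyFun K (Module.End K W) :=
    Subalgebra.sub_mem _ (Subalgebra.one_mem _) hd
  obtain ⟨x, hx, hx1, hx2⟩ := hpre _ _ (isOpen_polyFun_ne_zero hd) (isOpen_polyFun_ne_zero hd')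
    (fun x hx => by
      rcases h01 x (identityComponent_subset hx) with h | h
      · right; simp [h]
      · left; simp [h])
    ⟨g, hg, hne⟩ ⟨1, one_mem_identityComponent, by simp [h1]⟩
  rcases h01 x (identityComponent_subset hx) with h | h
  · exact hx1 h
  · exact hx2 (by simp [h])

end IdentityComponent

/-! ### Bases adapted to a `Q`-filtration -/

section AdaptedBasis

variable {k : Type u} [Field k] {V : Type v} [AddCommGroup V] [Module k V]
variable {Q : QuadraticForm k V}

/-- A basis of `X^{≥ 1}` compatible with the flag of the terms of degree `≥ 1`. -/
theorem QFiltration.exists_flag_basis [FiniteDimensional k V] (F : QFiltration Q) :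
    ∃ (n : ℕ) (x : Fin n → V) (d : Fin n → ℤ), LinearIndependent k x ∧ (∀ i, 1 ≤ d i) ∧
      (∀ i, x i ∈ F.X (d i)) ∧
      ∀ a, 1 ≤ a → ∀ v ∈ F.X a, v ∈ Submodule.span k (x '' {i | a ≤ d i}) := by
  obtain ⟨A, hA1, hA⟩ := F.exists_forall_ge_eq_bot
  have key : ∀ a ≤ A, 1 ≤ a → ∃ s : Set V, LinearIndepOn k id s ∧ s ⊆ F.X a ∧
      ∀ b, a ≤ b → ∀ v ∈ F.X b, v ∈ Submodule.span k (s ∩ F.X b) := by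
    refine Int.leInductionDown ?_ ?_
    · intro _
      refine ⟨∅, linearIndepOn_empty k id, by simp, fun b hb v hv => ?_⟩
      rw [hA b hb, Submodule.mem_bot] at hv
      rw [hv]; exact Submodule.zero_mem _
    · intro a _ ih ha
      obtain ⟨s, hs, hsub, hspan⟩ := ih (by omega)
      obtain ⟨t, htX, hst, hXt, ht⟩ := exists_linearIndepOn_id_extension hs
        (hsub.trans (F.antitone (show a - 1 ≤ a by omega)))
      refine ⟨t, ht, htX, fun b hb v hv => ?_⟩
      rcases hb.eq_or_lt with rfl | hb
      · rw [Set.inter_eq_left.mpr htX]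
        exact hXt hv
      · exact Submodule.span_mono (Set.inter_subset_inter_left _ hst) (hspan b (by omega) v hv)
  obtain ⟨s, hs, hsub, hspan⟩ := key 1 hA1 le_rfl
  have hfin : s.Finite := LinearIndependent.setFinite hs.linearIndependent
  have : Fintype s := hfin.fintype
  have hdeg : ∀ v : s, ∃ d : ℤ, 1 ≤ d ∧ (v : V) ∈ F.X d ∧ (v : V) ∉ F.X (d + 1) := by
    intro v
    by_contra h
    push Not at h
    have h1 : ∀ d, 1 ≤ d → (v : V) ∈ F.X d :=
      Int.leInduction (hsub v.2) fun d hd ih => h d hd ih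
    have h2 := h1 A hA1
    rw [hA A le_rfl, Submodule.mem_bot] at h2
    exact hs.ne_zero v.2 h2
  choose d hd1 hd2 hd3 using hdeg
  let e : Fin (Fintype.card s) ≃ s := (Fintype.equivFin s).symm
  refine ⟨Fintype.card s, fun i => (e i : V), fun i => d (e i), ?_, fun i => hd1 _,
    fun i => hd2 _, fun a ha v hv => ?_⟩
  · exact LinearIndependent.comp hs e e.injective
  · refine Submodule.span_mono ?_ (hspan a ha v hv)
    rintro y ⟨hy, hya⟩
    refine ⟨e.symm ⟨y, hy⟩, ?_, by simp⟩
    simp only [Set.mem_ofPred_eq, Equiv.apply_symm_apply]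
    by_contra hlt
    exact hd3 ⟨y, hy⟩ (F.antitone (by omega) hya)

/-- A basis of `V` which splits the filtration compatibly with `Q`: it defines a one-parameter group
of isometries which acts on the span of the basis vectors of degree `a` as the scalar `t ^ a`. -/
structure AdaptedBasis (F : QFiltration Q) (I : Type*) where
  /-- the basis -/
  b : Module.Basis I k V
  /-- the degrees of the basis vectors -/
  deg : I → ℤ
  mem : ∀ i, b i ∈ F.X (deg i)
  repr_eq_zero : ∀ a, ∀ v ∈ F.X a, ∀ i, deg i < a → b.repr v i = 0
  form_eq_zero : ∀ i, deg i ≠ 0 → Q (b i) = 0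
  polar_eq_zero : ∀ i j, deg i + deg j ≠ 0 → QuadraticMap.polar Q (b i) (b j) = 0

open QFiltration in
/-- A basis of `X^{≥ 1}`, a basis of a complement `C` of `X^{≥ 1}` in `X^{≥ 0}` which contains the
radical, and a basis dual to the first one form an adapted basis. The dual vectors can be
made isotropic and mutually orthogonal by subtracting elements of `X^{≥ 1}`. -/
theorem exists_adaptedBasis [FiniteDimensional k V] (hQ : IsNondeg Q) (F : QFiltration Q) :
    ∃ n r : ℕ, Nonempty (AdaptedBasis F ((Fin n ⊕ Fin r) ⊕ Fin n)) := by
  obtain ⟨n, x, d, hx, hd, hxd, hspan⟩ := F.exists_flag_basis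
  have hx1 : ∀ i, x i ∈ F.X 1 := fun i => F.antitone (hd i) (hxd i)
  have hspan1 : Submodule.span k (Set.range x) = F.X 1 := by
    refine le_antisymm (Submodule.span_le.mpr ?_) fun v hv => ?_
    · rintro _ ⟨i, rfl⟩; exact hx1 i
    · exact Submodule.span_mono (Set.image_subset_range _ _) (hspan 1 le_rfl v hv)
  have hdisj : Disjoint (perp Q ⊤) (F.X 1) := by
    rw [Submodule.disjoint_def]
    intro v hv hv1
    refine eq_zero_of_mem_radical hQ (fun y => ?_) (F.isotropic 1 le_rfl v hv1)
    rw [QuadraticMap.polar_comm]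
    exact hv y trivial
  obtain ⟨C', hRC', hC'⟩ := hdisj.exists_isCompl
  let C := C' ⊓ F.X 0
  have hRC : perp Q ⊤ ≤ C := le_inf hRC' (by
    rw [F.X_eq_perp le_rfl]; exact perp_anti le_top)
  have hCX : C ⊔ F.X 1 = F.X 0 := by
    have h10 : F.X 1 ≤ F.X 0 := F.antitone (by norm_num)
    rw [sup_comm, ← sup_inf_assoc_of_le C' h10, sup_comm, hC'.sup_eq_top, top_inf_eq]
  have hdisjC : Disjoint (F.X 1) C := hC'.disjoint.symm.mono_right inf_le_left
  let cb := Module.finBasis k C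
  let c : Fin (Module.finrank k C) → V := fun i => cb i
  have hc0 : ∀ i, c i ∈ F.X 0 := fun i => (cb i).2.2
  have hcspan : Submodule.span k (Set.range c) = C := by
    have : Set.range c = C.subtype '' Set.range cb := by
      rw [← Set.range_comp]; rfl
    rw [this, Submodule.span_image, cb.span_eq, Submodule.map_subtype_top]
  have hcli : LinearIndependent k c := cb.linearIndependent.map' C.subtype C.ker_subtype
  have hli : LinearIndependent k (Sum.elim x c) := hx.sum_type hcli (by rw [hspan1, hcspan]; exact hdisjC)
  obtain ⟨G, hG⟩ := LinearMap.exists_leftInverse_of_injective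
    (Finsupp.linearCombination k (Sum.elim x c)) (LinearMap.ker_eq_bot.mpr hli)
  have hG' : ∀ i, G (Sum.elim x c i) = Finsupp.single i 1 := fun i => by
    have := LinearMap.congr_fun hG (Finsupp.single i 1)
    simpa using this
  have hy₀ : ∀ j : Fin n, ∃ y, ∀ v, QuadraticMap.polar Q y v =
      (Finsupp.lapply (Sum.inl j) ∘ₗ G : V →ₗ[k] k) v := by
    intro j
    refine exists_polar_eq _ fun r hr => ?_
    have hrC : r ∈ Submodule.span k (Set.range c) := by
      rw [hcspan]
      refine hRC fun y _ => ?_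
      change QuadraticMap.polar Q y r = 0
      rw [QuadraticMap.polar_comm]; exact hr y
    have : Submodule.span k (Set.range c) ≤
        LinearMap.ker (Finsupp.lapply (Sum.inl j) ∘ₗ G : V →ₗ[k] k) := by
      rw [Submodule.span_le]
      rintro _ ⟨i, rfl⟩
      have := hG' (Sum.inr i)
      rw [Sum.elim_inr] at this
      simp [this]
    exact this hrC
  choose y₀ hy₀ using hy₀
  have hy₀x : ∀ j i, QuadraticMap.polar Q (y₀ j) (x i) = if j = i then 1 else 0 := by
    intro j i
    have := hG' (Sum.inl i)
    rw [Sum.elim_inl] at this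
    rw [hy₀, LinearMap.comp_apply, this, Finsupp.lapply_apply, Finsupp.single_apply]
    simp [eq_comm]
  have hy₀c : ∀ j i, QuadraticMap.polar Q (y₀ j) (c i) = 0 := by
    intro j i
    have := hG' (Sum.inr i)
    rw [Sum.elim_inr] at this
    rw [hy₀, LinearMap.comp_apply, this, Finsupp.lapply_apply, Finsupp.single_apply]
    simp
  -- the correction makes `y₀ j - z j` isotropic; summing over `i < j` only keeps this valid in
  -- characteristic two
  let z : Fin n → V := fun j =>
    ∑ i, (if i < j then QuadraticMap.polar Q (y₀ i) (y₀ j) else if i = j then Q (y₀ j) else 0) • x i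
  have hz1 : ∀ j, z j ∈ F.X 1 := fun j =>
    Submodule.sum_mem _ fun i _ => Submodule.smul_mem _ _ (hx1 i)
  have hy₀z : ∀ l j, QuadraticMap.polar Q (y₀ l) (z j) =
      if l < j then QuadraticMap.polar Q (y₀ l) (y₀ j) else if l = j then Q (y₀ j) else 0 := by
    intro l j
    have : QuadraticMap.polar Q (y₀ l) (z j) = Q.polarBilin (y₀ l) (z j) := rfl
    rw [this]
    simp only [z, map_sum, map_smul, QuadraticMap.polarBilin_apply_apply, hy₀x]
    simp
  have h11 : ∀ {v w : V}, v ∈ F.X 1 → w ∈ F.X 0 → QuadraticMap.polar Q v w = 0 := fun hv hw =>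
    polar_eq_zero_of_one_le (a := 1) (b := 0) (by norm_num) hv hw
  have h10 : ∀ {v : V}, v ∈ F.X 1 → v ∈ F.X 0 := fun hv => F.antitone (by norm_num) hv
  let y : Fin n → V := fun j => y₀ j - z j
  have hyx : ∀ j i, QuadraticMap.polar Q (y j) (x i) = if j = i then 1 else 0 := fun j i => by
    rw [QuadraticMap.polar_sub_left, h11 (hz1 j) (h10 (hx1 i)), hy₀x, sub_zero]
  have hyc : ∀ j i, QuadraticMap.polar Q (y j) (c i) = 0 := fun j i => by
    rw [QuadraticMap.polar_sub_left, h11 (hz1 j) (hc0 i), hy₀c, sub_zero]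
  have hQy : ∀ j, Q (y j) = 0 := fun j => by
    have h1 : Q (z j) = 0 := F.isotropic 1 le_rfl _ (hz1 j)
    have h2 := hy₀z j j
    rw [if_neg (lt_irrefl _), if_pos rfl] at h2
    change Q (y₀ j - z j) = 0
    rw [sub_eq_add_neg, QuadraticMap.map_add Q, QuadraticMap.map_neg, QuadraticMap.polar_neg_right,
      h1, h2]
    ring
  have hyy_lt : ∀ j l, j < l → QuadraticMap.polar Q (y j) (y l) = 0 := fun j l hjl => by
    change QuadraticMap.polar Q (y₀ j - z j) (y₀ l - z l) = 0
    rw [QuadraticMap.polar_sub_left, QuadraticMap.polar_sub_right, QuadraticMap.polar_sub_right,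
      h11 (hz1 j) (h10 (hz1 l)), QuadraticMap.polar_comm Q (z j), hy₀z, hy₀z, if_pos hjl,
      if_neg (not_lt_of_gt hjl), if_neg hjl.ne']
    ring
  have hyy : ∀ j l, QuadraticMap.polar Q (y j) (y l) = 0 := fun j l => by
    rcases lt_trichotomy j l with h | rfl | h
    · exact hyy_lt j l h
    · rw [QuadraticMap.polar_self, hQy, smul_zero]
    · rw [QuadraticMap.polar_comm]; exact hyy_lt l j h
  let e : (Fin n ⊕ Fin (Module.finrank k C)) ⊕ Fin n → V := Sum.elim (Sum.elim x c) y
  have hpolx : ∀ (a : Fin n → k) (l : Fin n),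
      QuadraticMap.polar Q (∑ i, a i • y i) (x l) = a l := by
    intro a l
    have : QuadraticMap.polar Q (∑ i, a i • y i) (x l) = Q.polarBilin.flip (x l) (∑ i, a i • y i) :=
      rfl
    rw [this]
    simp only [map_sum, map_smul, LinearMap.flip_apply, QuadraticMap.polarBilin_apply_apply, hyx]
    simp
  have hX0 : ∀ v ∈ F.X 0, v ∈ Submodule.span k (Set.range (Sum.elim x c)) := by
    intro v hv
    rw [Set.Sum.elim_range, Submodule.span_union, hspan1, hcspan, sup_comm, hCX]
    exact hv
  have heli : LinearIndependent k e := by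
    rw [Fintype.linearIndependent_iff]
    intro g hg
    rw [Fintype.sum_sum_type] at hg
    have h0 : ∑ i, g (Sum.inl i) • e (Sum.inl i) ∈ F.X 0 := by
      refine Submodule.sum_mem _ fun i _ => Submodule.smul_mem _ _ ?_
      rcases i with i | i
      · exact h10 (hx1 i)
      · exact hc0 i
    have hr : ∀ l, g (Sum.inr l) = 0 := by
      intro l
      rw [← hpolx (fun i => g (Sum.inr i)) l]
      have h2 : ∑ i, g (Sum.inr i) • y i = -∑ i, g (Sum.inl i) • e (Sum.inl i) :=
        eq_neg_of_add_eq_zero_right hg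
      rw [h2, QuadraticMap.polar_neg_left, QuadraticMap.polar_comm, h11 (hx1 l) h0, neg_zero]
    simp only [hr, zero_smul, Finset.sum_const_zero, add_zero] at hg
    have hl := Fintype.linearIndependent_iff.mp hli (fun i => g (Sum.inl i)) hg
    rintro (i | i)
    · exact hl i
    · exact hr i
  have hetop : ⊤ ≤ Submodule.span k (Set.range e) := by
    intro v _
    have h1 : v - ∑ i, QuadraticMap.polar Q v (x i) • y i ∈ F.X 0 := by
      rw [F.X_eq_perp le_rfl, sub_zero, ← hspan1]
      have hsub : Submodule.span k (Set.range x) ≤ LinearMap.ker (Q.polarBilin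
          (v - ∑ i, QuadraticMap.polar Q v (x i) • y i)) := by
        rw [Submodule.span_le]
        rintro _ ⟨l, rfl⟩
        change QuadraticMap.polar Q _ _ = 0
        rw [QuadraticMap.polar_sub_left, hpolx (fun i => QuadraticMap.polar Q v (x i)), sub_self]
      intro u hu
      change QuadraticMap.polar Q u _ = 0
      rw [QuadraticMap.polar_comm]
      exact hsub hu
    have h2 := hX0 _ h1
    have h3 : Submodule.span k (Set.range (Sum.elim x c)) ≤ Submodule.span k (Set.range e) := by
      refine Submodule.span_mono ?_
      rintro _ ⟨i, rfl⟩
      exact ⟨Sum.inl i, rfl⟩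
    rw [← sub_add_cancel v (∑ i, QuadraticMap.polar Q v (x i) • y i)]
    refine Submodule.add_mem _ (h3 h2) (Submodule.sum_mem _ fun i _ => Submodule.smul_mem _ _ ?_)
    exact Submodule.subset_span ⟨Sum.inr i, rfl⟩
  let b := Module.Basis.mk heli hetop
  have hb : ∀ i, b i = e i := fun i => Module.Basis.mk_apply heli hetop i
  have hrepr : ∀ v i, b.repr v (Sum.inr i) = QuadraticMap.polar Q v (x i) := by
    intro v i
    have : b.coord (Sum.inr i) = Q.polarBilin.flip (x i) := by
      refine b.ext fun j => ?_
      rw [Module.Basis.coord_apply, b.repr_self, LinearMap.flip_apply,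
        QuadraticMap.polarBilin_apply_apply, hb]
      rcases j with (j | j) | j
      · rw [Finsupp.single_apply, if_neg (by simp)]
        exact (h11 (hx1 j) (h10 (hx1 i))).symm
      · rw [Finsupp.single_apply, if_neg (by simp)]
        change 0 = QuadraticMap.polar Q (c j) (x i)
        rw [QuadraticMap.polar_comm]
        exact (h11 (hx1 i) (hc0 j)).symm
      · rw [Finsupp.single_apply]
        change _ = QuadraticMap.polar Q (y j) (x i)
        rw [hyx]
        simp
    exact LinearMap.congr_fun this v
  refine ⟨n, Module.finrank k C, ⟨⟨b, Sum.elim (Sum.elim d fun _ => 0) fun i => -d i, ?_, ?_, ?_, ?_⟩⟩⟩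
  · rintro ((i | i) | i) <;> rw [hb]
    · exact hxd i
    · exact hc0 i
    · change y i ∈ F.X (-d i)
      have := hd i
      rw [F.X_eq_perp (by omega)]
      intro u hu
      have hsub : Submodule.span k (x '' {l | 1 - -d i ≤ d l}) ≤
          LinearMap.ker (Q.polarBilin (y i)) := by
        rw [Submodule.span_le]
        rintro _ ⟨l, hl, rfl⟩
        change QuadraticMap.polar Q _ _ = 0
        rw [hyx, if_neg]
        rintro rfl
        simp only [Set.mem_ofPred_eq] at hl
        omega
      change QuadraticMap.polar Q u (y i) = 0
      rw [QuadraticMap.polar_comm]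
      exact hsub (hspan _ (by omega) u hu)
  · intro a v hv
    rcases le_or_gt 1 a with ha | ha
    · have h1 : v ∈ Submodule.span k (b '' {j | a ≤ Sum.elim (Sum.elim d fun _ => 0)
          (fun i => -d i) j}) := by
        refine Submodule.span_mono ?_ (hspan a ha v hv)
        rintro _ ⟨i, hi, rfl⟩
        exact ⟨Sum.inl (Sum.inl i), hi, hb _⟩
      rw [Module.Basis.mem_span_image] at h1
      intro i hi
      by_contra hne
      have := h1 (Finsupp.mem_support_iff.mpr hne)
      simp only [Set.mem_ofPred_eq] at this
      omega
    · rintro ((i | i) | i) hi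
      · have := hd i
        simp only [Sum.elim_inl] at hi
        omega
      · simp only [Sum.elim_inl, Sum.elim_inr] at hi
        omega
      · simp only [Sum.elim_inr] at hi
        rw [hrepr]
        exact polar_eq_zero_of_one_le (by omega) hv (hxd i)
  · rintro ((i | i) | i) hi <;> rw [hb]
    · exact F.isotropic 1 le_rfl _ (hx1 i)
    · exact absurd rfl hi
    · exact hQy i
  · rintro ((i | i) | i) ((j | j) | j) hij <;> rw [hb, hb]
    · exact h11 (hx1 i) (h10 (hx1 j))
    · exact h11 (hx1 i) (hc0 j)
    · change QuadraticMap.polar Q (x i) (y j) = 0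
      rw [QuadraticMap.polar_comm, hyx, if_neg]
      rintro rfl
      simp at hij
    · change QuadraticMap.polar Q (c i) (x j) = 0
      rw [QuadraticMap.polar_comm]
      exact h11 (hx1 j) (hc0 i)
    · simp at hij
    · change QuadraticMap.polar Q (c i) (y j) = 0
      rw [QuadraticMap.polar_comm]
      exact hyc j i
    · change QuadraticMap.polar Q (y i) (x j) = 0
      rw [hyx, if_neg]
      rintro rfl
      simp at hij
    · exact hyc i j
    · exact hyy i j

end AdaptedBasis

/-! ### Extension of scalars and contraction to the identity -/

section BaseChange

/-- Two quadratic forms which agree, together with their bilinear forms, on a basis are equal. -/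
theorem quadraticForm_ext_basis {K : Type*} [Field K] {W : Type*} [AddCommGroup W] [Module K W]
    {I : Type*} (B : Module.Basis I K W) {q q' : QuadraticForm K W} (h : ∀ i, q (B i) = q' (B i))
    (hp : ∀ i j, QuadraticMap.polar q (B i) (B j) = QuadraticMap.polar q' (B i) (B j)) :
    q = q' := by
  have hpol : q.polarBilin = q'.polarBilin := B.ext fun i => B.ext fun j => hp i j
  have hpol' : ∀ x y, QuadraticMap.polar q x y = QuadraticMap.polar q' x y := fun x y =>
    LinearMap.congr_fun (LinearMap.congr_fun hpol x) y
  refine QuadraticMap.ext fun x => ?_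
  have hx : x ∈ Submodule.span K (Set.range B) := by rw [B.span_eq]; trivial
  induction hx using Submodule.span_induction with
  | mem x hx => obtain ⟨i, rfl⟩ := hx; exact h i
  | zero => simp
  | add x y _ _ hx hy => rw [QuadraticMap.map_add q, QuadraticMap.map_add q', hx, hy, hpol']
  | smul a x _ hx => rw [QuadraticMap.map_smul, QuadraticMap.map_smul, hx]

theorem polar_extend {k : Type*} [Field k] {K : Type*} [Field K] [Algebra k K]
    {V : Type*} [AddCommGroup V] [Module k V] {W : Type*} [AddCommGroup W] [Module K W] [Module k W]
    {Q : QuadraticForm k V} {ι : V →ₗ[k] W} {QK : QuadraticForm K W}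
    (hQK : ∀ v, QK (ι v) = algebraMap k K (Q v)) (x y : V) :
    QuadraticMap.polar QK (ι x) (ι y) = algebraMap k K (QuadraticMap.polar Q x y) := by
  simp only [QuadraticMap.polar, ← map_add, hQK, map_sub]

variable {k : Type*} [Field k] {K : Type*} [Field K] [Algebra k K]
  {V : Type*} [AddCommGroup V] [Module k V]
  {W : Type*} [AddCommGroup W] [Module K W] [Module k W] [IsScalarTower k K W]
  {Q : QuadraticForm k V} {ι : V →ₗ[k] W} {QK : QuadraticForm K W}

theorem endHom_mul (hι : IsBaseChange K ι) (f g : Module.End k V) :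
    hι.endHom (f * g) = (hι.endHom f : Module.End K W) * hι.endHom g := by
  refine hι.algHom_ext _ _ fun x => ?_
  rw [Module.End.mul_apply, IsBaseChange.endHom_comp_apply, IsBaseChange.endHom_comp_apply,
    IsBaseChange.endHom_comp_apply, Module.End.mul_apply]

theorem endHom_eq (hι : IsBaseChange K ι) {f : Module.End k V} {f' : Module.End K W}
    (h : ∀ v, f' (ι v) = ι (f v)) : f' = hι.endHom f := by
  refine hι.algHom_ext _ _ fun x => ?_
  rw [h, IsBaseChange.endHom_comp_apply]

theorem endHom_mem_orthGroup (hι : IsBaseChange K ι)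
    (hQK : ∀ v, QK (ι v) = algebraMap k K (Q v)) {g : Module.End k V} (hg : g ∈ orthGroup Q) :
    (hι.endHom g : Module.End K W) ∈ orthGroup QK := by
  constructor
  · obtain ⟨h, -, h1, h2⟩ := exists_inv_orthGroup hg
    refine ⟨⟨hι.endHom g, hι.endHom h, ?_, ?_⟩, rfl⟩
    · rw [← endHom_mul, h2, IsBaseChange.endHom_one]
    · rw [← endHom_mul, h1, IsBaseChange.endHom_one]
  · have h : QK.comp (hι.endHom g) = QK := by
      let b := Module.Basis.ofVectorSpace k V
      refine quadraticForm_ext_basis (hι.basis b) (fun i => ?_) fun i j => ?_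
      · rw [QuadraticMap.comp_apply, IsBaseChange.basis_apply, IsBaseChange.endHom_comp_apply,
          hQK, hQK, hg.2]
      · rw [IsBaseChange.basis_apply, IsBaseChange.basis_apply]
        have : QuadraticMap.polar (QK.comp (hι.endHom g)) (ι (b i)) (ι (b j)) =
            QuadraticMap.polar QK (ι (g (b i))) (ι (g (b j))) := by
          simp only [QuadraticMap.polar, QuadraticMap.comp_apply, ← map_add,
            IsBaseChange.endHom_comp_apply]
        rw [this, polar_extend hQK, polar_extend hQK, polar_isometry hg.2]
    exact fun x => by rw [← QuadraticMap.comp_apply, h]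

end BaseChange

section Contraction

variable {k : Type u} [Field k] {K : Type*} [Field K] [Algebra k K]
  {V : Type v} [AddCommGroup V] [Module k V]
  {W : Type*} [AddCommGroup W] [Module K W] [Module k W] [IsScalarTower k K W]
  {Q : QuadraticForm k V} {ι : V →ₗ[k] W} {QK : QuadraticForm K W} {F : QFiltration Q}

/-- The scalings `t ^ a` on the span of the basis vectors of degree `a`, as endomorphisms. -/
def basisScaling {I : Type*} (B : Module.Basis I K W) (deg : I → ℤ) (t : K) : Module.End K W :=
  B.constr K fun i => t ^ deg i • B i

theorem basisScaling_apply {I : Type*} (B : Module.Basis I K W) (deg : I → ℤ) (t : K) (i : I) :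
    basisScaling B deg t (B i) = t ^ deg i • B i := B.constr_basis K _ i

theorem basisScaling_mul {I : Type*} (B : Module.Basis I K W) (deg : I → ℤ) {t : K} (ht : t ≠ 0) :
    basisScaling B deg t * basisScaling B deg t⁻¹ = 1 := by
  refine B.ext fun i => ?_
  rw [Module.End.mul_apply, basisScaling_apply, map_smul, basisScaling_apply, smul_smul,
    inv_zpow, inv_mul_cancel₀ (zpow_ne_zero _ ht), one_smul, Module.End.one_apply]

theorem basisScaling_mem_orthGroup {I : Type*} (A : AdaptedBasis F I) (hι : IsBaseChange K ι)
    (hQK : ∀ v, QK (ι v) = algebraMap k K (Q v)) {t : K} (ht : t ≠ 0) :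
    basisScaling (hι.basis A.b) A.deg t ∈ orthGroup QK := by
  constructor
  · refine ⟨⟨_, basisScaling (hι.basis A.b) A.deg t⁻¹, basisScaling_mul _ _ ht, ?_⟩, rfl⟩
    have h := basisScaling_mul (hι.basis A.b) A.deg (inv_ne_zero ht)
    rwa [inv_inv] at h
  · have h : QK.comp (basisScaling (hι.basis A.b) A.deg t) = QK := by
      refine quadraticForm_ext_basis (hι.basis A.b) (fun i => ?_) fun i j => ?_
      · rw [QuadraticMap.comp_apply, basisScaling_apply, QuadraticMap.map_smul]
        by_cases hi : A.deg i = 0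
        · simp [hi]
        · rw [IsBaseChange.basis_apply, hQK, A.form_eq_zero i hi]; simp
      · have : QuadraticMap.polar (QK.comp (basisScaling (hι.basis A.b) A.deg t))
            (hι.basis A.b i) (hι.basis A.b j) = t ^ A.deg i * (t ^ A.deg j *
              QuadraticMap.polar QK (hι.basis A.b i) (hι.basis A.b j)) := by
          rw [← smul_eq_mul, ← smul_eq_mul, ← QuadraticMap.polar_smul_right,
            ← QuadraticMap.polar_smul_left, ← basisScaling_apply, ← basisScaling_apply]
          simp only [QuadraticMap.polar, QuadraticMap.comp_apply, map_add]
        rw [this, ← mul_assoc, ← zpow_add₀ ht]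
        by_cases hij : A.deg i + A.deg j = 0
        · rw [hij]; simp
        · rw [IsBaseChange.basis_apply, IsBaseChange.basis_apply, polar_extend hQK,
            A.polar_eq_zero i j hij]
          simp
    exact fun x => by rw [← QuadraticMap.comp_apply, h]

/-- Let `g` preserve the filtration. For `t ≠ 0` this is the conjugate by the scaling with parameter
`t` of the extension of `g`; for `t = 0` it is the part of `g` of degree zero. The truncation of a
negative exponent to `0` is harmless, since the coefficient of that term vanishes. -/
def contractionCurve {I : Type*} [Fintype I] (A : AdaptedBasis F I) (hι : IsBaseChange K ι)
    (g : Module.End k V) (t : K) : Module.End K W :=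
  ∑ i, ∑ j, t ^ (A.deg i - A.deg j).toNat • (algebraMap k K (A.b.repr (g (A.b j)) i)) •
    ((hι.basis A.b).coord j).smulRight (hι.basis A.b i)

theorem contractionCurve_apply {I : Type*} [Fintype I] (A : AdaptedBasis F I)
    (hι : IsBaseChange K ι) (g : Module.End k V) (t : K) (j : I) :
    contractionCurve A hι g t (hι.basis A.b j) =
      ∑ i, t ^ (A.deg i - A.deg j).toNat • (algebraMap k K (A.b.repr (g (A.b j)) i)) •
        hι.basis A.b i := by
  classical
  simp only [contractionCurve, LinearMap.sum_apply, LinearMap.smul_apply,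
    LinearMap.smulRight_apply, Module.Basis.coord_apply, Module.Basis.repr_self]
  refine Finset.sum_congr rfl fun i _ => ?_
  rw [Finset.sum_eq_single j]
  · simp
  · intro l _ hl
    rw [Finsupp.single_apply, if_neg hl.symm]; simp
  · simp

theorem repr_of_deg_le {I : Type*} [DecidableEq I] (A : AdaptedBasis F I) {g : Module.End k V}
    (hgF : ∀ a, ∀ x ∈ F.X a, g x - x ∈ F.X (a + 1)) {i j : I} (h : A.deg i ≤ A.deg j) :
    A.b.repr (g (A.b j)) i = if j = i then 1 else 0 := by
  have h1 := A.repr_eq_zero _ _ (hgF _ _ (A.mem j)) i (by omega)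
  rw [map_sub, Finsupp.sub_apply, sub_eq_zero, A.b.repr_self, Finsupp.single_apply] at h1
  exact h1

/-- An isometry which acts trivially on the graded space of a `Q`-filtration is contracted to the
identity by the one-parameter group of an adapted basis, so its extension of scalars lies in
the identity component. -/
theorem endHom_mem_identityComponent [FiniteDimensional k V] [Infinite K] (hQ : IsNondeg Q)
    (hι : IsBaseChange K ι) (hQK : ∀ v, QK (ι v) = algebraMap k K (Q v)) {g : Module.End k V}
    (hg : g ∈ orthGroup Q) (hgF : ∀ a, ∀ x ∈ F.X a, g x - x ∈ F.X (a + 1)) :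
    (hι.endHom g : Module.End K W) ∈ identityComponent QK := by
  classical
  obtain ⟨n, r, ⟨A⟩⟩ := exists_adaptedBasis hQ F
  let c := contractionCurve A hι g
  have hc0 : c 0 = 1 := by
    refine (hι.basis A.b).ext fun j => ?_
    rw [contractionCurve_apply, Finset.sum_eq_single j]
    · rw [repr_of_deg_le A hgF le_rfl]; simp
    · intro i _ hij
      rcases le_or_gt (A.deg i) (A.deg j) with h | h
      · rw [repr_of_deg_le A hgF h, if_neg hij.symm]; simp
      · rw [zero_pow (by omega), zero_smul]
    · simp
  have hc1 : c 1 = hι.endHom g := by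
    refine (hι.basis A.b).ext fun j => ?_
    rw [contractionCurve_apply, IsBaseChange.basis_apply, IsBaseChange.endHom_comp_apply]
    conv_rhs => rw [← A.b.sum_repr (g (A.b j)), map_sum]
    refine Finset.sum_congr rfl fun i _ => ?_
    rw [one_pow, one_smul, IsBaseChange.basis_apply, map_smul, algebraMap_smul]
  have hconj : ∀ t ≠ 0, c t = basisScaling (hι.basis A.b) A.deg t * hι.endHom g *
      basisScaling (hι.basis A.b) A.deg t⁻¹ := by
    intro t ht
    refine (hι.basis A.b).ext fun j => ?_
    rw [contractionCurve_apply, Module.End.mul_apply, Module.End.mul_apply, basisScaling_apply,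
      map_smul, map_smul, ← hc1, contractionCurve_apply, map_sum, Finset.smul_sum]
    refine Finset.sum_congr rfl fun i _ => ?_
    rw [one_pow, one_smul, map_smul, basisScaling_apply, smul_comm (algebraMap k K _), inv_zpow,
      ← zpow_neg, smul_smul (t ^ (-A.deg j)), ← zpow_add₀ ht]
    rcases lt_or_ge (A.deg i) (A.deg j) with h | h
    · rw [repr_of_deg_le A hgF h.le, if_neg (by rintro rfl; exact lt_irrefl _ h)]; simp
    · rw [← zpow_natCast, Int.toNat_of_nonneg (by omega)]
      congr 2
      ring
  have hO : ∀ t, c t ∈ orthGroup QK := by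
    intro t
    by_cases ht : t = 0
    · rw [ht, hc0]; exact one_mem_orthGroup
    · rw [hconj t ht]
      exact mul_mem_orthGroup (mul_mem_orthGroup (basisScaling_mem_orthGroup A hι hQK ht)
        (endHom_mem_orthGroup hι hQK hg)) (basisScaling_mem_orthGroup A hι hQK (inv_ne_zero ht))
  let _ := zariski K (Module.End K W)
  have hpre : IsPreconnected (Set.range c) := by
    refine isPreconnected_range_curve c fun l => ?_
    refine ⟨∑ i, ∑ j, Polynomial.C (l ((algebraMap k K (A.b.repr (g (A.b j)) i)) •
      ((hι.basis A.b).coord j).smulRight (hι.basis A.b i))) *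
      Polynomial.X ^ (A.deg i - A.deg j).toNat, fun t => ?_⟩
    simp only [c, contractionCurve, map_sum, map_smul, Polynomial.eval_finsetSum,
      Polynomial.eval_mul, Polynomial.eval_C, Polynomial.eval_pow, Polynomial.eval_X, smul_eq_mul]
    refine Finset.sum_congr rfl fun i _ => Finset.sum_congr rfl fun j _ => ?_
    ring
  rw [← hc1]
  exact hpre.subset_connectedComponentIn ⟨0, hc0⟩ (by rintro _ ⟨t, rfl⟩; exact hO t) ⟨1, rfl⟩

end Contraction

/-! ### The Dickson invariant in characteristic two -/

section MatrixIdentities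

variable {R : Type*} [CommRing R] {n : ℕ}

/-- The sum of the principal minors of size two of a matrix, that is, the second elementary symmetric
function of its eigenvalues. -/
def secondMinorSum (M : Matrix (Fin n) (Fin n) R) : R :=
  ∑ i, ∑ j, if i < j then M i i * M j j - M i j * M j i else 0

theorem sum_eq_sum_lt (f : Fin n → Fin n → R) (hd : ∀ i, f i i = 0) :
    ∑ i, ∑ j, f i j = ∑ i, ∑ j, if i < j then f i j + f j i else 0 := by
  have h1 : ∑ i, ∑ j, f i j =
      ∑ i, ∑ j, ((if i < j then f i j else 0) + if j < i then f i j else 0) := by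
    refine Finset.sum_congr rfl fun i _ => Finset.sum_congr rfl fun j _ => ?_
    rcases lt_trichotomy i j with h | rfl | h
    · rw [if_pos h, if_neg (not_lt_of_gt h), add_zero]
    · simp [hd]
    · rw [if_pos h, if_neg (not_lt_of_gt h), zero_add]
  have h2 : ∑ i, ∑ j, (if j < i then f i j else 0) = ∑ i, ∑ j, if i < j then f j i else 0 :=
    Finset.sum_comm
  rw [h1]
  simp only [Finset.sum_add_distrib]
  rw [h2]
  simp only [← Finset.sum_add_distrib]
  refine Finset.sum_congr rfl fun i _ => Finset.sum_congr rfl fun j _ => ?_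
  split_ifs <;> simp

theorem sum_eq_zero_of_symm (h2 : (2 : R) = 0) (f : Fin n → Fin n → R) (hd : ∀ i, f i i = 0)
    (hs : ∀ i j, f i j = f j i) : ∑ i, ∑ j, f i j = 0 := by
  rw [sum_eq_sum_lt f hd]
  refine Finset.sum_eq_zero fun i _ => Finset.sum_eq_zero fun j _ => ?_
  split_ifs
  · rw [hs i j]
    linear_combination f j i * h2
  · rfl

theorem secondMinorSum_add (X Y : Matrix (Fin n) (Fin n) R) :
    secondMinorSum (X + Y) = secondMinorSum X + secondMinorSum Y +
      (X.trace * Y.trace - (X * Y).trace) := by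
  have h : X.trace * Y.trace - (X * Y).trace =
      ∑ i, ∑ j, (X i i * Y j j - X i j * Y j i) := by
    simp only [Matrix.trace, Matrix.diag, Matrix.mul_apply, Finset.sum_mul_sum,
      Finset.sum_sub_distrib]
  rw [h, sum_eq_sum_lt _ fun i => sub_self _]
  simp only [secondMinorSum, ← Finset.sum_add_distrib]
  refine Finset.sum_congr rfl fun i _ => Finset.sum_congr rfl fun j _ => ?_
  split_ifs
  · simp only [Matrix.add_apply]; ring
  · simp

theorem secondMinorSum_transpose (X : Matrix (Fin n) (Fin n) R) :
    secondMinorSum X.transpose = secondMinorSum X := by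
  simp only [secondMinorSum, Matrix.transpose_apply]
  refine Finset.sum_congr rfl fun i _ => Finset.sum_congr rfl fun j _ => ?_
  rw [mul_comm (X j i)]

/-- The Cauchy–Binet formula for minors of size two. -/
theorem secondMinorSum_mul (X Y : Matrix (Fin n) (Fin n) R) :
    secondMinorSum (X * Y) = ∑ i, ∑ j, if i < j then
      ∑ p, ∑ q, (if p < q then (X i p * X j q - X i q * X j p) * (Y p i * Y q j - Y p j * Y q i)
        else 0) else 0 := by
  refine Finset.sum_congr rfl fun i _ => Finset.sum_congr rfl fun j _ => ?_
  split_ifs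
  · have h : (X * Y) i i * (X * Y) j j - (X * Y) i j * (X * Y) j i =
        ∑ p, ∑ q, X i p * X j q * (Y p i * Y q j - Y p j * Y q i) := by
      simp only [Matrix.mul_apply, Finset.sum_mul_sum, ← Finset.sum_sub_distrib]
      refine Finset.sum_congr rfl fun p _ => Finset.sum_congr rfl fun q _ => ?_
      ring
    rw [h, sum_eq_sum_lt _ fun p => by ring]
    refine Finset.sum_congr rfl fun p _ => Finset.sum_congr rfl fun q _ => ?_
    split_ifs
    · ring
    · rfl
  · rfl

theorem secondMinorSum_mul_comm (X Y : Matrix (Fin n) (Fin n) R) :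
    secondMinorSum (X * Y) = secondMinorSum (Y * X) := by
  have h : ∀ X Y : Matrix (Fin n) (Fin n) R, secondMinorSum (X * Y) =
      ∑ i, ∑ j, ∑ p, ∑ q, if i < j then (if p < q then (X i p * X j q - X i q * X j p) *
        (Y p i * Y q j - Y p j * Y q i) else 0) else 0 := by
    intro X Y
    rw [secondMinorSum_mul]
    refine Finset.sum_congr rfl fun i _ => Finset.sum_congr rfl fun j _ => ?_
    split_ifs
    · rfl
    · simp
  rw [h, h]
  simp only [← Fintype.sum_prod_type']
  have e : ∀ f : (Fin n × Fin n × Fin n × Fin n) → R,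
      ∑ x, f x = ∑ x : Fin n × Fin n × Fin n × Fin n, f (x.2.2.1, x.2.2.2, x.1, x.2.1) := by
    intro f
    refine (Fintype.sum_equiv ⟨fun x => (x.2.2.1, x.2.2.2, x.1, x.2.1),
      fun x => (x.2.2.1, x.2.2.2, x.1, x.2.1), fun _ => rfl, fun _ => rfl⟩ _ _ fun x => ?_)
    rfl
  rw [e]
  refine Finset.sum_congr rfl fun x _ => ?_
  by_cases h1 : x.1 < x.2.1 <;> by_cases h2 : x.2.2.1 < x.2.2.2 <;> simp [h1, h2]
  ring

theorem trace_mul_eq_zero (h2 : (2 : R) = 0) {T C : Matrix (Fin n) (Fin n) R}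
    (hT : T.transpose = T) (hT0 : ∀ i, T i i = 0) (hC : C.transpose = C) : (T * C).trace = 0 := by
  simp only [Matrix.trace, Matrix.diag, Matrix.mul_apply]
  refine sum_eq_zero_of_symm h2 _ (fun i => by rw [hT0, zero_mul]) fun i j => ?_
  have h3 := congrFun (congrFun hT i) j
  have h4 := congrFun (congrFun hC i) j
  rw [Matrix.transpose_apply] at h3 h4
  rw [h3, h4]

theorem conj_diag_eq_zero (h2 : (2 : R) = 0) {T : Matrix (Fin n) (Fin n) R}
    (hT : T.transpose = T) (hT0 : ∀ i, T i i = 0) (x : Fin n → R) :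
    ∑ i, ∑ j, x i * T i j * x j = 0 := by
  refine sum_eq_zero_of_symm h2 _ (fun i => by rw [hT0]; ring) fun i j => ?_
  have h3 := congrFun (congrFun hT i) j
  rw [Matrix.transpose_apply] at h3
  rw [h3]; ring

/-- The identity behind the Dickson invariant. Let `S = A + Aᵀ` be alternating with inverse `T` and let
`G` be a matrix with `Gᵀ S G = S` and `Gᵀ A G = A + U + Uᵀ`. The matrices `T (A + U + Uᵀ)` and `T A` are
conjugate, and the comparison of their second elementary symmetric functions shows
that the trace of `T U` is idempotent. -/
theorem trace_sq_eq (h2 : (2 : R) = 0) {S T A U G : Matrix (Fin n) (Fin n) R}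
    (hT : T.transpose = T) (hT0 : ∀ i, T i i = 0) (hST : S * T = 1) (hA : A + A.transpose = S)
    (hG : G.transpose * S * G = S) (hGA : G.transpose * A * G = A + (U + U.transpose)) :
    (T * U).trace ^ 2 = (T * U).trace := by
  have hTS : T * S = 1 := mul_eq_one_comm.mp hST
  have hGT : G * T * G.transpose = T := by
    have h1 : (T * G.transpose * S) * G = 1 := by
      rw [Matrix.mul_assoc T, Matrix.mul_assoc T, hG, hTS]
    have h3 : G * (T * G.transpose * S) = 1 := mul_eq_one_comm.mp h1
    calc G * T * G.transpose = G * (T * G.transpose * S) * T := by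
          simp only [Matrix.mul_assoc, hST, Matrix.mul_one]
      _ = T := by rw [h3, Matrix.one_mul]
  have hconj : secondMinorSum (T * (A + (U + U.transpose))) = secondMinorSum (T * A) := by
    rw [← hGA, show T * (G.transpose * A * G) = (T * G.transpose * A) * G by
      simp only [Matrix.mul_assoc], secondMinorSum_mul_comm,
      show G * (T * G.transpose * A) = G * T * G.transpose * A by simp only [Matrix.mul_assoc], hGT]
  have hE : (T * (U + U.transpose)).trace = 0 := trace_mul_eq_zero h2 hT hT0 (by
    rw [Matrix.transpose_add, Matrix.transpose_transpose, add_comm])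
  have htr : (T * U.transpose).trace = (T * U).trace := by
    rw [← Matrix.trace_transpose, Matrix.transpose_mul, Matrix.transpose_transpose, hT,
      Matrix.trace_mul_comm]
  have hmin : secondMinorSum (T * U.transpose) = secondMinorSum (T * U) := by
    rw [← secondMinorSum_transpose, Matrix.transpose_mul, Matrix.transpose_transpose, hT,
      secondMinorSum_mul_comm]
  have hsymm : (T * U * (T * U.transpose)).trace = 0 := by
    rw [show T * U * (T * U.transpose) = T * (U * T * U.transpose) by simp only [Matrix.mul_assoc]]
    refine trace_mul_eq_zero h2 hT hT0 ?_
    rw [Matrix.transpose_mul, Matrix.transpose_mul, Matrix.transpose_transpose, hT,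
      Matrix.mul_assoc]
  have h3 : (T * A * (T * (U + U.transpose))).trace = (T * U).trace := by
    have h4 : (T * A * (T * U.transpose)).trace = (T * A.transpose * (T * U)).trace := by
      rw [← Matrix.trace_transpose]
      simp only [Matrix.transpose_mul, Matrix.transpose_transpose, hT]
      rw [Matrix.mul_assoc U, Matrix.trace_mul_comm]
      simp only [Matrix.mul_assoc]
    rw [Matrix.mul_add, Matrix.mul_add, Matrix.trace_add, h4, ← Matrix.trace_add, ← Matrix.add_mul,
      ← Matrix.mul_add, hA, hTS, Matrix.one_mul]
  rw [Matrix.mul_add, secondMinorSum_add, hE, h3, Matrix.mul_add, secondMinorSum_add, htr, hmin,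
    hsymm] at hconj
  linear_combination hconj - secondMinorSum (T * U) * h2

end MatrixIdentities

section Dickson

variable {K : Type*} [Field K] {W : Type*} [AddCommGroup W] [Module K W] {n : ℕ}

/-- The strictly upper triangular part of the matrix of `(x, y) ↦ β (g x) (g y) - β x y`. -/
def upperDefect (b : Module.Basis (Fin n) K W) (β : LinearMap.BilinForm K W) (g : Module.End K W) :
    Matrix (Fin n) (Fin n) K :=
  Matrix.of fun i j => if i < j then β (g (b i)) (g (b j)) - β (b i) (b j) else 0

/-- The Dickson invariant of `g` with respect to a basis. Here `q x = β x x`, and `T` is the inverse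
of the matrix of the bilinear form of `q`. -/
def dickson (b : Module.Basis (Fin n) K W) (β : LinearMap.BilinForm K W)
    (T : Matrix (Fin n) (Fin n) K) (g : Module.End K W) : K :=
  (T * upperDefect b β g).trace

theorem dickson_mem_polyFun (b : Module.Basis (Fin n) K W) (β : LinearMap.BilinForm K W)
    (T : Matrix (Fin n) (Fin n) K) : dickson b β T ∈ polyFun K (Module.End K W) := by
  have hcoord : ∀ i p, (fun g : Module.End K W => b.repr (g (b i)) p) ∈
      polyFun K (Module.End K W) := fun i p =>
    linear_mem_polyFun (b.coord p ∘ₗ LinearMap.applyₗ (b i))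
  have hβ : ∀ i j, (fun g : Module.End K W => β (g (b i)) (g (b j))) ∈
      polyFun K (Module.End K W) := by
    intro i j
    have : (fun g : Module.End K W => β (g (b i)) (g (b j))) =
        ∑ p, ∑ r, β (b p) (b r) • ((fun g : Module.End K W => b.repr (g (b i)) p) *
          fun g => b.repr (g (b j)) r) := by
      funext g
      conv_lhs => rw [← b.sum_repr (g (b i)), ← b.sum_repr (g (b j))]
      simp only [map_sum, map_smul, LinearMap.sum_apply, LinearMap.smul_apply, Finset.sum_apply,
        Pi.smul_apply, Pi.mul_apply, smul_eq_mul, Finset.mul_sum]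
      rw [Finset.sum_comm]
      refine Finset.sum_congr rfl fun p _ => Finset.sum_congr rfl fun r _ => ?_
      ring
    rw [this]
    exact Subalgebra.sum_mem _ fun p _ => Subalgebra.sum_mem _ fun r _ =>
      Subalgebra.smul_mem _ (Subalgebra.mul_mem _ (hcoord i p) (hcoord j r)) _
  have : dickson b β T = ∑ i, ∑ j, T i j • (if j < i then
      (fun g : Module.End K W => β (g (b j)) (g (b i))) -
        algebraMap K (Module.End K W → K) (β (b j) (b i)) else 0) := by
    funext g
    simp only [dickson, Matrix.trace, Matrix.diag, Matrix.mul_apply, Finset.sum_apply,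
      Pi.smul_apply, smul_eq_mul, upperDefect, Matrix.of_apply]
    refine Finset.sum_congr rfl fun i _ => Finset.sum_congr rfl fun j _ => ?_
    split_ifs <;> rfl
  rw [this]
  refine Subalgebra.sum_mem _ fun i _ => Subalgebra.sum_mem _ fun j _ =>
    Subalgebra.smul_mem _ ?_ _
  split_ifs
  · exact Subalgebra.sub_mem _ (hβ j i) (Subalgebra.algebraMap_mem _ _)
  · exact Subalgebra.zero_mem _

/-- In characteristic two and for a nondegenerate bilinear form, a reflection is not in the
identity component of the orthogonal group: its Dickson invariant is `1`. -/
theorem reflection_notMem_identityComponent (h2 : (2 : K) = 0) (b : Module.Basis (Fin n) K W)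
    (q : QuadraticForm K W) {T : Matrix (Fin n) (Fin n) K}
    (hT : Matrix.of (fun i j => QuadraticMap.polar q (b i) (b j)) * T = 1) {w : W} (hw : q w = 1)
    {g : Module.End K W} (hg : ∀ x, g x = x + QuadraticMap.polar q w x • w) :
    g ∉ identityComponent q := by
  intro hgmem
  have : Module.Free K W := Module.Free.of_basis b
  obtain ⟨β, hβ⟩ := LinearMap.BilinMap.toQuadraticMap_surjective q
  have hqβ : ∀ x, q x = β x x := fun x => by rw [← hβ]; rfl
  have hpol : ∀ x y, QuadraticMap.polar q x y = β x y + β y x := fun x y => by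
    simp only [QuadraticMap.polar, hqβ, map_add, LinearMap.add_apply]; ring
  set S : Matrix (Fin n) (Fin n) K := Matrix.of (fun i j => QuadraticMap.polar q (b i) (b j)) with hS
  have hTS : T * S = 1 := mul_eq_one_comm.mp hT
  have hSsymm : S.transpose = S := by
    ext i j
    rw [Matrix.transpose_apply, hS, Matrix.of_apply, Matrix.of_apply, QuadraticMap.polar_comm]
  have hS0 : ∀ i, S i i = 0 := fun i => by
    rw [hS, Matrix.of_apply, hpol]
    linear_combination β (b i) (b i) * h2
  have hTsymm : T.transpose = T := by
    have h3 : T.transpose * S = 1 := by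
      rw [← hSsymm, ← Matrix.transpose_mul, hT, Matrix.transpose_one]
    calc T.transpose = T.transpose * (S * T) := by rw [hT, Matrix.mul_one]
      _ = T := by rw [← Matrix.mul_assoc, h3, Matrix.one_mul]
  have hT0 : ∀ i, T i i = 0 := fun i => by
    have h3 : T = T.transpose * S * T := by rw [hTsymm, hTS, Matrix.one_mul]
    rw [h3]
    simp only [Matrix.mul_apply, Matrix.transpose_apply, Finset.sum_mul]
    rw [Finset.sum_comm]
    exact conj_diag_eq_zero h2 hSsymm hS0 fun p => T p i
  let A : Matrix (Fin n) (Fin n) K := LinearMap.BilinForm.toMatrix b β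
  have hAij : ∀ i j, A i j = β (b i) (b j) := fun i j => LinearMap.BilinForm.toMatrix_apply b β i j
  have hAS : A + A.transpose = S := by
    ext i j
    rw [Matrix.add_apply, Matrix.transpose_apply, hAij, hAij, hS, Matrix.of_apply, hpol]
  -- for an isometry the strictly upper triangular part determines the matrix `Gᵀ A G - A`
  have hdefect : ∀ f ∈ orthGroup q, ∀ i j, β (f (b i)) (f (b j)) - β (b i) (b j) =
      upperDefect b β f i j + upperDefect b β f j i := by
    intro f hf i j
    have h3 := polar_isometry hf.2 (b i) (b j)
    have h4 := hf.2 (b i)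
    rw [hpol, hpol] at h3
    rw [hqβ, hqβ] at h4
    simp only [upperDefect, Matrix.of_apply]
    rcases lt_trichotomy i j with h | rfl | h
    · rw [if_pos h, if_neg (not_lt_of_gt h), add_zero]
    · rw [if_neg (lt_irrefl _), h4]; simp
    · rw [if_pos h, if_neg (not_lt_of_gt h), zero_add]
      linear_combination h3 + (β (b j) (b i) - β (f (b j)) (f (b i))) * h2
  have h01 : ∀ f ∈ orthGroup q, dickson b β T f = 0 ∨ dickson b β T f = 1 := by
    intro f hf
    have hsq : dickson b β T f ^ 2 = dickson b β T f := by
      refine trace_sq_eq h2 (S := S) (A := A) (G := LinearMap.toMatrix b b f) hTsymm hT0 hT hAS ?_ ?_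
      · have h3 : S = LinearMap.BilinForm.toMatrix b q.polarBilin := by
          ext i j
          rw [LinearMap.BilinForm.toMatrix_apply]; rfl
        rw [h3, ← LinearMap.BilinForm.toMatrix_comp b b]
        congr 1
        exact LinearMap.ext fun x => LinearMap.ext fun y => polar_isometry hf.2 x y
      · rw [← LinearMap.BilinForm.toMatrix_comp b b]
        ext i j
        rw [LinearMap.BilinForm.toMatrix_apply, Matrix.add_apply, Matrix.add_apply,
          Matrix.transpose_apply, ← hdefect f hf, hAij, LinearMap.BilinForm.comp_apply]
        ring
    have h3 : dickson b β T f * (dickson b β T f - 1) = 0 := by linear_combination hsq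
    rcases mul_eq_zero.mp h3 with h | h
    · exact Or.inl h
    · exact Or.inr (sub_eq_zero.mp h)
  have hone : dickson b β T 1 = 0 := by
    have : upperDefect b β 1 = 0 := by
      ext i j
      simp [upperDefect]
    rw [dickson, this, Matrix.mul_zero, Matrix.trace_zero]
  have hgd := eq_zero_of_mem_identityComponent (dickson_mem_polyFun b β T) h01 hone hgmem
  -- the invariant of the reflection, from `Gᵀ A G - A = p rᵀ + r pᵀ`
  let p : Fin n → K := fun i => β (b i) w
  let r : Fin n → K := fun i => β w (b i)
  have hww : β w w = 1 := by rw [← hqβ, hw]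
  have hE : ∀ i j, β (g (b i)) (g (b j)) - β (b i) (b j) = p i * r j + r i * p j := by
    intro i j
    simp only [hg, hpol, map_add, map_smul, LinearMap.add_apply, LinearMap.smul_apply, smul_eq_mul,
      hww, p, r]
    linear_combination (β (b i) w * β (b j) w + β (b i) w * β w (b j) +
      β w (b i) * β w (b j)) * h2
  have hsym : (upperDefect b β g - Matrix.of fun i j => p i * r j).transpose =
      upperDefect b β g - Matrix.of fun i j => p i * r j := by
    ext i j
    have h3 := hdefect g (identityComponent_subset hgmem) i j
    have h4 := hE i j
    simp only [Matrix.transpose_apply, Matrix.sub_apply, Matrix.of_apply]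
    linear_combination h4 - h3 + (p i * r j - upperDefect b β g i j) * h2
  have htr := trace_mul_eq_zero h2 hTsymm hT0 hsym
  rw [Matrix.mul_sub, Matrix.trace_sub] at htr
  have hval : (T * Matrix.of fun i j => p i * r j).trace = ∑ i, r i * ∑ j, T i j * p j := by
    simp only [Matrix.trace, Matrix.diag, Matrix.mul_apply, Matrix.of_apply, Finset.mul_sum]
    refine Finset.sum_congr rfl fun i _ => Finset.sum_congr rfl fun j _ => ?_
    ring
  have hSw : S.mulVec (fun i => b.repr w i) = p + r := by
    funext i
    have h3 : QuadraticMap.polar q (b i) w = q.polarBilin (b i) (∑ j, b.repr w j • b j) := by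
      rw [b.sum_repr]; rfl
    have h4 : (p + r) i = QuadraticMap.polar q (b i) w := by rw [hpol]; rfl
    rw [h4, h3, map_sum]
    simp only [Matrix.mulVec, dotProduct, hS, Matrix.of_apply, map_smul, smul_eq_mul,
      QuadraticMap.polarBilin_apply_apply]
    exact Finset.sum_congr rfl fun j _ => mul_comm _ _
  have hTpr : T.mulVec (p + r) = fun i => b.repr w i := by
    rw [← hSw, Matrix.mulVec_mulVec, hTS, Matrix.one_mulVec]
  have hTp : ∀ i, ∑ j, T i j * p j = b.repr w i - ∑ j, T i j * r j := by
    intro i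
    have h3 := congrFun hTpr i
    simp only [Matrix.mulVec, dotProduct, Pi.add_apply, mul_add, Finset.sum_add_distrib] at h3
    linear_combination h3
  have hrw : ∑ i, r i * b.repr w i = 1 := by
    rw [← hww]
    conv_rhs => rw [← b.sum_repr w]
    conv_rhs => rw [map_sum]
    refine Finset.sum_congr rfl fun i _ => ?_
    rw [map_smul, smul_eq_mul, mul_comm, b.sum_repr]
  have hrr : ∑ i, r i * ∑ j, T i j * r j = 0 := by
    rw [← conj_diag_eq_zero h2 hTsymm hT0 r]
    simp only [Finset.mul_sum]
    refine Finset.sum_congr rfl fun i _ => Finset.sum_congr rfl fun j _ => ?_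
    ring
  have hone' : (T * Matrix.of fun i j => p i * r j).trace = 1 := by
    rw [hval]
    simp only [hTp, mul_sub, Finset.sum_sub_distrib]
    rw [hrw, hrr, sub_zero]
  rw [hone'] at htr
  change dickson b β T g - 1 = 0 at htr
  rw [hgd] at htr
  simp at htr

end Dickson

/-! ### Unipotent elements of the special orthogonal group -/

section Types

variable {k : Type u} [Field k] {K : Type*} [Field K] {V : Type v} [AddCommGroup V] [Module k V]
  {W : Type*} [AddCommGroup W] [Module K W] [Module k W]
  {Q : QuadraticForm k V} {ι : V →ₗ[k] W} {QK : QuadraticForm K W} {F : QFiltration Q}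

theorem span_image_isotropic [Algebra k K] (hQK : ∀ v, QK (ι v) = algebraMap k K (Q v))
    {U : Submodule k V} (hU : ∀ x ∈ U, Q x = 0) :
    ∀ x ∈ Submodule.span K (ι '' (U : Set V)), QK x = 0 := by
  have h1 : ∀ x ∈ U, Submodule.span K (ι '' (U : Set V)) ≤ LinearMap.ker (QK.polarBilin (ι x)) := by
    intro x hx
    rw [Submodule.span_le]
    rintro _ ⟨y, hy, rfl⟩
    change QuadraticMap.polar QK (ι x) (ι y) = 0
    rw [polar_extend hQK, polar_eq_zero_of_isotropic hU hx hy, map_zero]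
  have h2 : ∀ y ∈ Submodule.span K (ι '' (U : Set V)),
      Submodule.span K (ι '' (U : Set V)) ≤ LinearMap.ker (QK.polarBilin y) := by
    intro y hy
    rw [Submodule.span_le]
    rintro _ ⟨x, hx, rfl⟩
    change QuadraticMap.polar QK y (ι x) = 0
    rw [QuadraticMap.polar_comm]
    exact h1 x hx hy
  intro x hx
  induction hx using Submodule.span_induction with
  | mem x hx =>
    obtain ⟨y, hy, rfl⟩ := hx
    rw [hQK, hU y hy, map_zero]
  | zero => simp
  | add x y hx hy h h' =>
    have : QuadraticMap.polar QK x y = 0 := h2 x hx hy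
    rw [QuadraticMap.map_add QK, h, h', this]; simp
  | smul a x _ h => rw [QuadraticMap.map_smul, h, smul_zero]

/-- A filtration has at most one type. -/
theorem filtrationsOfType_unique {D : ℕ} {φ ψ : PieceIndex D QK}
    (hφ : F ∈ filtrationsOfType Q ι QK φ) (hψ : F ∈ filtrationsOfType Q ι QK ψ) : φ = ψ := by
  rcases φ with ⟨f, hf⟩ | ⟨⟨j, hj⟩, ⟨f, hf⟩⟩ <;> rcases ψ with ⟨f', hf'⟩ | ⟨⟨j', hj'⟩, ⟨f', hf'⟩⟩
  · obtain rfl : f = f' := Finsupp.ext fun a => (hφ a).symm.trans (hψ a)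
    rfl
  · obtain rfl : f = f' := Finsupp.ext fun a => (hφ a).symm.trans (hψ.1 a)
    exact absurd hf'.2.2 (hf.2 hf'.2.1).ne'
  · obtain rfl : f = f' := Finsupp.ext fun a => (hφ.1 a).symm.trans (hψ a)
    exact absurd hf.2.2 (hf'.2 hf.2.1).ne'
  · obtain rfl : f = f' := Finsupp.ext fun a => (hφ.1 a).symm.trans (hψ.1 a)
    obtain rfl : j = j' := isotropicOrbits_eq hj hj' hφ.2.2 hψ.2.2
    rfl

end Types

section SpecialOrthogonal

variable {k : Type u} [Field k] {K : Type*} [Field K] [Algebra k K]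
  {V : Type v} [AddCommGroup V] [Module k V] [FiniteDimensional k V]
  {W : Type*} [AddCommGroup W] [Module K W] [Module k W] [IsScalarTower k K W]
  {Q : QuadraticForm k V} {ι : V →ₗ[k] W} {QK : QuadraticForm K W} {F : QFiltration Q}

/-- As `N` raises degrees by two, `1 + N` acts trivially on the graded space and is contracted to `1`. -/
theorem one_add_mem_unipotentSO [Infinite K] (hQ : IsNondeg Q) (hι : IsBaseChange K ι)
    (hQK : ∀ v, QK (ι v) = algebraMap k K (Q v)) {N : Module.End k V} (hN : N ∈ F.E2geStar) :
    1 + N ∈ unipotentSO Q ι QK := by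
  obtain ⟨⟨hO, hU⟩, hA⟩ := QFiltration.mem_E2geStar_iff.mp hN
  refine ⟨⟨hO, hι.endHom (1 + N), ?_, fun v => hι.endHom_comp_apply _ v⟩, hU⟩
  refine endHom_mem_identityComponent hQ hι hQK hO (F := F) fun a x hx => ?_
  rw [LinearMap.add_apply, Module.End.one_apply, add_sub_cancel_left]
  exact F.antitone (by omega) (hA.map_mem a x hx)

/-- If `g` is in `SO_Q` and `g r` is contracted to `1` for a reflection `r`, then `r` is in the identity
component, which the Dickson invariant excludes. -/
theorem not_isOddShift [Infinite K] (hQ : IsNondeg Q) (hι : IsBaseChange K ι)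
    (hQK : ∀ v, QK (ι v) = algebraMap k K (Q v)) {g : Module.End k V}
    (hg : g ∈ specialOrth Q ι QK) : ¬IsOddShift Q (g - 1) := by
  rintro ⟨h2, hR, w, hw, F, hF⟩
  obtain ⟨hgO, g', hg', hgg'⟩ := hg
  rw [endHom_eq hι hgg'] at hg'
  let r : Module.End k V := 1 + (Q.polarBilin w).smulRight w
  have hr : ∀ x, r x = x + QuadraticMap.polar Q w x • w := fun x => rfl
  have hww : QuadraticMap.polar Q w w = 0 := by
    rw [QuadraticMap.polar_self, hw, nsmul_eq_mul]
    push_cast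
    rw [h2, zero_mul]
  have hrr : r * r = 1 := by
    refine LinearMap.ext fun x => ?_
    have h3 : QuadraticMap.polar Q w x • w + QuadraticMap.polar Q w x • w = 0 := by
      rw [← two_smul k, h2, zero_smul]
    rw [Module.End.mul_apply, hr (r x), hr x, QuadraticMap.polar_add_right,
      QuadraticMap.polar_smul_right, hww, smul_zero, add_zero, add_assoc, h3, add_zero,
      Module.End.one_apply]
  have hrO : r ∈ orthGroup Q := by
    refine ⟨⟨⟨r, r, hrr, hrr⟩, rfl⟩, fun x => ?_⟩
    rw [hr, QuadraticMap.map_add Q, QuadraticMap.map_smul, QuadraticMap.polar_smul_right,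
      QuadraticMap.polar_comm Q x, hw]
    simp only [smul_eq_mul]
    linear_combination QuadraticMap.polar Q w x ^ 2 * h2
  have hgr : (hι.endHom (g * r) : Module.End K W) ∈ identityComponent QK := by
    refine endHom_mem_identityComponent hQ hι hQK (mul_mem_orthGroup hgO hrO) (F := F)
      fun a x hx => ?_
    have := hF a x hx
    rwa [add_sub_cancel] at this
  obtain ⟨h, hh, hh1, -⟩ := exists_inv_identityComponent hg'
  have hrmem : (hι.endHom r : Module.End K W) ∈ identityComponent QK := by
    have h3 : (hι.endHom r : Module.End K W) = h * hι.endHom (g * r) := by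
      rw [endHom_mul, ← mul_assoc, hh1, one_mul]
    rw [h3]
    exact mul_mem_identityComponent hh hgr
  let b := Module.finBasis k V
  let S : Matrix (Fin (Module.finrank k V)) (Fin (Module.finrank k V)) k :=
    LinearMap.BilinForm.toMatrix b Q.polarBilin
  have hSdet : IsUnit S.det := by
    rw [isUnit_iff_ne_zero, ← LinearMap.BilinForm.nondegenerate_iff_det_ne_zero b]
    refine ⟨fun x hx => hR x hx, fun x hx => hR x fun y => ?_⟩
    rw [QuadraticMap.polar_comm]
    exact hx y
  refine reflection_notMem_identityComponent (T := S⁻¹.map (algebraMap k K)) ?_ (hι.basis b) QK ?_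
    (w := ι w) ?_ (g := hι.endHom r) (fun x => ?_) hrmem
  · rw [← map_ofNat (algebraMap k K) 2, h2, map_zero]
  · have h3 : Matrix.of (fun i j => QuadraticMap.polar QK (hι.basis b i) (hι.basis b j)) =
        S.map (algebraMap k K) := by
      ext i j
      rw [Matrix.of_apply, IsBaseChange.basis_apply, IsBaseChange.basis_apply, polar_extend hQK,
        Matrix.map_apply]
      exact congrArg (algebraMap k K)
        (LinearMap.BilinForm.toMatrix_apply b Q.polarBilin i j).symm
    rw [h3, ← Matrix.map_mul, Matrix.mul_nonsing_inv _ hSdet]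
    simp
  · rw [hQK, hw, map_one]
  · have h3 : (1 + (QK.polarBilin (ι w)).smulRight (ι w) : Module.End K W) = hι.endHom r := by
      refine endHom_eq hι fun v => ?_
      rw [hr, map_add, map_smul, ← algebraMap_smul K, ← polar_extend hQK]
      rfl
    rw [← h3]
    rfl

theorem existsUnique_filtration [Infinite K] (hsq : (2 : k) = 0 → ∀ c : k, ∃ d, d ^ 2 = c)
    (hQ : IsNondeg Q) (hι : IsBaseChange K ι) (hQK : ∀ v, QK (ι v) = algebraMap k K (Q v))
    {g : Module.End k V} (hg : g ∈ unipotentSO Q ι QK) :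
    ∃! F : QFiltration Q, g - 1 ∈ F.E2geStar := by
  have hshift : g - 1 ∈ unipShift Q := by
    change 1 + (g - 1) ∈ orthGroup Q ∧ IsUnipotent (1 + (g - 1))
    rw [add_sub_cancel]
    exact ⟨hg.1.1, hg.2⟩
  obtain ⟨F, hF⟩ := (exists_isAdapted hsq hQ hshift.1.2 hg.2).resolve_right
    (not_isOddShift hQ hι hQK hg.1)
  refine ⟨F, QFiltration.mem_E2geStar_iff.mpr ⟨hshift, hF⟩, fun F' hF' => ?_⟩
  exact (QFiltration.mem_E2geStar_iff.mp hF').2.unique hQ hF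

theorem finrank_span_image_le (ι : V →ₗ[k] W) (U : Submodule k V) :
    Module.finrank K (Submodule.span K (ι '' (U : Set V))) ≤ Module.finrank k U := by
  let b := Module.finBasis k U
  have h : Submodule.span K (ι '' (U : Set V)) ≤
      Submodule.span K (Set.range fun i => ι (b i : V)) := by
    rw [Submodule.span_le]
    rintro _ ⟨u, hu, rfl⟩
    have h1 : u = ∑ i, b.repr ⟨u, hu⟩ i • (b i : V) := by
      have h2 := congrArg U.subtype (b.sum_repr ⟨u, hu⟩)
      simp only [map_sum, map_smul, Submodule.subtype_apply] at h2
      exact h2.symm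
    rw [h1, map_sum]
    refine Submodule.sum_mem _ fun i _ => ?_
    rw [map_smul, ← algebraMap_smul K]
    exact Submodule.smul_mem _ _ (Submodule.subset_span ⟨i, rfl⟩)
  have hfin : FiniteDimensional K (Submodule.span K (Set.range fun i => ι (b i : V))) :=
    FiniteDimensional.span_of_finite K (Set.finite_range _)
  refine (Submodule.finrank_mono h).trans ?_
  have h3 := finrank_range_le_card (R := K) fun i => ι (b i : V)
  rw [Fintype.card_fin] at h3
  exact h3

theorem finrank_span_image (hι : IsBaseChange K ι) (U : Submodule k V) :
    Module.finrank K (Submodule.span K (ι '' (U : Set V))) = Module.finrank k U := by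
  obtain ⟨C, hC⟩ := U.exists_isCompl
  have hB := hι.basis (Module.finBasis k V)
  have hfin : Module.Finite K W := Module.Finite.of_basis hB
  have hW : Module.finrank K W = Module.finrank k V := by
    rw [Module.finrank_eq_card_basis hB, Fintype.card_fin]
  have htop : Submodule.span K (ι '' (U : Set V)) ⊔ Submodule.span K (ι '' (C : Set V)) = ⊤ := by
    rw [eq_top_iff, ← (hι.basis (Module.finBasis k V)).span_eq, Submodule.span_le]
    rintro _ ⟨i, rfl⟩
    rw [IsBaseChange.basis_apply]
    have h1 : Module.finBasis k V i ∈ U ⊔ C := by rw [hC.sup_eq_top]; trivial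
    obtain ⟨x, hx, y, hy, hxy⟩ := Submodule.mem_sup.mp h1
    rw [← hxy, map_add]
    exact Submodule.add_mem_sup (Submodule.subset_span ⟨x, hx, rfl⟩)
      (Submodule.subset_span ⟨y, hy, rfl⟩)
  have h1 := Submodule.finrank_add_le_finrank_add_finrank (Submodule.span K (ι '' (U : Set V)))
    (Submodule.span K (ι '' (C : Set V)))
  rw [htop, finrank_top, hW] at h1
  have h2 := Submodule.finrank_add_eq_of_isCompl hC
  have h3 := finrank_span_image_le (K := K) ι U
  have h4 := finrank_span_image_le (K := K) ι C
  omega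

theorem X_zero_eq_X_one (h : Module.finrank k (F.gr 0) = 0) : F.X 0 = F.X 1 := by
  have h1 := F.finrank_gr 0
  rw [h, zero_add] at h1
  exact (Submodule.eq_of_le_of_finrank_eq (F.succ_le 0) h1).symm

/-- If `gr^0 X = 0`, then `X^{≥ 0}` is an isotropic subspace of half the dimension. -/
theorem span_X_zero_mem_halfIsotropic (hQ : IsNondeg Q) (hι : IsBaseChange K ι)
    (hQK : ∀ v, QK (ι v) = algebraMap k K (Q v)) (h : F.X 0 = F.X 1) :
    Submodule.span K (ι '' (F.X 0 : Set V)) ∈ halfIsotropic QK := by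
  have hiso : ∀ x ∈ F.X 0, Q x = 0 := fun x hx => F.isotropic 1 le_rfl x (h ▸ hx)
  refine ⟨?_, span_image_isotropic hQK hiso⟩
  have h1 := finrank_add_finrank_perp hQ hiso
  have h2 : perp Q (F.X 0) = F.X 0 := by
    have h3 := F.X_eq_perp (a := 0) le_rfl
    rw [sub_zero, ← h] at h3
    exact h3.symm
  rw [h2] at h1
  rw [finrank_span_image hι, Module.finrank_eq_card_basis (hι.basis (Module.finBasis k V)),
    Fintype.card_fin]
  omega

end SpecialOrthogonal

section Pieces

variable {k : Type u} [Field k] {K : Type*} [Field K] [Algebra k K]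
  {V : Type v} [AddCommGroup V] [Module k V] [FiniteDimensional k V]
  {W : Type*} [AddCommGroup W] [Module K W] [Module k W] [IsScalarTower k K W]
  {Q : QuadraticForm k V} {ι : V →ₗ[k] W} {QK : QuadraticForm K W} {F : QFiltration Q}

theorem exists_type (hQ : IsNondeg Q) (hι : IsBaseChange K ι)
    (hQK : ∀ v, QK (ι v) = algebraMap k K (Q v)) {N : Module.End k V} (hN : N ∈ F.E2geStar) :
    ∃ φ : PieceIndex (Module.finrank k V) QK, F ∈ filtrationsOfType Q ι QK φ := by
  obtain ⟨⟨hO, -⟩, hA⟩ := QFiltration.mem_E2geStar_iff.mp hN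
  obtain ⟨f, hf, hfF⟩ := hA.exists_dimVector hQ hO.2
  by_cases h0 : Even (Module.finrank k V) ∧ f 0 = 0
  · have hX : F.X 0 = F.X 1 := X_zero_eq_X_one ((hfF 0).trans h0.2)
    refine ⟨Sum.inr (⟨_, ⟨_, span_X_zero_mem_halfIsotropic hQ hι hQK hX, rfl⟩⟩,
      ⟨f, hf, h0⟩), hfF, hX, 1, one_mem_identityComponent, ?_⟩
    rw [Module.End.one_eq_id, Submodule.map_id]
  · exact ⟨Sum.inl ⟨f, hf, fun h => Nat.pos_of_ne_zero fun h' => h0 ⟨h, h'⟩⟩, hfF⟩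

theorem bijOn_Psi [Infinite K] (hsq : (2 : k) = 0 → ∀ c : k, ∃ d, d ^ 2 = c)
    (hQ : IsNondeg Q) (hι : IsBaseChange K ι) (hQK : ∀ v, QK (ι v) = algebraMap k K (Q v)) :
    Set.BijOn (Psi Q ι QK (Module.finrank k V)) Set.univ (unipotentSO Q ι QK) := by
  refine ⟨?_, ?_, ?_⟩
  · rintro ⟨φ, ⟨⟨F, N⟩, -, hN⟩⟩ -
    exact one_add_mem_unipotentSO hQ hι hQK hN
  · rintro ⟨φ, ⟨⟨F, N⟩, hF, hN⟩⟩ - ⟨ψ, ⟨⟨F', N'⟩, hF', hN'⟩⟩ - h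
    obtain rfl : N = N' := add_left_cancel (a := (1 : Module.End k V)) h
    obtain rfl : F = F' := (QFiltration.mem_E2geStar_iff.mp hN).2.unique hQ
      (QFiltration.mem_E2geStar_iff.mp hN').2
    obtain rfl : φ = ψ := filtrationsOfType_unique hF hF'
    rfl
  · intro g hg
    obtain ⟨F, hF, -⟩ := existsUnique_filtration hsq hQ hι hQK hg
    obtain ⟨φ, hφ⟩ := exists_type hQ hι hQK hF
    exact ⟨⟨φ, ⟨⟨F, g - 1⟩, hφ, hF⟩⟩, trivial, add_sub_cancel 1 g⟩

end Pieces

theorem exists_sq_eq {k : Type*} [Field k] (hk : IsAlgClosed k ∨ Finite k) (h2 : (2 : k) = 0)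
    (c : k) : ∃ d, d ^ 2 = c := by
  rcases hk with hk | hk
  · exact IsAlgClosed.exists_pow_nat_eq c two_pos
  · have hinj : Function.Injective fun d : k => d ^ 2 := fun a b h =>
      sq_eq_sq_of_two_eq_zero h2 h
    exact Finite.surjective_of_injective hinj c

end OrthUnip

end

theorem theorem1p7
    {k : Type*} [Field k] (hk : IsAlgClosed k ∨ Finite k)
    {K : Type*} [Field K] [Algebra k K] [IsAlgClosure k K]
    {V : Type*} [AddCommGroup V] [Module k V] [FiniteDimensional k V]
    (hV : 2 ≤ Module.finrank k V)
    (Q : QuadraticForm k V) (hQ : OrthUnip.IsNondeg Q)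
    {W : Type*} [AddCommGroup W] [Module K W] [Module k W] [IsScalarTower k K W]
    (ι : V →ₗ[k] W) (hι : IsBaseChange K ι)
    (QK : QuadraticForm K W) (hQK : ∀ v, QK (ι v) = algebraMap k K (Q v)) :
    (∀ g ∈ OrthUnip.unipotentSO Q ι QK,
      ∃! F : OrthUnip.QFiltration Q, g - 1 ∈ F.E2geStar) ∧
    Set.BijOn (OrthUnip.Psi Q ι QK (Module.finrank k V)) Set.univ
      (OrthUnip.unipotentSO Q ι QK) ∧
    ((⋃ φ : OrthUnip.PieceIndex (Module.finrank k V) QK, OrthUnip.pieceXi Q ι QK φ) =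
        OrthUnip.unipotentSO Q ι QK ∧
      Pairwise fun φ ψ : OrthUnip.PieceIndex (Module.finrank k V) QK =>
        Disjoint (OrthUnip.pieceXi Q ι QK φ) (OrthUnip.pieceXi Q ι QK ψ)) := by
  have hsq := OrthUnip.exists_sq_eq hk
  have hK : IsAlgClosed K := IsAlgClosure.isAlgClosed k
  have hinf : Infinite K := IsAlgClosed.instInfinite
  have hbij := OrthUnip.bijOn_Psi hsq hQ hι hQK
  refine ⟨fun g hg => OrthUnip.existsUnique_filtration hsq hQ hι hQK hg, hbij, ?_, ?_⟩
  · ext g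
    rw [Set.mem_iUnion, ← hbij.image_eq]
    constructor
    · rintro ⟨φ, p, rfl⟩
      exact ⟨⟨φ, p⟩, trivial, rfl⟩
    · rintro ⟨⟨φ, p⟩, -, rfl⟩
      exact ⟨φ, p, rfl⟩
  · intro φ ψ hne
    rw [Set.disjoint_left]
    rintro _ ⟨p, rfl⟩ ⟨p', h⟩
    exact hne (congrArg Sigma.fst (hbij.injOn trivial trivial h))
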